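/- Let $D\ge 1$, let $\Sigma\in\mathbb R^{D\times D}$ be symmetric positive definite with distinct eigenvalues $\sigma_1^2>\dots>\sigma_D^2>0$ ($\sigma_i>0$), let $p_0=\mathcal N(0,\Sigma)$, and put $S(\Sigma)=\sum_{i=1}^D\max(\sigma_i,\sigma_i^2)$. *Diffusion.* Let $T>0$ and let $w:[0,T]\to\mathbb R$ be such that $w^2$ is integrable; put $b_t=e^{-\int_0^t w_s^2\,ds}$, $a_t=\sqrt{1-b_t^2}$, and assume that $t\mapsto a_t$ is strictly increasing on $[0,T]$. Let $\bar a^{-2}:\mathbb R\cup\{\infty\}\to[0,T]$ be the extended inverse of $t\mapsto a_t^2$: it is $0$ on $(-\infty,0)$, the inverse function on $[0,a_T^2]$, and $T$ on $(a_T^2,\infty]$. *Data and empirical PCA.* Let $X_1,\dots,X_n$ ($n\ge1$) be i.i.d. with law $p_0$, let $\hat\Sigma=\frac1n\sum_{i=1}^n X_iX_i^\top$, and let $\hat\Sigma=\hat O\,\mathrm{diag}(\hat\sigma_1^2,\dots,\hat\sigma_D^2)\,\hat O^\top$ be a spectral decomposition, with $\hat O$ orthogonal and $\hat\sigma_1\ge\dots\ge\hat\sigma_D\ge0$.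 Let $P_d\in\mathbb R^{d\times D}$ be the projection on the first $d$ coordinates. Given the data, let $(\hat X_t)_{t\in[0,T]}$ be a solution of the plug-in backward equation $$d\hat X_t=\big(w_{T-t}^2\hat X_t+2w_{T-t}^2\,\hat s(\hat X_t,T-t)\big)dt+\sqrt{2w_{T-t}^2}\,dW_t,\qquad \hat X_0\sim\mathcal N(0,a_T^2I_D+b_T^2\hat\Sigma),$$ where $\hat s(x,t)=-(a_t^2I_D+b_t^2\hat\Sigma)^{-1}x$ and $W$ is a standard $D$-dimensional Brownian motion independent of $\hat X_0$. *Fréchet distance.* For Gaussian laws, $d_F^2(\mathcal N(\mu_1,\Sigma_1),\mathcal N(\mu_2,\Sigma_2))=\|\mu_1-\mu_2\|^2+\mathrm{tr}\big(\Sigma_1+\Sigma_2-2(\Sigma_2^{1/2}\Sigma_1\Sigma_2^{1/2})^{1/2}\big)$. *Thresholds.* For a constant $C>0$ and $u\ge0$ let $\varepsilon_u=\frac{8C}{3}\Big(\sqrt{\frac{D+u}{n}}+\frac{D+u}{n}\Big)$. For $d\in\{2,\dots,D\}$ put $$\hat T_d(u)=T-\bar a^{-2}\left(\frac{\hat\sigma_d^2-4S(\Sigma)\varepsilon_u+2\hat\sigma_d\sqrt{\hat\sigma_d^2-4S(\Sigma)\varepsilon_u}}{(1-\hat\sigma_d^2)_+}\right),\qquad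 \hat t_d(u)=T-\bar a^{-2}\left(\frac{\hat\sigma_d^2+4S(\Sigma)\varepsilon_u+2\hat\sigma_d\sqrt{\hat\sigma_d^2+4S(\Sigma)\varepsilon_u}}{(1-\hat\sigma_d^2)_+}\right),$$ where a quotient with denominator $0$ is $\infty$, and $\hat T_1(u)=0$, $\hat t_{D+1}(u)=T$. The thresholds are called *well defined* if $\hat\sigma_d^2>4S(\Sigma)\varepsilon_u$ for all $d\in\{2,\dots,D\}$. *Claim.* There is a universal constant $C>0$ such that, for every $\Sigma$ as above, there is $\varepsilon_0>0$ depending only on $\Sigma$ with the following property. For all $T,w,n$ and $X_1,\dots,X_n$ as above and every $u\ge0$ there is an event of probability at least $1-2e^{-u}$ on which: 1. if $\varepsilon_u\le\varepsilon_0$, then the thresholds are well defined; 2. whenever the thresholds are well defined, for every $d\in\{1,\dots,D\}$ with $\hat t_{d+1}(u)>0$ and every $t\in[\hat T_d(u),\hat t_{d+1}(u)]$, $$d_F\big(\hat OP_d^\top P_d\hat O^\top\hat X_t,\;p_0\big)=\min_{d'\in\{1,\dots,D\}}d_F\big(\hat OP_{d'}^\top P_{d'}\hat O^\top\hat X_t,\;p_0\big),$$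 where $d_F$ is taken between $p_0$ and the law of the projected process given the data. -/

import Mathlib

open MeasureTheory ProbabilityTheory Filter Topology
open scoped NNReal ENNReal MatrixOrder

noncomputable section

namespace LatentDiffusion

/-! ### Variance-preserving noise schedule -/

/-- `b_t = exp (-∫₀ᵗ w_s² ds)`. -/
def signalScale (w : ℝ → ℝ) (t : ℝ) : ℝ :=
  Real.exp (-∫ s in (0 : ℝ)..t, w s ^ 2)

/-- `a_t = √(1 - b_t²)`. -/
def noiseScale (w : ℝ → ℝ) (t : ℝ) : ℝ :=
  Real.sqrt (1 - signalScale w t ^ 2)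

/-- The extended inverse of `t ↦ a_t²` on `[0, T]`: it is `0` on negative arguments, the inverse
function on `[0, a_T²]`, and `T` on `(a_T², ∞]`. -/
def invNoiseSq (w : ℝ → ℝ) (T : ℝ) (x : EReal) : ℝ :=
  open Classical in
  if x < 0 then 0
  else if x ≤ ((noiseScale w T ^ 2 : ℝ) : EReal) then
    Function.invFunOn (fun t => noiseScale w t ^ 2) (Set.Icc 0 T) x.toReal
  else T

/-- The quotient `x / y₊`, equal to `∞` when the positive part `y₊` vanishes. -/
def divPosPart (x y : ℝ) : EReal :=
  open Classical in
  if max y 0 = 0 then ⊤ else ((x / max y 0 : ℝ) : EReal)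

/-! ### Brownian motion, Wiener integrals and the plug-in backward diffusion -/

/-- A standard `D`-dimensional Brownian motion: its coordinates are independent standard real
Brownian motions. -/
structure IsBrownianVec {D : ℕ} {Ω : Type*} [MeasurableSpace Ω]
    (W : ℝ≥0 → Ω → EuclideanSpace ℝ (Fin D)) (P : Measure Ω) : Prop where
  brownian_coord : ∀ i, IsBrownianReal (fun t ω => W t ω i) P
  indep_coord : iIndepFun (fun (i : Fin D) (ω : Ω) (t : ℝ≥0) => W t ω i) P

/-- Data of a deterministic step function on `[0, ∞)`, with value `coef i` on
`(node i, node (i + 1)]` for `i < size`, and zero elsewhere. -/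
structure StepFn where
  size : ℕ
  node : ℕ → ℝ≥0
  node_mono : Monotone node
  coef : ℕ → ℝ

/-- The step function itself. -/
def StepFn.eval (φ : StepFn) (s : ℝ) : ℝ :=
  ∑ i ∈ Finset.range φ.size,
    (Set.Ioc (φ.node i : ℝ) (φ.node (i + 1))).indicator (fun _ => φ.coef i) s

/-- The elementary stochastic integral `∫₀ᵗ φ dW` of a step function. -/
def StepFn.integral {D : ℕ} {Ω : Type*} (φ : StepFn)
    (W : ℝ≥0 → Ω → EuclideanSpace ℝ (Fin D)) (t : ℝ≥0) (ω : Ω) : EuclideanSpace ℝ (Fin D) :=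
  ∑ i ∈ Finset.range φ.size,
    φ.coef i • (W (min (φ.node (i + 1)) t) ω - W (min (φ.node i) t) ω)

/-- `I` is (a version of) the Wiener integral `∫₀ᵗ g dW` of the deterministic scalar function `g`:
the limit in `L²` of elementary integrals of step functions that converge to `g` in
`L²(0, t)`. -/
def IsWienerIntegral {D : ℕ} {Ω : Type*} [MeasurableSpace Ω] (P : Measure Ω)
    (W : ℝ≥0 → Ω → EuclideanSpace ℝ (Fin D)) (g : ℝ → ℝ) (t : ℝ≥0)
    (I : Ω → EuclideanSpace ℝ (Fin D)) : Prop :=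
  ∃ φ : ℕ → StepFn,
    Tendsto (fun k => eLpNorm (fun s => (φ k).eval s - g s) 2
      (volume.restrict (Set.Ioc 0 (t : ℝ)))) atTop (𝓝 0) ∧
    Tendsto (fun k => eLpNorm (fun ω => (φ k).integral W t ω - I ω) 2 P) atTop (𝓝 0)

/-- The covariance matrix `a_t² I + b_t² S` at time `t` of the forward diffusion started from
`N(0, S)`. -/
def forwardCov {D : ℕ} (w : ℝ → ℝ) (S : Matrix (Fin D) (Fin D) ℝ) (t : ℝ) :
    Matrix (Fin D) (Fin D) ℝ :=
  noiseScale w t ^ 2 • (1 : Matrix (Fin D) (Fin D) ℝ) + signalScale w t ^ 2 • S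

/-- The score `s(x, t) = -(a_t² I + b_t² S)⁻¹ x` of `N(0, a_t² I + b_t² S)`. -/
def gaussianScore {D : ℕ} (w : ℝ → ℝ) (S : Matrix (Fin D) (Fin D) ℝ)
    (x : EuclideanSpace ℝ (Fin D)) (t : ℝ) : EuclideanSpace ℝ (Fin D) :=
  -(Matrix.toEuclideanCLM (𝕜 := ℝ) (forwardCov w S t)⁻¹ x)

/-- The drift `w_{T-t}² x + 2 w_{T-t}² s(x, T - t)` of the backward diffusion. -/
def backwardDrift {D : ℕ} (w : ℝ → ℝ) (T : ℝ) (S : Matrix (Fin D) (Fin D) ℝ)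
    (t : ℝ) (x : EuclideanSpace ℝ (Fin D)) : EuclideanSpace ℝ (Fin D) :=
  w (T - t) ^ 2 • x + (2 * w (T - t) ^ 2) • gaussianScore w S x (T - t)

/-- `Y` is, on `[0, T]`, a solution driven by the Brownian motion `W` of the backward stochastic
differential equation
`dY_t = (w_{T-t}² Y_t + 2 w_{T-t}² s(Y_t, T - t)) dt + √(2 w_{T-t}²) dW_t`,
`Y_0 ∼ N(0, a_T² I + b_T² S)`, where `s` is the score computed from the covariance matrix `S`.
The equation is understood in integrated form. -/
structure IsBackwardDiffusion {D : ℕ} {Ω : Type*} [MeasurableSpace Ω] (P : Measure Ω)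
    (w : ℝ → ℝ) (T : ℝ) (S : Matrix (Fin D) (Fin D) ℝ)
    (W : ℝ≥0 → Ω → EuclideanSpace ℝ (Fin D))
    (Y : ℝ → Ω → EuclideanSpace ℝ (Fin D)) : Prop where
  brownian : IsBrownianVec W P
  aemeasurable : ∀ t ∈ Set.Icc 0 T, AEMeasurable (Y t) P
  continuous_paths : ∀ᵐ ω ∂P, ContinuousOn (fun t => Y t ω) (Set.Icc 0 T)
  law_init : HasLaw (Y 0) (multivariateGaussian 0 (forwardCov w S T)) P
  indep_init : IndepFun (Y 0) (fun (ω : Ω) (t : ℝ≥0) => W t ω) P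
  integrable_drift : ∀ᵐ ω ∂P,
    IntervalIntegrable (fun s => backwardDrift w T S s (Y s ω)) volume 0 T
  equation : ∀ t ∈ Set.Icc 0 T,
    IsWienerIntegral P W (fun s => Real.sqrt (2 * w (T - s) ^ 2)) t.toNNReal
      (fun ω => Y t ω - Y 0 ω - ∫ s in (0 : ℝ)..t, backwardDrift w T S s (Y s ω))

/-! ### The Fréchet distance -/

/-- The matrix of covariances of the coordinates under `μ`. -/
def covMatrix {D : ℕ} (μ : Measure (EuclideanSpace ℝ (Fin D))) : Matrix (Fin D) (Fin D) ℝ :=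
  Matrix.of fun i j => cov[fun x => x i, fun x => x j; μ]

/-- The Fréchet distance
`d_F² = ‖m₁ - m₂‖² + tr (Σ₁ + Σ₂ - 2 (Σ₂^{1/2} Σ₁ Σ₂^{1/2})^{1/2})` between two (Gaussian)
distributions with means `mᵢ` and covariance matrices `Σᵢ`. -/
def frechetDist {D : ℕ} (μ₁ μ₂ : Measure (EuclideanSpace ℝ (Fin D))) : ℝ :=
  Real.sqrt (‖(∫ x, x ∂μ₁) - ∫ x, x ∂μ₂‖ ^ 2 +
    (covMatrix μ₁ + covMatrix μ₂ -
      (2 : ℝ) • CFC.sqrt (CFC.sqrt (covMatrix μ₂) * covMatrix μ₁ *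
        CFC.sqrt (covMatrix μ₂))).trace)

/-! ### Empirical principal components and the time thresholds -/

/-- The empirical covariance matrix `(1/n) ∑ᵢ xᵢ xᵢᵀ`. -/
def empCov {D n : ℕ} (x : Fin n → EuclideanSpace ℝ (Fin D)) : Matrix (Fin D) (Fin D) ℝ :=
  (n : ℝ)⁻¹ • ∑ i, Matrix.vecMulVec (fun j => x i j) (fun j => x i j)

/-- `S = O diag(s₁², …, s_D²) Oᵀ` with `O` orthogonal and `s₁ ≥ ⋯ ≥ s_D ≥ 0`. -/
structure IsSpectralDecomp {D : ℕ} (S O : Matrix (Fin D) (Fin D) ℝ) (s : Fin D → ℝ) : Prop where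
  orthogonal : O ∈ Matrix.orthogonalGroup (Fin D) ℝ
  nonneg : ∀ i, 0 ≤ s i
  antitone : Antitone s
  eq : S = O * Matrix.diagonal (fun i => s i ^ 2) * O.transpose

/-- The `d × D` matrix `P_d` keeping the first `d` coordinates. -/
def coordProj (D d : ℕ) : Matrix (Fin d) (Fin D) ℝ :=
  Matrix.of fun i j => if i.val = j.val then 1 else 0

/-- The matrix `O P_dᵀ P_d Oᵀ`. -/
def pcaProj {D : ℕ} (O : Matrix (Fin D) (Fin D) ℝ) (d : ℕ) : Matrix (Fin D) (Fin D) ℝ :=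
  O * (coordProj D d).transpose * coordProj D d * O.transpose

/-- `∑_d max(σ_d, σ_d²)`. -/
def spectralSum {D : ℕ} (σ : Fin D → ℝ) : ℝ :=
  ∑ i, max (σ i) (σ i ^ 2)

/-- `ε_u = (8C/3) (√((D+u)/n) + (D+u)/n)`. -/
def estError (C : ℝ) (D n : ℕ) (u : ℝ) : ℝ :=
  8 * C / 3 * (Real.sqrt ((D + u) / n) + (D + u) / n)

/-- The threshold `T̂_d`, with `T̂_1 = 0`. Here `e` stands for `S(Σ) ε_u`, and the index `d` runs
through `1, …, D`, so that `s_d` is the entry of `s` at position `d - 1`. -/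
def upperThreshold {D : ℕ} (w : ℝ → ℝ) (T : ℝ) (s : Fin D → ℝ) (e : ℝ) (d : ℕ) : ℝ :=
  if h : 2 ≤ d ∧ d ≤ D then
    let r : ℝ := s ⟨d - 1, by omega⟩
    T - invNoiseSq w T
      (divPosPart (r ^ 2 - 4 * e + 2 * r * Real.sqrt (r ^ 2 - 4 * e)) (1 - r ^ 2))
  else 0

/-- The threshold `t̂_d`, for `2 ≤ d ≤ D + 1`, with `t̂_{D+1} = T`. Here `e` stands for
`S(Σ) ε_u`. -/
def lowerThreshold {D : ℕ} (w : ℝ → ℝ) (T : ℝ) (s : Fin D → ℝ) (e : ℝ) (d : ℕ) : ℝ :=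
  if h : 2 ≤ d ∧ d ≤ D then
    let r : ℝ := s ⟨d - 1, by omega⟩
    T - invNoiseSq w T
      (divPosPart (r ^ 2 + 4 * e + 2 * r * Real.sqrt (r ^ 2 + 4 * e)) (1 - r ^ 2))
  else T

end LatentDiffusion

end

open LatentDiffusion

/-!
The covariance matrix of the backward diffusion is explicit. In the eigenbasis of `Σ̂` each
coordinate of `Ŷ_t` solves a scalar linear equation driven by a Wiener integral, so an integrating
factor and the Itô isometry give the first two moments: at noise level `a = a_{T-t}²` the
coordinates are centred and uncorrelated with variances `c_i = a + (1 - a) σ̂_i²`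
(`IsBackwardDiffusion.moments`). Hence the squared Fréchet distance of the projection on the first
`k` components to `N(0, Σ)` is `tr Σ + ∑_{i ≤ k} c_i - 2 Φ(k)`, with `Φ(k)` the fidelity
`tr (√Σ M_k √Σ)^{1/2}` of `Σ` and the covariance matrix `M_k` of the projection
(`frechetDist_eq_sqrt_latentCost`).

If `Σ` and `Σ̂` were equal, `Φ(k)` would be `∑_{i ≤ k} √c_i σ̂_i`, and the `k`-th component would
contribute `c_k - 2 √c_k σ̂_k`, whose sign is decided by comparing `√c_k` with `2 σ̂_k`. In general,
if `Σ̂` and `Σ` are comparable up to the factor `(1 + η)²` in the order of quadratic forms, operator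
monotonicity of the square root shows that `Φ(k)` has its ideal value up to the factor `1 + η`
(`Matrix.trace_sqrt_fidelity_le`, `fidelity_bounds`). The increments of the cost in `k` are then
known up to an error of at most `4 S(Σ) ε_u`, and the thresholds are the noise levels at which the
perturbed quadratic expressions in `√c_k` change sign. Monotonicity in the singular value extends
the two inequalities at `d` and `d + 1` to all components (`latentCost_le_of_mem_thresholds`).
Components with `σ̂_k ≥ 1` have no finite threshold; for them the error has to be measured relative
to `√c_k` (`latentCost_succ_le`).

The comparability of `Σ̂` and `Σ` with `η` a multiple of `√((D + u) / n) + (D + u) / n` has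
probability at least `1 - 2 e^{-u}`: the exponential deviation bound for the `χ²` distribution is
applied in each direction of a net of the sphere (`exists_event_empCov_close`). If the thresholds
are well defined, `η` is automatically small, so no further assumption on `n` is needed.
-/

/-! ### Square roots of positive semidefinite matrices -/

namespace Matrix

variable {ι : Type*} [Fintype ι] [DecidableEq ι]

/-- The square root is operator monotone on real positive semidefinite matrices. If `v` is an
eigenvector of `√B - √A` for the eigenvalue `l`, then
`vᵀ (B - A) v = l * vᵀ (√A + √B) v`, so that `l < 0` is impossible. -/
theorem posSemidef_sqrt_sub_sqrt {A B : Matrix ι ι ℝ} (hA : A.PosSemidef)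
    (hAB : (B - A).PosSemidef) : (CFC.sqrt B - CFC.sqrt A).PosSemidef := by
  have hB : B.PosSemidef := by simpa using hAB.add hA
  have hX : (CFC.sqrt A).PosSemidef := nonneg_iff_posSemidef.1 (CFC.sqrt_nonneg A)
  have hY : (CFC.sqrt B).PosSemidef := nonneg_iff_posSemidef.1 (CFC.sqrt_nonneg B)
  have hXX : CFC.sqrt A * CFC.sqrt A = A := CFC.sqrt_mul_sqrt_self A hA.nonneg
  have hYY : CFC.sqrt B * CFC.sqrt B = B := CFC.sqrt_mul_sqrt_self B hB.nonneg
  generalize CFC.sqrt A = X at *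
  generalize CFC.sqrt B = Y at *
  have hZ : (Y - X).IsHermitian := hY.1.sub hX.1
  rw [hZ.posSemidef_iff_eigenvalues_nonneg]
  intro i
  by_contra! hneg
  set l := hZ.eigenvalues i
  have hl : l < 0 := hneg
  set v : ι → ℝ := (hZ.eigenvectorBasis i).ofLp
  have hv : (Y - X) *ᵥ v = l • v := hZ.mulVec_eigenvectorBasis i
  have hvv : v ⬝ᵥ v = 1 := by
    have h1 := (hZ.eigenvectorBasis.orthonormal).1 i
    have h2 := real_inner_self_eq_norm_sq (hZ.eigenvectorBasis i)
    rw [h1] at h2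
    rw [EuclideanSpace.inner_eq_star_dotProduct] at h2
    simpa using h2
  have hXv : 0 ≤ v ⬝ᵥ X *ᵥ v := by simpa using hX.dotProduct_mulVec_nonneg v
  have hYv : 0 ≤ v ⬝ᵥ Y *ᵥ v := by simpa using hY.dotProduct_mulVec_nonneg v
  have hD : 0 ≤ v ⬝ᵥ (B - A) *ᵥ v := by simpa using hAB.dotProduct_mulVec_nonneg v
  have hsym : ∀ u, v ⬝ᵥ (Y - X) *ᵥ u = l * (v ⬝ᵥ u) := by
    intro u
    have ht : (Y - X)ᵀ = Y - X := by simpa [IsHermitian] using hZ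
    rw [dotProduct_mulVec, ← mulVec_transpose, ht, hv, smul_dotProduct, smul_eq_mul]
  have hdec : (2 : ℝ) • (B - A) = (Y - X) * (Y + X) + (Y + X) * (Y - X) := by
    rw [← hXX, ← hYY, two_smul]; noncomm_ring
  have hdec' : 2 * (v ⬝ᵥ (B - A) *ᵥ v) = 2 * l * (v ⬝ᵥ Y *ᵥ v + v ⬝ᵥ X *ᵥ v) := by
    have h := congrArg (fun M => v ⬝ᵥ M *ᵥ v) hdec
    simp only [smul_mulVec, dotProduct_smul, smul_eq_mul, add_mulVec, ← mulVec_mulVec,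
      dotProduct_add, hv, mulVec_smul, hsym] at h
    rw [h]; ring
  have hdiff : v ⬝ᵥ Y *ᵥ v - v ⬝ᵥ X *ᵥ v = l := by
    have := hsym v
    rwa [hvv, mul_one, sub_mulVec, dotProduct_sub] at this
  nlinarith

theorem trace_sqrt_le_trace_sqrt {A B : Matrix ι ι ℝ} (hA : A.PosSemidef)
    (hAB : (B - A).PosSemidef) : (CFC.sqrt A).trace ≤ (CFC.sqrt B).trace := by
  have := (posSemidef_sqrt_sub_sqrt hA hAB).trace_nonneg
  rw [trace_sub] at this
  linarith

theorem PosSemidef.trace_sqrt {A : Matrix ι ι ℝ} (hA : A.PosSemidef) :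
    (CFC.sqrt A).trace = (A.charpoly.roots.map Real.sqrt).sum := by
  rw [CFC.sqrt_eq_cfc, cfc_nnreal_eq_real _ A, hA.1.cfc_eq, hA.1.roots_charpoly_eq_eigenvalues]
  simp only [IsHermitian.cfc, Unitary.conjStarAlgAut_apply]
  rw [trace_mul_cycle]
  simp [trace_diagonal, Function.comp_def, Real.coe_toNNReal', hA.eigenvalues_nonneg]

/-- `AᵀA` and `AAᵀ` have the same characteristic polynomial, hence square roots of the same
trace. -/
theorem trace_sqrt_transpose_mul_self (A : Matrix ι ι ℝ) :
    (CFC.sqrt (Aᵀ * A)).trace = (CFC.sqrt (A * Aᵀ)).trace := by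
  have h1 : (Aᵀ * A).PosSemidef := by simpa using posSemidef_conjTranspose_mul_self A
  have h2 : (A * Aᵀ).PosSemidef := by simpa using posSemidef_self_mul_conjTranspose A
  rw [h1.trace_sqrt, h2.trace_sqrt, charpoly_mul_comm]

theorem orthogonal_conj_mul {O : Matrix ι ι ℝ} (hO : O ∈ orthogonalGroup ι ℝ) (A B : Matrix ι ι ℝ) :
    O * A * Oᵀ * (O * B * Oᵀ) = O * (A * B) * Oᵀ := by
  have h : Oᵀ * O = 1 := (mem_orthogonalGroup_iff' _ _).1 hO
  calc O * A * Oᵀ * (O * B * Oᵀ) = O * A * (Oᵀ * O) * B * Oᵀ := by noncomm_ring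
    _ = _ := by rw [h]; noncomm_ring

theorem posSemidef_conj_diagonal (O : Matrix ι ι ℝ) {d : ι → ℝ} (hd : ∀ i, 0 ≤ d i) :
    (O * diagonal d * Oᵀ).PosSemidef := by
  simpa using (posSemidef_diagonal_iff.2 hd).mul_mul_conjTranspose_same O

theorem sqrt_conj_diagonal {O : Matrix ι ι ℝ} (hO : O ∈ orthogonalGroup ι ℝ) {d : ι → ℝ}
    (hd : ∀ i, 0 ≤ d i) :
    CFC.sqrt (O * diagonal d * Oᵀ) = O * diagonal (fun i => √(d i)) * Oᵀ := by
  refine CFC.sqrt_unique ?_ (posSemidef_conj_diagonal O fun i => Real.sqrt_nonneg _).nonneg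
  rw [orthogonal_conj_mul hO, diagonal_mul_diagonal]
  simp [Real.mul_self_sqrt, hd]

theorem trace_conj_diagonal {O : Matrix ι ι ℝ} (hO : O ∈ orthogonalGroup ι ℝ) (d : ι → ℝ) :
    (O * diagonal d * Oᵀ).trace = ∑ i, d i := by
  have h : Oᵀ * O = 1 := (mem_orthogonalGroup_iff' _ _).1 hO
  rw [trace_mul_cycle, h, one_mul, trace_diagonal]

theorem sqrt_smul_of_posSemidef {A : Matrix ι ι ℝ} (hA : A.PosSemidef) {r : ℝ} (hr : 0 ≤ r) :
    CFC.sqrt (r ^ 2 • A) = r • CFC.sqrt A := by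
  refine CFC.sqrt_unique ?_ ?_
  · rw [smul_mul_smul_comm, CFC.sqrt_mul_sqrt_self A hA.nonneg, sq]
  · exact ((nonneg_iff_posSemidef.1 (CFC.sqrt_nonneg A)).smul hr).nonneg

/-- The fidelity `tr (√M A √M)^{1/2}` is symmetric in its two arguments. -/
theorem trace_sqrt_fidelity_comm {A M : Matrix ι ι ℝ} (hA : A.PosSemidef) (hM : M.PosSemidef) :
    (CFC.sqrt (CFC.sqrt A * M * CFC.sqrt A)).trace =
      (CFC.sqrt (CFC.sqrt M * A * CFC.sqrt M)).trace := by
  have hX : (CFC.sqrt A)ᵀ = CFC.sqrt A := by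
    simpa using (nonneg_iff_posSemidef.1 (CFC.sqrt_nonneg A)).1.eq
  have hY : (CFC.sqrt M)ᵀ = CFC.sqrt M := by
    simpa using (nonneg_iff_posSemidef.1 (CFC.sqrt_nonneg M)).1.eq
  have hXX : CFC.sqrt A * CFC.sqrt A = A := CFC.sqrt_mul_sqrt_self A hA.nonneg
  have hYY : CFC.sqrt M * CFC.sqrt M = M := CFC.sqrt_mul_sqrt_self M hM.nonneg
  have h := trace_sqrt_transpose_mul_self (CFC.sqrt M * CFC.sqrt A)
  rw [transpose_mul, hX, hY] at h
  have e1 : CFC.sqrt A * CFC.sqrt M * (CFC.sqrt M * CFC.sqrt A) = CFC.sqrt A * M * CFC.sqrt A := by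
    conv_rhs => rw [← hYY]
    noncomm_ring
  have e2 : CFC.sqrt M * CFC.sqrt A * (CFC.sqrt A * CFC.sqrt M) = CFC.sqrt M * A * CFC.sqrt M := by
    conv_rhs => rw [← hXX]
    noncomm_ring
  rwa [e1, e2] at h

/-- The fidelity `tr (√A M √A)^{1/2}` is monotone in `A`, up to the homogeneity factor. -/
theorem trace_sqrt_fidelity_le {A B M : Matrix ι ι ℝ} (hA : A.PosSemidef) (hB : B.PosSemidef)
    (hM : M.PosSemidef) {r : ℝ} (hr : 0 ≤ r) (h : (r ^ 2 • B - A).PosSemidef) :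
    (CFC.sqrt (CFC.sqrt A * M * CFC.sqrt A)).trace ≤
      r * (CFC.sqrt (CFC.sqrt B * M * CFC.sqrt B)).trace := by
  rw [trace_sqrt_fidelity_comm hA hM, trace_sqrt_fidelity_comm hB hM]
  have hY : (CFC.sqrt M)ᵀ = CFC.sqrt M := by
    simpa using (nonneg_iff_posSemidef.1 (CFC.sqrt_nonneg M)).1.eq
  have key : ∀ {Z : Matrix ι ι ℝ}, Z.PosSemidef →
      (CFC.sqrt M * Z * CFC.sqrt M).PosSemidef := by
    intro Z hZ
    have := hZ.mul_mul_conjTranspose_same (CFC.sqrt M)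
    rwa [conjTranspose_eq_transpose_of_trivial, hY] at this
  have h1 := trace_sqrt_le_trace_sqrt (key hA) (B := r ^ 2 • (CFC.sqrt M * B * CFC.sqrt M)) (by
    have := key h
    rwa [mul_sub, sub_mul, mul_smul_comm, smul_mul_assoc] at this)
  rwa [sqrt_smul_of_posSemidef (key hB) hr, trace_smul, smul_eq_mul] at h1

theorem trace_sqrt_fidelity_conj_diagonal {O : Matrix ι ι ℝ} (hO : O ∈ orthogonalGroup ι ℝ)
    {c s : ι → ℝ} (hc : ∀ i, 0 ≤ c i) (hs : ∀ i, 0 ≤ s i) :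
    (CFC.sqrt (CFC.sqrt (O * diagonal (fun i => s i ^ 2) * Oᵀ) * (O * diagonal c * Oᵀ) *
      CFC.sqrt (O * diagonal (fun i => s i ^ 2) * Oᵀ))).trace = ∑ i, √(c i) * s i := by
  rw [sqrt_conj_diagonal hO fun i => sq_nonneg _]
  simp only [Real.sqrt_sq (hs _)]
  rw [orthogonal_conj_mul hO, orthogonal_conj_mul hO, diagonal_mul_diagonal, diagonal_mul_diagonal,
    sqrt_conj_diagonal hO fun i => mul_nonneg (mul_nonneg (hs i) (hc i)) (hs i),
    trace_conj_diagonal hO]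
  refine Finset.sum_congr rfl fun i _ => ?_
  rw [show s i * c i * s i = c i * s i ^ 2 by ring, Real.sqrt_mul (hc i), Real.sqrt_sq (hs i)]

end Matrix

/-! ### Nets of the sphere and deviations of Gaussian squares -/

/-- The unit sphere of a finite-dimensional space has a `1/2`-net of at most `5 ^ dim` points:
take a maximal `1/2`-separated subset. -/
theorem exists_finset_half_net_sphere (E : Type*) [NormedAddCommGroup E] [NormedSpace ℝ E]
    [FiniteDimensional ℝ E] :
    ∃ N : Finset E, N.card ≤ 5 ^ Module.finrank ℝ E ∧ (∀ y ∈ N, ‖y‖ = 1) ∧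
      ∀ x : E, ‖x‖ = 1 → ∃ y ∈ N, ‖x - y‖ ≤ 1 / 2 := by
  classical
  let Sep : Finset E → Prop := fun s =>
    (∀ y ∈ s, ‖y‖ = 1) ∧ ∀ c ∈ s, ∀ d ∈ s, c ≠ d → 1 / 2 ≤ ‖c - d‖
  have hcard : ∀ s, Sep s → s.card ≤ 5 ^ Module.finrank ℝ E := by
    rintro s ⟨h1, h2⟩
    have hinj : Function.Injective (fun y : E => (2 : ℝ) • y) :=
      smul_right_injective E (two_ne_zero)
    rw [← Finset.card_image_of_injective s hinj]
    refine Besicovitch.card_le_of_separated _ ?_ ?_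
    · intro c hc
      obtain ⟨y, hy, rfl⟩ := Finset.mem_image.1 hc
      simp [norm_smul, h1 y hy]
    · intro c hc d hd hcd
      obtain ⟨y, hy, rfl⟩ := Finset.mem_image.1 hc
      obtain ⟨z, hz, rfl⟩ := Finset.mem_image.1 hd
      have := h2 y hy z hz (fun h => hcd (by rw [h]))
      simp only [← smul_sub, norm_smul, Real.norm_ofNat]
      linarith
  have hne : {k | ∃ s, Sep s ∧ s.card = k}.Nonempty := ⟨0, ∅, by simp [Sep], rfl⟩
  have hbdd : BddAbove {k | ∃ s, Sep s ∧ s.card = k} :=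
    ⟨5 ^ Module.finrank ℝ E, by rintro k ⟨s, hs, rfl⟩; exact hcard s hs⟩
  obtain ⟨N, hN, hNcard⟩ := Nat.sSup_mem hne hbdd
  refine ⟨N, hcard N hN, hN.1, fun x hx => ?_⟩
  by_contra! hfar
  have hxN : x ∉ N := fun h => by
    have := hfar x h
    simp at this
    linarith
  have hins : Sep (insert x N) := by
    refine ⟨fun y hy => ?_, fun c hc d hd hcd => ?_⟩
    · rcases Finset.mem_insert.1 hy with rfl | h
      exacts [hx, hN.1 y h]
    · rcases Finset.mem_insert.1 hc with hc' | hc' <;> rcases Finset.mem_insert.1 hd with hd' | hd'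
      · exact absurd (hc'.trans hd'.symm) hcd
      · rw [hc']; exact (hfar d hd').le
      · rw [hd', norm_sub_rev]; exact (hfar c hc').le
      · exact hN.2 c hc' d hd' hcd
  have := le_csSup hbdd ⟨insert x N, hins, rfl⟩
  rw [Finset.card_insert_of_notMem hxN, hNcard] at this
  omega

/-- A quadratic form that is at most `δ` in absolute value on a `1/2`-net of the sphere is at most
`16 δ` on the sphere. -/
theorem abs_le_of_abs_le_on_half_net {E : Type*} [NormedAddCommGroup E] [InnerProductSpace ℝ E]
    [FiniteDimensional ℝ E] {Q : E → ℝ} (hcont : Continuous Q)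
    (hpar : ∀ x y, Q (x + y) + Q (x - y) = 2 * Q x + 2 * Q y)
    (hhom : ∀ (r : ℝ) x, Q (r • x) = r ^ 2 * Q x) {N : Set E} (hN : ∀ y ∈ N, ‖y‖ = 1)
    (hnet : ∀ x : E, ‖x‖ = 1 → ∃ y ∈ N, ‖x - y‖ ≤ 1 / 2) {δ : ℝ} (hδ : ∀ y ∈ N, |Q y| ≤ δ)
    (x : E) : |Q x| ≤ 16 * δ * ‖x‖ ^ 2 := by
  suffices hmain : ∀ x : E, ‖x‖ = 1 → |Q x| ≤ 16 * δ by
    rcases eq_or_ne x 0 with rfl | hx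
    · have := hhom 0 0
      simp at this
      simp [this]
    · have hx' : ‖x‖ ≠ 0 := norm_ne_zero_iff.2 hx
      have h1 := hmain (‖x‖⁻¹ • x) (by simp [norm_smul, hx'])
      have h2 : Q x = ‖x‖ ^ 2 * Q (‖x‖⁻¹ • x) := by
        rw [← hhom, smul_smul, mul_inv_cancel₀ hx', one_smul]
      rw [h2, abs_mul, abs_of_nonneg (sq_nonneg ‖x‖), mul_comm]
      gcongr
  intro x₀ hx₀
  obtain ⟨x, hx, hmax⟩ := (isCompact_sphere (0 : E) 1).exists_isMaxOn ⟨x₀, by simpa using hx₀⟩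
    (hcont.abs.continuousOn)
  have hx1 : ‖x‖ = 1 := by simpa using hx
  have hle : ∀ z : E, |Q z| ≤ |Q x| * ‖z‖ ^ 2 := by
    intro z
    rcases eq_or_ne z 0 with rfl | hz
    · have := hhom 0 0
      simp at this
      simp [this]
    · have hz' : ‖z‖ ≠ 0 := norm_ne_zero_iff.2 hz
      have h1 : |Q (‖z‖⁻¹ • z)| ≤ |Q x| := hmax (by simp [norm_smul, hz'])
      have h2 : Q z = ‖z‖ ^ 2 * Q (‖z‖⁻¹ • z) := by
        rw [← hhom, smul_smul, mul_inv_cancel₀ hz', one_smul]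
      rw [h2, abs_mul, abs_of_nonneg (sq_nonneg ‖z‖), mul_comm]
      gcongr
  refine (by simpa [hx₀] using hle x₀ : |Q x₀| ≤ |Q x|).trans ?_
  obtain ⟨y, hy, hxy⟩ := hnet x hx1
  have hy1 := hN y hy
  set ρ : ℝ := inner ℝ x y with hρdef
  have hρ : 7 / 8 ≤ ρ := by
    have h := norm_sub_sq_real x y
    rw [hx1, hy1, ← hρdef] at h
    nlinarith [norm_nonneg (x - y)]
  have hn1 : ‖y - ρ • x‖ ^ 2 = 1 - ρ ^ 2 := by
    rw [norm_sub_sq_real, norm_smul, inner_smul_right, real_inner_comm, ← hρdef, hx1, hy1,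
      mul_one, Real.norm_eq_abs, sq_abs]
    ring
  have hn2 : ‖ρ • x - (y - ρ • x)‖ ^ 2 = 1 := by
    rw [norm_sub_sq_real, hn1, norm_smul, inner_smul_left, inner_sub_right, inner_smul_right,
      ← hρdef, real_inner_self_eq_norm_sq, hx1, mul_one, Real.norm_eq_abs, sq_abs]
    simp
  have hp := hpar (ρ • x) (y - ρ • x)
  rw [add_sub_cancel, hhom] at hp
  have b1 := hle (y - ρ • x)
  have b2 := hle (ρ • x - (y - ρ • x))
  have b3 := hδ y hy
  rw [hn1] at b1
  rw [hn2] at b2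
  -- The bound `|Q y| ≥ (4 ρ² - 3) |Q x|` with `ρ ≥ 7/8`.
  have h4 : 1 / 16 ≤ 4 * ρ ^ 2 - 3 := by nlinarith
  have h5 : (4 * ρ ^ 2 - 3) * |Q x| ≤ |Q y| := by
    rcases abs_cases (Q x) with ⟨h, _⟩ | ⟨h, _⟩ <;> rw [h] at b1 b2 ⊢ <;>
      [refine le_trans ?_ (le_abs_self _); refine le_trans ?_ (neg_le_abs _)] <;>
      nlinarith [abs_le.1 b1, abs_le.1 b2]
  nlinarith [abs_nonneg (Q x)]

/-- The elementary inequality `-log (1 - x) ≤ x + x²` for `|x| ≤ 1/2`. -/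
theorem one_le_one_sub_mul_exp {x : ℝ} (hx : |x| ≤ 1 / 2) : 1 ≤ (1 - x) * Real.exp (x + x ^ 2) := by
  obtain ⟨h1, h2⟩ := abs_le.1 hx
  rcases le_total 0 x with h | h
  · have := Real.quadratic_le_exp_of_nonneg (show 0 ≤ x + x ^ 2 by positivity)
    have h3 : 1 ≤ (1 - x) * (1 + (x + x ^ 2) + (x + x ^ 2) ^ 2 / 2) := by
      nlinarith [mul_nonneg h h, mul_nonneg (mul_nonneg h h) h, pow_nonneg h 4, pow_nonneg h 5,
        mul_nonneg (pow_nonneg h 3) (show 0 ≤ 1 / 2 - x by linarith),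
        mul_nonneg (pow_nonneg h 2) (show 0 ≤ 1 / 2 - x by linarith)]
    nlinarith
  · have := Real.add_one_le_exp (x + x ^ 2)
    nlinarith [mul_nonneg (neg_nonneg.2 h) (sq_nonneg x)]

theorem integrable_exp_mul_sq_sub_one_gaussianReal {l : ℝ} (hl : l < 1 / 2) :
    Integrable (fun x => Real.exp (l * (x ^ 2 - 1))) (gaussianReal 0 1) := by
  rw [gaussianReal_of_var_ne_zero _ one_ne_zero, gaussianPDF_def,
    integrable_withDensity_iff_integrable_smul₀' (by fun_prop) (by simp)]
  have h : ∀ x : ℝ, (ENNReal.ofReal (gaussianPDFReal 0 1 x)).toReal • Real.exp (l * (x ^ 2 - 1)) =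
      ((√(2 * Real.pi))⁻¹ * Real.exp (-l)) * Real.exp (-(1 / 2 - l) * x ^ 2) := by
    intro x
    rw [ENNReal.toReal_ofReal (gaussianPDFReal_nonneg _ _ _), gaussianPDFReal, smul_eq_mul]
    simp only [NNReal.coe_one, mul_one, sub_zero]
    rw [mul_assoc, mul_assoc, ← Real.exp_add, ← Real.exp_add]
    ring_nf
  simp_rw [h]
  exact (integrable_exp_neg_mul_sq (by linarith)).const_mul _

/-- The centred square of a standard Gaussian variable is sub-exponential. -/
theorem integral_exp_mul_sq_sub_one_gaussianReal_le {l : ℝ} (hl : |l| ≤ 1 / 4) :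
    ∫ x, Real.exp (l * (x ^ 2 - 1)) ∂(gaussianReal 0 1) ≤ Real.exp (2 * l ^ 2) := by
  have hl2 := abs_le.1 hl
  have hpos : 0 < 1 - 2 * l := by linarith
  have h : ∀ x : ℝ, gaussianPDFReal 0 1 x • Real.exp (l * (x ^ 2 - 1)) =
      ((√(2 * Real.pi))⁻¹ * Real.exp (-l)) * Real.exp (-(1 / 2 - l) * x ^ 2) := by
    intro x
    rw [gaussianPDFReal, smul_eq_mul]
    simp only [NNReal.coe_one, mul_one, sub_zero]
    rw [mul_assoc, mul_assoc, ← Real.exp_add, ← Real.exp_add]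
    ring_nf
  rw [integral_gaussianReal_eq_integral_smul one_ne_zero]
  simp_rw [h]
  rw [integral_const_mul, integral_gaussian]
  have hsq : √(Real.pi / (1 / 2 - l)) = √(2 * Real.pi) * (√(1 - 2 * l))⁻¹ := by
    rw [← Real.sqrt_inv, ← Real.sqrt_mul (by positivity)]
    congr 1
    have : (1 / 2 - l) ≠ 0 := by linarith
    field_simp
  have hpi : √(2 * Real.pi) ≠ 0 := by positivity
  have hroot : 0 < √(1 - 2 * l) := Real.sqrt_pos.2 hpos
  rw [hsq, show (√(2 * Real.pi))⁻¹ * Real.exp (-l) * (√(2 * Real.pi) * (√(1 - 2 * l))⁻¹) =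
    Real.exp (-l) * (√(1 - 2 * l))⁻¹ by field_simp, ← div_eq_mul_inv, div_le_iff₀ hroot]
  have key := one_le_one_sub_mul_exp (x := 2 * l) (by rw [abs_mul, abs_two]; linarith)
  have e : (1 - 2 * l) * Real.exp (2 * l + (2 * l) ^ 2) =
      (√(1 - 2 * l) * Real.exp (l + 2 * l ^ 2)) ^ 2 := by
    rw [mul_pow (√(1 - 2 * l)), Real.sq_sqrt hpos.le, ← Real.exp_nat_mul]
    ring_nf
  rw [e] at key
  have h1 : 1 ≤ √(1 - 2 * l) * Real.exp (l + 2 * l ^ 2) := by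
    by_contra! hc
    nlinarith [mul_pos hroot (Real.exp_pos (l + 2 * l ^ 2))]
  calc Real.exp (-l) = Real.exp (-l) * 1 := (mul_one _).symm
    _ ≤ Real.exp (-l) * (√(1 - 2 * l) * Real.exp (l + 2 * l ^ 2)) := by gcongr
    _ = Real.exp (2 * l ^ 2) * √(1 - 2 * l) := by
      rw [Real.exp_add, Real.exp_neg]
      field_simp

/-- Chernoff bound for the empirical second moment of independent standard Gaussian variables. -/
theorem measureReal_abs_sum_sq_sub_one_le {Ω : Type*} [MeasurableSpace Ω] {μ : Measure Ω}
    [IsProbabilityMeasure μ] {n : ℕ} (hn : 0 < n) {g : Fin n → Ω → ℝ} (hg : iIndepFun g μ)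
    (hlaw : ∀ i, HasLaw (g i) (gaussianReal 0 1) μ) {s : ℝ} (hs : 0 ≤ s) :
    μ.real {ω | 9 * (√s + s) ≤ |(n : ℝ)⁻¹ * ∑ i, g i ω ^ 2 - 1|} ≤ 2 * Real.exp (-(2 * n * s)) := by
  have hn' : (0 : ℝ) < n := by exact_mod_cast hn
  -- the Chernoff parameter: of order `√s` in the Gaussian regime and constant for large deviations
  set l : ℝ := min (√s) 1 / 4 with hl
  have hl0 : 0 ≤ l := by positivity
  have hl1 : l ≤ 1 / 4 := by rw [hl]; linarith [min_le_right (√s) 1]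
  have hss : √s ^ 2 = s := Real.sq_sqrt hs
  have hls : s / 4 ≤ l * (√s + s) := by
    have h0 := Real.sqrt_nonneg s
    rcases le_total (√s) 1 with h | h
    · rw [hl, min_eq_left h]; nlinarith
    · rw [hl, min_eq_right h]; nlinarith
  have hll : l ^ 2 ≤ s / 16 := by
    have : min (√s) 1 ≤ √s := min_le_left _ _
    have h0 : 0 ≤ min (√s) 1 := by positivity
    rw [hl]; nlinarith
  let Z : Fin n → Ω → ℝ := fun i ω => g i ω ^ 2 - 1
  have hZind : iIndepFun Z μ := hg.comp (fun _ x => x ^ 2 - 1) (fun _ => by fun_prop)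
  have hZmeas : ∀ i, AEMeasurable (Z i) μ := fun i =>
    ((hlaw i).aemeasurable.pow_const 2).sub_const 1
  have hmgf : ∀ {r : ℝ}, |r| ≤ 1 / 4 → ∀ i, mgf (Z i) μ r ≤ Real.exp (2 * r ^ 2) := by
    intro r hr i
    have := (hlaw i).integral_comp (f := fun x => Real.exp (r * (x ^ 2 - 1))) (by fun_prop)
    simp only [mgf, Z]
    calc _ = _ := this
      _ ≤ _ := integral_exp_mul_sq_sub_one_gaussianReal_le hr
  have hint : ∀ {r : ℝ}, |r| ≤ 1 / 4 → ∀ i, Integrable (fun ω => Real.exp (r * Z i ω)) μ := by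
    intro r hr i
    have h1 := integrable_exp_mul_sq_sub_one_gaussianReal (l := r) (by linarith [abs_le.1 hr])
    rw [← (hlaw i).map_eq] at h1
    exact h1.comp_aemeasurable (hlaw i).aemeasurable
  have hsum : ∀ {r : ℝ}, |r| ≤ 1 / 4 → mgf (∑ i, Z i) μ r ≤ Real.exp (2 * r ^ 2 * n) := by
    intro r hr
    rw [hZind.mgf_sum₀ hZmeas]
    calc ∏ i, mgf (Z i) μ r ≤ ∏ _i : Fin n, Real.exp (2 * r ^ 2) :=
          Finset.prod_le_prod (fun i _ => mgf_nonneg) fun i _ => hmgf hr i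
      _ = Real.exp (2 * r ^ 2 * n) := by
          rw [Finset.prod_const, Finset.card_univ, Fintype.card_fin, ← Real.exp_nat_mul, mul_comm]
  have hintsum : ∀ {r : ℝ}, |r| ≤ 1 / 4 →
      Integrable (fun ω => Real.exp (r * (∑ i, Z i) ω)) μ := by
    intro r hr
    rw [← mgf_pos_iff, hZind.mgf_sum₀ hZmeas]
    exact Finset.prod_pos fun i _ => mgf_pos (hint hr i)
  set a : ℝ := n * (9 * (√s + s)) with ha
  have hsub : {ω | 9 * (√s + s) ≤ |(n : ℝ)⁻¹ * ∑ i, g i ω ^ 2 - 1|} ⊆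
      {ω | a ≤ (∑ i, Z i) ω} ∪ {ω | (∑ i, Z i) ω ≤ -a} := by
    intro ω hω
    have e : (∑ i, Z i) ω = n * ((n : ℝ)⁻¹ * ∑ i, g i ω ^ 2 - 1) := by
      simp only [Finset.sum_apply, Z, Finset.sum_sub_distrib, Finset.sum_const, Finset.card_univ,
        Fintype.card_fin, nsmul_eq_mul, mul_one]
      field_simp
    simp only [Set.mem_ofPred_eq, Set.mem_union, e, ha] at hω ⊢
    rcases le_abs'.1 hω with h | h
    · right
      nlinarith
    · left
      gcongr
  have hexp : -l * a + 2 * l ^ 2 * n ≤ -(2 * n * s) := by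
    rw [ha]
    nlinarith [mul_le_mul_of_nonneg_left hls hn'.le, mul_le_mul_of_nonneg_left hll hn'.le,
      mul_nonneg hn'.le hs]
  have hlabs : |l| ≤ 1 / 4 := by rwa [abs_of_nonneg hl0]
  have hlabs' : |-l| ≤ 1 / 4 := by rwa [abs_neg]
  have h1 : μ.real {ω | a ≤ (∑ i, Z i) ω} ≤ Real.exp (-(2 * n * s)) :=
    calc _ ≤ Real.exp (-l * a) * mgf (∑ i, Z i) μ l :=
          measure_ge_le_exp_mul_mgf a hl0 (hintsum hlabs)
      _ ≤ Real.exp (-l * a) * Real.exp (2 * l ^ 2 * n) := by gcongr; exact hsum hlabs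
      _ ≤ _ := by rw [← Real.exp_add]; exact Real.exp_le_exp.2 hexp
  have h2 : μ.real {ω | (∑ i, Z i) ω ≤ -a} ≤ Real.exp (-(2 * n * s)) :=
    calc _ ≤ Real.exp (-(-l) * -a) * mgf (∑ i, Z i) μ (-l) :=
          measure_le_le_exp_mul_mgf (-a) (by linarith) (hintsum hlabs')
      _ ≤ Real.exp (-(-l) * -a) * Real.exp (2 * (-l) ^ 2 * n) := by gcongr; exact hsum hlabs'
      _ ≤ _ := by
        rw [← Real.exp_add]
        refine Real.exp_le_exp.2 ?_
        nlinarith [hexp]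
  calc _ ≤ μ.real ({ω | a ≤ (∑ i, Z i) ω} ∪ {ω | (∑ i, Z i) ω ≤ -a}) := measureReal_mono hsub
    _ ≤ _ := measureReal_union_le _ _
    _ ≤ _ := by linarith

/-! ### Concentration of the empirical covariance matrix -/

namespace LatentDiffusion

open Matrix

theorem hasLaw_dotProduct_multivariateGaussian {D : ℕ} {Sig : Matrix (Fin D) (Fin D) ℝ}
    (hSig : Sig.PosSemidef) {x : Fin D → ℝ} (hx : x ⬝ᵥ Sig *ᵥ x = 1) :
    HasLaw (fun y : EuclideanSpace ℝ (Fin D) => x ⬝ᵥ y.ofLp) (gaussianReal 0 1)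
      (multivariateGaussian 0 Sig) := by
  set L : StrongDual ℝ (EuclideanSpace ℝ (Fin D)) := innerSL ℝ (WithLp.toLp 2 x) with hL
  have hfun : (fun y : EuclideanSpace ℝ (Fin D) => x ⬝ᵥ y.ofLp) = L := by
    ext y
    simp [hL, innerSL_apply_apply, EuclideanSpace.inner_eq_star_dotProduct, dotProduct_comm]
  rw [hfun]
  refine ⟨by fun_prop, ?_⟩
  rw [IsGaussian.map_eq_gaussianReal, L.integral_comp_id_comm IsGaussian.integrable_id]
  have hv : Var[L; multivariateGaussian 0 Sig] = 1 := by
    have := covarianceBilin_self (μ := multivariateGaussian 0 Sig) IsGaussian.memLp_two_id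
      (WithLp.toLp 2 x)
    rw [covarianceBilin_multivariateGaussian hSig] at this
    rw [← hx, this]
    rfl
  simp [hv]

theorem dotProduct_empCov_mulVec {D n : ℕ} (X : Fin n → EuclideanSpace ℝ (Fin D))
    (x : Fin D → ℝ) :
    x ⬝ᵥ empCov X *ᵥ x = (n : ℝ)⁻¹ * ∑ i, (x ⬝ᵥ (X i).ofLp) ^ 2 := by
  have h : ∀ i, x ⬝ᵥ vecMulVec (fun j => X i j) (fun j => X i j) *ᵥ x = (x ⬝ᵥ (X i).ofLp) ^ 2 := by
    intro i
    rw [vecMulVec_mulVec, dotProduct_smul, sq]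
    simp [dotProduct_comm]
  rw [empCov, smul_mulVec, dotProduct_smul, sum_mulVec, dotProduct_sum, smul_eq_mul]
  simp_rw [h]

theorem isHermitian_empCov {D n : ℕ} (X : Fin n → EuclideanSpace ℝ (Fin D)) :
    (empCov X).IsHermitian := by
  ext i j
  simp [empCov, Matrix.sum_apply, vecMulVec_apply, mul_comm]

/-- With probability at least `1 - 2 exp (-u)`, the empirical covariance matrix of a Gaussian
sample is comparable to the true one in the order of quadratic forms, with the dimension-dependent
relative error `144 (√((D + u) / n) + (D + u) / n)`. The deviation bound for a single direction is
applied on a net of the sphere. -/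
theorem exists_event_empCov_close {D n : ℕ} (hn : 0 < n) {Sig O : Matrix (Fin D) (Fin D) ℝ}
    {σ : Fin D → ℝ} (hO : O ∈ orthogonalGroup (Fin D) ℝ) (hσ : ∀ i, 0 < σ i)
    (hSig : Sig = O * diagonal (fun i => σ i ^ 2) * Oᵀ)
    {Ω : Type*} [MeasurableSpace Ω] {μ : Measure Ω} [IsProbabilityMeasure μ]
    {X : Fin n → Ω → EuclideanSpace ℝ (Fin D)} (hX : iIndepFun X μ)
    (hlaw : ∀ i, HasLaw (X i) (multivariateGaussian 0 Sig) μ) {u : ℝ} (hu : 0 ≤ u) :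
    ∃ E : Set Ω, MeasurableSet E ∧ 1 - 2 * Real.exp (-u) ≤ μ.real E ∧ ∀ ω ∈ E,
      ((1 + 144 * (√((D + u) / n) + (D + u) / n)) • Sig - empCov (fun i => X i ω)).PosSemidef ∧
      (empCov (fun i => X i ω) -
        (1 - 144 * (√((D + u) / n) + (D + u) / n)) • Sig).PosSemidef := by
  have hOO : Oᵀ * O = 1 := (mem_orthogonalGroup_iff' _ _).1 hO
  have hOO' : O * Oᵀ = 1 := (mem_orthogonalGroup_iff _ _).1 hO
  have hn' : (0 : ℝ) < n := by exact_mod_cast hn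
  have hPSD : Sig.PosSemidef := by
    rw [hSig]; exact posSemidef_conj_diagonal O fun i => sq_nonneg _
  set s : ℝ := (D + u) / n with hs
  have hs0 : 0 ≤ s := by positivity
  set q : ℝ := √s + s with hq
  -- `v z = Σ^{-1/2} z` up to a rotation: it turns the form of `Σ` into the Euclidean norm.
  let v : EuclideanSpace ℝ (Fin D) → Fin D → ℝ := fun z => O *ᵥ fun i => (σ i)⁻¹ * z i
  have hvSig : ∀ z, v z ⬝ᵥ Sig *ᵥ v z = ‖z‖ ^ 2 := by
    intro z
    have h1 : Sig *ᵥ v z = O *ᵥ fun i => σ i * z i := by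
      simp only [v]
      rw [hSig, mulVec_mulVec, mul_assoc, hOO, mul_one, ← mulVec_mulVec]
      congr 1
      ext i
      rw [mulVec_diagonal]
      have := (hσ i).ne'
      field_simp
    rw [h1]
    simp only [v]
    rw [dotProduct_mulVec, ← mulVec_transpose, mulVec_mulVec, hOO, one_mulVec,
      EuclideanSpace.real_norm_sq_eq, dotProduct]
    refine Finset.sum_congr rfl fun i _ => ?_
    have := (hσ i).ne'
    field_simp
  have hvadd : ∀ y z, v (y + z) = v y + v z := by
    intro y z
    simp only [v, ← mulVec_add]
    congr 1; ext i; simp [mul_add]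
  have hvsmul : ∀ (r : ℝ) z, v (r • z) = r • v z := by
    intro r z
    simp only [v, ← mulVec_smul]
    congr 1; ext i; simp; ring
  have hvsub : ∀ y z, v (y - z) = v y - v z := by
    intro y z
    simp only [v, ← mulVec_sub]
    congr 1; ext i; simp [mul_sub]
  have hvcont : Continuous v := by
    refine Continuous.matrix_mulVec continuous_const ?_
    fun_prop
  let Q : Ω → EuclideanSpace ℝ (Fin D) → ℝ := fun ω z =>
    (n : ℝ)⁻¹ * ∑ i, (v z ⬝ᵥ (X i ω).ofLp) ^ 2 - ‖z‖ ^ 2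
  obtain ⟨N, hNcard, hN1, hNnet⟩ := exists_finset_half_net_sphere (EuclideanSpace ℝ (Fin D))
  let bad : Set Ω := ⋃ z ∈ N, {ω | 9 * q ≤ |Q ω z|}
  have hbad : μ.real bad ≤ 2 * Real.exp (-u) := by
    have h1 : ∀ z ∈ N, μ.real {ω | 9 * q ≤ |Q ω z|} ≤ 2 * Real.exp (-(2 * n * s)) := by
      intro z hz
      have hlawz : ∀ i, HasLaw (fun ω => v z ⬝ᵥ (X i ω).ofLp) (gaussianReal 0 1) μ := fun i =>
        (hasLaw_dotProduct_multivariateGaussian hPSD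
          (x := v z) (by rw [hvSig, hN1 z hz, one_pow])).fun_comp (hlaw i)
      have hind : iIndepFun (fun i ω => v z ⬝ᵥ (X i ω).ofLp) μ :=
        hX.comp (fun _ y => v z ⬝ᵥ y.ofLp) (fun _ => by simp only [dotProduct]; fun_prop)
      have := measureReal_abs_sum_sq_sub_one_le hn hind hlawz hs0
      simpa only [Q, hN1 z hz, one_pow] using this
    have h5 : (5 : ℝ) ≤ Real.exp 2 := by
      have := Real.exp_one_gt_d9
      rw [show (2 : ℝ) = 1 + 1 by norm_num, Real.exp_add]
      nlinarith
    -- the net has at most `5 ^ D ≤ exp (2 D)` points, which the deviation bound compensates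
    calc μ.real bad ≤ ∑ z ∈ N, μ.real {ω | 9 * q ≤ |Q ω z|} := measureReal_biUnion_finset_le _ _
      _ ≤ ∑ z ∈ N, 2 * Real.exp (-(2 * n * s)) := Finset.sum_le_sum h1
      _ = N.card * (2 * Real.exp (-(2 * n * s))) := by simp
      _ ≤ Real.exp (2 * D) * (2 * Real.exp (-(2 * n * s))) := by
        gcongr
        calc (N.card : ℝ) ≤ 5 ^ D := by
              have : (N.card : ℝ) ≤ (5 ^ Module.finrank ℝ (EuclideanSpace ℝ (Fin D)) : ℕ) := by
                exact_mod_cast hNcard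
              simpa using this
          _ ≤ Real.exp 2 ^ D := by gcongr
          _ = Real.exp (2 * D) := by rw [← Real.exp_nat_mul]; ring_nf
      _ ≤ 2 * Real.exp (-u) := by
        rw [mul_left_comm, ← Real.exp_add]
        gcongr
        have : n * s = D + u := by rw [hs]; field_simp
        nlinarith
  refine ⟨(toMeasurable μ bad)ᶜ, (measurableSet_toMeasurable _ _).compl, ?_, ?_⟩
  · rw [measureReal_compl (measurableSet_toMeasurable _ _), probReal_univ, measureReal_def,
      measure_toMeasurable, ← measureReal_def]
    linarith
  intro ω hω
  have hgood : ∀ z ∈ (N : Set (EuclideanSpace ℝ (Fin D))), |Q ω z| ≤ 9 * q := by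
    intro z hz
    by_contra! h
    exact hω (subset_toMeasurable _ _ (Set.mem_biUnion hz h.le))
  have hall : ∀ z, |Q ω z| ≤ 144 * q * ‖z‖ ^ 2 := by
    intro z
    have := abs_le_of_abs_le_on_half_net (Q := Q ω) ?_ ?_ ?_ hN1 hNnet hgood z
    · linarith
    · simp only [Q]
      have : ∀ i, Continuous fun z => v z ⬝ᵥ (X i ω).ofLp := fun i =>
        hvcont.dotProduct continuous_const
      fun_prop
    · intro y z
      have h := parallelogram_law_with_norm ℝ y z
      have h2 : ∑ i, (v (y + z) ⬝ᵥ (X i ω).ofLp) ^ 2 + ∑ i, (v (y - z) ⬝ᵥ (X i ω).ofLp) ^ 2 =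
          2 * ∑ i, (v y ⬝ᵥ (X i ω).ofLp) ^ 2 + 2 * ∑ i, (v z ⬝ᵥ (X i ω).ofLp) ^ 2 := by
        simp only [Finset.mul_sum, ← Finset.sum_add_distrib, hvadd, hvsub, add_dotProduct,
          sub_dotProduct]
        exact Finset.sum_congr rfl fun i _ => by ring
      simp only [Q]
      linear_combination (n : ℝ)⁻¹ * h2 - h
    · intro r z
      simp only [Q, hvsmul, smul_dotProduct, smul_eq_mul, mul_pow, ← Finset.mul_sum, norm_smul,
        Real.norm_eq_abs, sq_abs]
      ring
  have hsurj : ∀ x : Fin D → ℝ, ∃ z, v z = x := by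
    intro x
    refine ⟨WithLp.toLp 2 fun i => σ i * (Oᵀ *ᵥ x) i, ?_⟩
    have : (fun i => (σ i)⁻¹ * (σ i * (Oᵀ *ᵥ x) i)) = Oᵀ *ᵥ x := by
      ext i
      have := (hσ i).ne'
      field_simp
    simp only [v]
    rw [this, mulVec_mulVec, hOO', one_mulVec]
  have hquad : ∀ x : Fin D → ℝ, |x ⬝ᵥ empCov (fun i => X i ω) *ᵥ x - x ⬝ᵥ Sig *ᵥ x| ≤
      144 * q * (x ⬝ᵥ Sig *ᵥ x) := by
    intro x
    obtain ⟨z, rfl⟩ := hsurj x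
    rw [dotProduct_empCov_mulVec, hvSig]
    exact hall z
  have hsm : ∀ r : ℝ, (r • Sig).IsHermitian := fun r => by
    rw [IsHermitian, conjTranspose_smul, hPSD.1.eq]; simp
  constructor
  · refine PosSemidef.of_dotProduct_mulVec_nonneg ((hsm _).sub (isHermitian_empCov _)) fun x => ?_
    have := abs_le.1 (hquad x)
    rw [sub_mulVec, smul_mulVec, dotProduct_sub, dotProduct_smul, star_trivial, smul_eq_mul]
    linarith
  · refine PosSemidef.of_dotProduct_mulVec_nonneg ((isHermitian_empCov _).sub (hsm _)) fun x => ?_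
    have := abs_le.1 (hquad x)
    rw [sub_mulVec, smul_mulVec, dotProduct_sub, dotProduct_smul, star_trivial, smul_eq_mul]
    linarith

end LatentDiffusion

/-! ### The noise schedule and the increments of the cost -/

namespace LatentDiffusion

section Schedule

variable {w : ℝ → ℝ} {T : ℝ}

theorem signalScale_pos (w : ℝ → ℝ) (t : ℝ) : 0 < signalScale w t := Real.exp_pos _

theorem signalScale_le_one (w : ℝ → ℝ) {t : ℝ} (ht : 0 ≤ t) : signalScale w t ≤ 1 := by
  rw [signalScale, Real.exp_le_one_iff, neg_nonpos]
  exact intervalIntegral.integral_nonneg ht fun s _ => sq_nonneg _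

theorem noiseScale_sq (w : ℝ → ℝ) {t : ℝ} (ht : 0 ≤ t) :
    noiseScale w t ^ 2 = 1 - signalScale w t ^ 2 := by
  rw [noiseScale, Real.sq_sqrt]
  have h1 := signalScale_le_one w ht
  have h2 := signalScale_pos w t
  nlinarith

theorem noiseScale_sq_lt_one (w : ℝ → ℝ) {t : ℝ} (ht : 0 ≤ t) : noiseScale w t ^ 2 < 1 := by
  rw [noiseScale_sq w ht]
  have := pow_pos (signalScale_pos w t) 2
  linarith

theorem continuousOn_signalScale (hT : 0 ≤ T)
    (hw : IntervalIntegrable (fun s => w s ^ 2) volume 0 T) :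
    ContinuousOn (signalScale w) (Set.Icc 0 T) := by
  have h := intervalIntegral.continuousOn_primitive_interval'
    (f := fun s => w s ^ 2) (μ := volume) (a := 0) (b₁ := 0) (b₂ := T) hw Set.left_mem_uIcc
  rw [Set.uIcc_of_le hT] at h
  exact h.neg.rexp

/-- On `[0, T]`, the extended inverse takes values in `[0, T]` and inverts `t ↦ a_t²` on
`[0, a_T²]`. -/
theorem invNoiseSq_mem_Icc (hT : 0 ≤ T) (hw : IntervalIntegrable (fun s => w s ^ 2) volume 0 T)
    (x : EReal) :
    invNoiseSq w T x ∈ Set.Icc 0 T ∧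
      ∀ y : ℝ, x = y → 0 ≤ y → y ≤ noiseScale w T ^ 2 →
        noiseScale w (invNoiseSq w T x) ^ 2 = y := by
  have hcont : ContinuousOn (fun t => noiseScale w t ^ 2) (Set.Icc 0 T) :=
    ((continuousOn_signalScale hT hw).pow 2 |> fun h =>
      (continuousOn_const.sub h).sqrt).pow 2
  have h0 : noiseScale w 0 ^ 2 = 0 := by
    simp [noiseScale_sq w le_rfl, signalScale]
  have himage : ∀ y : ℝ, 0 ≤ y → y ≤ noiseScale w T ^ 2 →
      ∃ t ∈ Set.Icc 0 T, (fun t => noiseScale w t ^ 2) t = y := by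
    intro y hy hyT
    have := intermediate_value_Icc hT hcont
    rw [h0] at this
    exact this ⟨hy, hyT⟩
  constructor
  · rw [invNoiseSq]
    split_ifs with h1 h2
    · exact ⟨le_rfl, hT⟩
    · have hbot : x ≠ ⊥ := fun h => by simp [h] at h1
      have htop : x ≠ ⊤ := fun h => absurd (EReal.coe_lt_top _) (not_lt.2 (h ▸ h2))
      lift x to ℝ using ⟨htop, hbot⟩
      refine Function.invFunOn_mem (himage _ ?_ ?_)
      · simpa using h1
      · simpa using EReal.coe_le_coe_iff.1 h2
    · exact ⟨hT, le_rfl⟩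
  · rintro y rfl hy hyT
    rw [invNoiseSq, if_neg (by simpa using hy), if_pos (by exact_mod_cast hyT), EReal.toReal_coe]
    exact Function.invFunOn_eq (himage y hy hyT)

/-- Later than the threshold `T - ā⁻²(N / y₊)`, the squared noise level is at most `N / y`. A
nonpositive `y` puts the threshold at `0` and gives no information. -/
theorem noiseScale_sq_mul_le_of_sub_invNoiseSq_le (hT : 0 ≤ T)
    (hw : IntervalIntegrable (fun s => w s ^ 2) volume 0 T)
    (hmono : StrictMonoOn (noiseScale w) (Set.Icc 0 T)) {N y t : ℝ} (hN : 0 ≤ N)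
    (ht : t ∈ Set.Icc 0 T) (h : T - invNoiseSq w T (divPosPart N y) ≤ t) :
    y ≤ 0 ∨ noiseScale w (T - t) ^ 2 * y ≤ N := by
  rcases le_or_gt y 0 with hy | hy
  · exact Or.inl hy
  right
  have hdiv : divPosPart N y = ((N / y : ℝ) : EReal) := by
    rw [divPosPart, max_eq_left hy.le, if_neg hy.ne']
  rw [← le_div_iff₀ hy]
  have hTt : T - t ∈ Set.Icc 0 T := ⟨by linarith [ht.2], by linarith [ht.1]⟩
  have hle : ∀ {a b : ℝ}, a ∈ Set.Icc 0 T → b ∈ Set.Icc 0 T → a ≤ b →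
      noiseScale w a ^ 2 ≤ noiseScale w b ^ 2 := fun ha hb hab =>
    pow_le_pow_left₀ (Real.sqrt_nonneg _) (hmono.monotoneOn ha hb hab) 2
  rcases le_or_gt (N / y) (noiseScale w T ^ 2) with hc | hc
  · obtain ⟨h1, h2⟩ := invNoiseSq_mem_Icc hT hw (divPosPart N y)
    rw [← h2 _ hdiv (by positivity) hc]
    exact hle hTt h1 (by linarith)
  · exact (hle hTt (Set.right_mem_Icc.2 hT) hTt.2).trans hc.le

/-- Before the threshold `T - ā⁻²(N / y₊)`, the squared noise level is at least `N / y`. Positivity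
of the threshold excludes the cases in which the extended inverse is truncated to `T`. -/
theorem le_noiseScale_sq_mul_of_le_sub_invNoiseSq (hT : 0 ≤ T)
    (hw : IntervalIntegrable (fun s => w s ^ 2) volume 0 T)
    (hmono : StrictMonoOn (noiseScale w) (Set.Icc 0 T)) {N y t : ℝ} (hN : 0 ≤ N) (ht : 0 ≤ t)
    (hpos : 0 < T - invNoiseSq w T (divPosPart N y))
    (h : t ≤ T - invNoiseSq w T (divPosPart N y)) :
    0 < y ∧ N ≤ noiseScale w (T - t) ^ 2 * y := by
  have htop : invNoiseSq w T ⊤ = T := by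
    rw [invNoiseSq, if_neg (by simp), if_neg (not_le.2 (EReal.coe_lt_top _))]
  have hy : 0 < y := by
    by_contra! hy
    rw [divPosPart, max_eq_right hy, if_pos rfl, htop] at hpos
    simp at hpos
  have hdiv : divPosPart N y = ((N / y : ℝ) : EReal) := by
    rw [divPosPart, max_eq_left hy.le, if_neg hy.ne']
  have hNy : 0 ≤ N / y := by positivity
  obtain ⟨h1, h2⟩ := invNoiseSq_mem_Icc hT hw (divPosPart N y)
  have hc : N / y ≤ noiseScale w T ^ 2 := by
    by_contra! hc
    rw [hdiv, invNoiseSq, if_neg (by simpa using hNy), if_neg (by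
      rw [not_le]; exact_mod_cast hc)] at hpos
    simp at hpos
  refine ⟨hy, ?_⟩
  rw [← div_le_iff₀ hy, ← h2 _ hdiv hNy hc]
  exact pow_le_pow_left₀ (Real.sqrt_nonneg _)
    (hmono.monotoneOn h1 ⟨by linarith [h1.1], by linarith⟩ (by linarith)) 2

end Schedule

section Increments

/-- The part of the squared Fréchet distance that depends on the latent dimension `k`, with
`a + (1 - a) r_i²` the variance of the `i`-th principal component at noise level `a` and `Φ k` the
fidelity of the projected law and the target. -/
noncomputable def latentCost {D : ℕ} (a : ℝ) (r : Fin D → ℝ) (Φ : ℕ → ℝ) (k : ℕ) : ℝ :=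
  (∑ i, if i.val < k then a + (1 - a) * r i ^ 2 else 0) - 2 * Φ k

/-- The fidelity in the ideal case in which the empirical and the true covariance agree. -/
noncomputable def idealFidelity {D : ℕ} (a : ℝ) (r : Fin D → ℝ) (k : ℕ) : ℝ :=
  ∑ i, if i.val < k then √(a + (1 - a) * r i ^ 2) * r i else 0

theorem sum_ite_lt_succ {D : ℕ} (f : Fin D → ℝ) (i : Fin D) :
    (∑ j, if j.val < i.val + 1 then f j else 0) =
      (∑ j, if j.val < i.val then f j else 0) + f i := by
  have : ∀ j : Fin D, (if j.val < i.val + 1 then f j else 0) =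
      (if j.val < i.val then f j else 0) + if j = i then f j else 0 := by
    intro j
    rcases lt_trichotomy j.val i.val with h | h | h
    · simp [h, Nat.lt_succ_of_lt h, Fin.ne_of_lt h]
    · obtain rfl := Fin.ext h
      simp
    · have h1 : ¬ j.val < i.val + 1 := by omega
      have h2 : ¬ j.val < i.val := by omega
      simp [h1, h2, Fin.ne_of_gt h]
  simp only [this, Finset.sum_add_distrib, Finset.sum_ite_eq', Finset.mem_univ, if_true]

theorem idealFidelity_mono {D : ℕ} {a : ℝ} {r : Fin D → ℝ} (hr : ∀ i, 0 ≤ r i) (i : Fin D) :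
    idealFidelity a r i.val ≤ idealFidelity a r (i.val + 1) := by
  rw [idealFidelity, idealFidelity, sum_ite_lt_succ]
  have := mul_nonneg (Real.sqrt_nonneg (a + (1 - a) * r i ^ 2)) (hr i)
  linarith

theorem idealFidelity_nonneg {D : ℕ} {a : ℝ} {r : Fin D → ℝ} (hr : ∀ i, 0 ≤ r i)
    (k : ℕ) : 0 ≤ idealFidelity a r k :=
  Finset.sum_nonneg fun i _ => by
    split_ifs
    · exact mul_nonneg (Real.sqrt_nonneg _) (hr i)
    · exact le_rfl

theorem idealFidelity_le {D : ℕ} {a : ℝ} {r : Fin D → ℝ} (ha0 : 0 ≤ a) (ha1 : a ≤ 1)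
    (hr : ∀ i, 0 ≤ r i) (k : ℕ) :
    idealFidelity a r k ≤ ∑ i, (r i + r i ^ 2) := by
  refine Finset.sum_le_sum fun i _ => ?_
  have h := hr i
  have h1 : √(a + (1 - a) * r i ^ 2) ≤ 1 + r i :=
    Real.sqrt_le_iff.2 ⟨by linarith, by nlinarith [mul_nonneg ha0 (sq_nonneg (r i))]⟩
  split_ifs
  · nlinarith
  · positivity

/-- The increment of the cost, compared with its ideal value `c - 2 √c r_i`. The error is relative
to the total ideal fidelity, since the fidelities before and after the step are both perturbed. -/
theorem abs_latentCost_succ_sub_le {D : ℕ} {a η : ℝ} {r : Fin D → ℝ} {Φ : ℕ → ℝ}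
    (hr : ∀ i, 0 ≤ r i) (hη : 0 ≤ η) (hη1 : η ≤ 1)
    (hΦ : ∀ k, Φ k ≤ (1 + η) * idealFidelity a r k ∧ idealFidelity a r k ≤ (1 + η) * Φ k)
    (i : Fin D) :
    |latentCost a r Φ (i.val + 1) - latentCost a r Φ i.val -
      (a + (1 - a) * r i ^ 2 - 2 * (√(a + (1 - a) * r i ^ 2) * r i))| ≤
      4 * η * idealFidelity a r (i.val + 1) := by
  have e1 : idealFidelity a r (i.val + 1) = idealFidelity a r i.val +
      √(a + (1 - a) * r i ^ 2) * r i := by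
    rw [idealFidelity, sum_ite_lt_succ]; rfl
  have e2 : latentCost a r Φ (i.val + 1) - latentCost a r Φ i.val =
      a + (1 - a) * r i ^ 2 - 2 * (Φ (i.val + 1) - Φ i.val) := by
    rw [latentCost, latentCost, sum_ite_lt_succ]; ring
  have hm := idealFidelity_mono (a := a) hr i
  have hlow : ∀ k, (1 - η) * idealFidelity a r k ≤ Φ k := fun k => by
    have h1 := (hΦ k).2
    have h2 : 0 ≤ Φ k := by nlinarith [idealFidelity_nonneg (a := a) hr k]
    nlinarith [mul_nonneg (mul_nonneg hη hη) h2]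
  have h0 := idealFidelity_nonneg (a := a) hr i.val
  have h1 := hlow i.val
  have h2 := hlow (i.val + 1)
  have h3 := (hΦ i.val).1
  have h4 := (hΦ (i.val + 1)).1
  have h5 : η * idealFidelity a r i.val ≤ η * idealFidelity a r (i.val + 1) := by gcongr
  rw [e2, abs_le]
  constructor <;> nlinarith

/-- Adding the `i`-th principal component does not increase the cost while the noise level is
below the upper threshold. If `r i < 1`, the error is at most `4 e` and the threshold is the root
of the quadratic inequality. If `1 ≤ r i` there is no threshold; then `a + (1 - a) r_i² ≤ r_i²`,
and the sharper error bound relative to `√(a + (1 - a) r_i²)` is needed. -/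
theorem latentCost_succ_le {D : ℕ} {a e η : ℝ} {r : Fin D → ℝ} {Φ : ℕ → ℝ} (ha0 : 0 ≤ a)
    (ha1 : a ≤ 1) (hr : ∀ i, 0 ≤ r i) (hη : 0 ≤ η) (hη1 : η ≤ 1)
    (hΦ : ∀ k, Φ k ≤ (1 + η) * idealFidelity a r k ∧ idealFidelity a r k ≤ (1 + η) * Φ k)
    (herr : η * ∑ i, (r i + r i ^ 2) ≤ e) (hanti : Antitone r) {i : Fin D} (hwell : 4 * e < r i ^ 2)
    (h : 1 ≤ r i ∨ a * (1 - r i ^ 2) ≤ r i ^ 2 - 4 * e + 2 * r i * √(r i ^ 2 - 4 * e)) :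
    latentCost a r Φ (i.val + 1) ≤ latentCost a r Φ i.val := by
  have hinc := (abs_le.1 (abs_latentCost_succ_sub_le hr hη hη1 hΦ i)).2
  set c := a + (1 - a) * r i ^ 2 with hc
  have hri : 0 ≤ r i := hr i
  have hc0 : 0 ≤ c := by
    have : 0 ≤ (1 - a) * r i ^ 2 := mul_nonneg (by linarith) (sq_nonneg _)
    linarith
  have hsc : √c ^ 2 = c := Real.sq_sqrt hc0
  have hsc0 := Real.sqrt_nonneg c
  rcases le_or_gt 1 (r i) with h1 | h1
  · have hrel : idealFidelity a r (i.val + 1) * r i ≤ √c * ∑ j, r j ^ 2 := by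
      rw [idealFidelity, Finset.sum_mul, Finset.mul_sum]
      refine Finset.sum_le_sum fun j _ => ?_
      split_ifs with hj
      · have hji : r i ≤ r j := hanti (Fin.le_def.2 (by omega))
        have hkey : √(a + (1 - a) * r j ^ 2) * r i ≤ √c * r j := by
          have hcj : 0 ≤ a + (1 - a) * r j ^ 2 :=
            add_nonneg ha0 (mul_nonneg (by linarith) (sq_nonneg _))
          rw [show √(a + (1 - a) * r j ^ 2) * r i = √((a + (1 - a) * r j ^ 2) * r i ^ 2) by
            rw [Real.sqrt_mul hcj, Real.sqrt_sq hri], show √c * r j = √(c * r j ^ 2) by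
            rw [Real.sqrt_mul hc0, Real.sqrt_sq (hr j)]]
          apply Real.sqrt_le_sqrt
          have : r i ^ 2 ≤ r j ^ 2 := by gcongr
          rw [hc]
          nlinarith
        nlinarith [mul_le_mul_of_nonneg_left hkey (hr j)]
      · rw [zero_mul]; positivity
    have hS : η * ∑ j, r j ^ 2 ≤ e := by
      refine le_trans ?_ herr
      gcongr with j
      linarith [hr j]
    have hcr : √c ≤ r i := Real.sqrt_le_iff.2 ⟨hri, by
      nlinarith [mul_nonneg ha0 (show 0 ≤ r i ^ 2 - 1 by nlinarith)]⟩
    have h4 : 4 * η * idealFidelity a r (i.val + 1) * r i ≤ √c * r i * r i := by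
      have := mul_le_mul_of_nonneg_left hrel hη
      have := mul_le_mul_of_nonneg_left hS hsc0
      have := mul_le_mul_of_nonneg_left hwell.le hsc0
      nlinarith
    have h5 : 4 * η * idealFidelity a r (i.val + 1) ≤ √c * r i :=
      le_of_mul_le_mul_right h4 (by linarith)
    nlinarith
  · have h2 := h.resolve_left (not_le.2 h1)
    have h4 : 4 * η * idealFidelity a r (i.val + 1) ≤ 4 * e := by
      have := mul_le_mul_of_nonneg_left (idealFidelity_le ha0 ha1 hr (i.val + 1)) hη
      linarith
    have hd := Real.sq_sqrt (show 0 ≤ r i ^ 2 - 4 * e by linarith)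
    have hd0 := Real.sqrt_nonneg (r i ^ 2 - 4 * e)
    set δ := √(r i ^ 2 - 4 * e) with hδ
    have hup : √c ≤ r i + δ := Real.sqrt_le_iff.2 ⟨by positivity, by nlinarith⟩
    have hlo : r i ≤ √c := Real.le_sqrt_of_sq_le (by
      nlinarith [mul_nonneg ha0 (show 0 ≤ 1 - r i ^ 2 by nlinarith)])
    have : (√c - r i) ^ 2 ≤ δ ^ 2 := pow_le_pow_left₀ (by linarith) (by linarith) 2
    nlinarith

/-- Adding the `i`-th principal component does not decrease the cost while the noise level is
above the lower threshold. -/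
theorem latentCost_le_succ {D : ℕ} {a e η : ℝ} {r : Fin D → ℝ} {Φ : ℕ → ℝ} (ha0 : 0 ≤ a)
    (ha1 : a ≤ 1) (hr : ∀ i, 0 ≤ r i) (hη : 0 ≤ η) (hη1 : η ≤ 1)
    (hΦ : ∀ k, Φ k ≤ (1 + η) * idealFidelity a r k ∧ idealFidelity a r k ≤ (1 + η) * Φ k)
    (he : 0 ≤ e) (herr : η * ∑ i, (r i + r i ^ 2) ≤ e) {i : Fin D}
    (h : r i ^ 2 + 4 * e + 2 * r i * √(r i ^ 2 + 4 * e) ≤ a * (1 - r i ^ 2)) :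
    latentCost a r Φ i.val ≤ latentCost a r Φ (i.val + 1) := by
  have hinc := (abs_le.1 (abs_latentCost_succ_sub_le hr hη hη1 hΦ i)).1
  set c := a + (1 - a) * r i ^ 2 with hc
  have hri : 0 ≤ r i := hr i
  have hc0 : 0 ≤ c := by
    have : 0 ≤ (1 - a) * r i ^ 2 := mul_nonneg (by linarith) (sq_nonneg _)
    linarith
  have hsc : √c ^ 2 = c := Real.sq_sqrt hc0
  have h4 : 4 * η * idealFidelity a r (i.val + 1) ≤ 4 * e := by
    have := mul_le_mul_of_nonneg_left (idealFidelity_le ha0 ha1 hr (i.val + 1)) hη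
    linarith
  have hd := Real.sq_sqrt (show 0 ≤ r i ^ 2 + 4 * e by positivity)
  have hd0 := Real.sqrt_nonneg (r i ^ 2 + 4 * e)
  set δ := √(r i ^ 2 + 4 * e) with hδ
  have hlo : r i + δ ≤ √c := Real.le_sqrt_of_sq_le (by nlinarith)
  have : δ ^ 2 ≤ (√c - r i) ^ 2 := pow_le_pow_left₀ hd0 (by linarith) 2
  nlinarith

end Increments

end LatentDiffusion

/-! ### Optimality between the thresholds and the Fréchet distance -/

namespace LatentDiffusion

open Matrix

theorem upperThreshold_nonneg {w : ℝ → ℝ} {T : ℝ} (hT : 0 ≤ T)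
    (hw : IntervalIntegrable (fun s => w s ^ 2) volume 0 T) {D : ℕ} (r : Fin D → ℝ) (e : ℝ)
    (d : ℕ) : 0 ≤ upperThreshold w T r e d := by
  rw [upperThreshold]
  split_ifs with h
  · exact sub_nonneg.2 (invNoiseSq_mem_Icc hT hw _).1.2
  · exact le_rfl

theorem lowerThreshold_le {w : ℝ → ℝ} {T : ℝ} (hT : 0 ≤ T)
    (hw : IntervalIntegrable (fun s => w s ^ 2) volume 0 T) {D : ℕ} (r : Fin D → ℝ) (e : ℝ)
    (d : ℕ) : lowerThreshold w T r e d ≤ T := by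
  rw [lowerThreshold]
  split_ifs with h
  · exact sub_le_self _ (invNoiseSq_mem_Icc hT hw _).1.1
  · exact le_rfl

/-- Between the two thresholds of `d`, the cost decreases up to dimension `d` and increases
afterwards. The thresholds only speak of the components `d` and `d + 1`; the inequalities for the
others follow because both sides of the threshold conditions are monotone in the singular value. -/
theorem latentCost_le_of_mem_thresholds {w : ℝ → ℝ} {T : ℝ} (hT : 0 ≤ T)
    (hw : IntervalIntegrable (fun s => w s ^ 2) volume 0 T)
    (hmono : StrictMonoOn (noiseScale w) (Set.Icc 0 T)) {D : ℕ} {e η t : ℝ} {r : Fin D → ℝ}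
    {Φ : ℕ → ℝ} (hr : ∀ i, 0 ≤ r i) (hanti : Antitone r) (hη : 0 ≤ η) (hη1 : η ≤ 1)
    (he : 0 ≤ e)
    (hΦ : ∀ k, Φ k ≤ (1 + η) * idealFidelity (noiseScale w (T - t) ^ 2) r k ∧
      idealFidelity (noiseScale w (T - t) ^ 2) r k ≤ (1 + η) * Φ k)
    (herr : η * ∑ i, (r i + r i ^ 2) ≤ e) (hwell : ∀ i : Fin D, 1 ≤ i.val → 4 * e < r i ^ 2)
    {d : ℕ} (hd : d ∈ Set.Icc 1 D) (hpos : 0 < lowerThreshold w T r e (d + 1))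
    (ht : t ∈ Set.Icc (upperThreshold w T r e d) (lowerThreshold w T r e (d + 1)))
    {d' : ℕ} (hd' : d' ∈ Set.Icc 1 D) :
    latentCost (noiseScale w (T - t) ^ 2) r Φ d ≤ latentCost (noiseScale w (T - t) ^ 2) r Φ d' := by
  have ht0 : 0 ≤ t := (upperThreshold_nonneg hT hw r e d).trans ht.1
  have htT : t ≤ T := ht.2.trans (lowerThreshold_le hT hw r e _)
  set a := noiseScale w (T - t) ^ 2 with ha
  have ha0 : 0 ≤ a := sq_nonneg _
  have ha1 : a ≤ 1 := (noiseScale_sq_lt_one w (by linarith)).le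
  have hdown : ∀ i : Fin D, 1 ≤ i.val → i.val < d →
      latentCost a r Φ (i.val + 1) ≤ latentCost a r Φ i.val := by
    intro i hi hid
    refine latentCost_succ_le ha0 ha1 hr hη hη1 hΦ herr hanti (hwell i hi) ?_
    have hd2 : 2 ≤ d ∧ d ≤ D := ⟨by omega, hd.2⟩
    have h1 := ht.1
    simp only [upperThreshold, dif_pos hd2] at h1
    set ρ := r ⟨d - 1, by omega⟩ with hρ
    have hρi : ρ ≤ r i := hanti (Fin.le_def.2 (by simp; omega))
    have hρ0 : 0 ≤ ρ := hr _
    have hwρ : 4 * e < ρ ^ 2 := hwell _ (by simp; omega)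
    have hsq : ρ ^ 2 ≤ r i ^ 2 := by gcongr
    rcases noiseScale_sq_mul_le_of_sub_invNoiseSq_le hT hw hmono
      (by have := Real.sqrt_nonneg (ρ ^ 2 - 4 * e); nlinarith [mul_nonneg hρ0 this])
      ⟨ht0, htT⟩ h1 with h | h
    · left; nlinarith
    · right
      calc a * (1 - r i ^ 2) ≤ a * (1 - ρ ^ 2) := by gcongr
        _ ≤ ρ ^ 2 - 4 * e + 2 * ρ * √(ρ ^ 2 - 4 * e) := h
        _ ≤ _ := by have := hr i; gcongr
  have hup : ∀ i : Fin D, d ≤ i.val →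
      latentCost a r Φ i.val ≤ latentCost a r Φ (i.val + 1) := by
    intro i hid
    refine latentCost_le_succ ha0 ha1 hr hη hη1 hΦ he herr ?_
    have hd2 : 2 ≤ d + 1 ∧ d + 1 ≤ D := ⟨by have := hd.1; omega, by have := i.isLt; omega⟩
    have h1 := ht.2
    simp only [lowerThreshold, dif_pos hd2] at h1 hpos
    set ρ := r ⟨d + 1 - 1, by omega⟩ with hρ
    have hρi : r i ≤ ρ := hanti (Fin.le_def.2 (by simp; omega))
    have hρ0 : 0 ≤ ρ := hr _
    have hri := hr i
    have hsq : r i ^ 2 ≤ ρ ^ 2 := by gcongr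
    have h := (le_noiseScale_sq_mul_of_le_sub_invNoiseSq hT hw hmono (by positivity) ht0 hpos
      h1).2
    calc _ ≤ ρ ^ 2 + 4 * e + 2 * ρ * √(ρ ^ 2 + 4 * e) := by gcongr
      _ ≤ a * (1 - ρ ^ 2) := h
      _ ≤ _ := by gcongr
  rcases le_total d d' with h | h
  · have : ∀ k, d ≤ k → k ≤ D → latentCost a r Φ d ≤ latentCost a r Φ k := by
      intro k hk
      induction k, hk using Nat.le_induction with
      | base => exact fun _ => le_rfl
      | succ k hk ih => exact fun hkD => (ih (by omega)).trans (hup ⟨k, by omega⟩ hk)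
    exact this d' h hd'.2
  · have : ∀ k, d' ≤ k → k ≤ d → latentCost a r Φ k ≤ latentCost a r Φ d' := by
      intro k hk
      induction k, hk using Nat.le_induction with
      | base => exact fun _ => le_rfl
      | succ k hk ih =>
        intro hkd
        have h1 := hd'.1
        have h2 := hd.2
        exact (hdown ⟨k, by omega⟩ (by simp; omega) (by simp; omega)).trans (ih (by omega))
    exact this d h le_rfl

theorem pcaProj_eq {D : ℕ} (O : Matrix (Fin D) (Fin D) ℝ) (d : ℕ) :
    pcaProj O d = O * diagonal (fun i => if i.val < d then (1 : ℝ) else 0) * Oᵀ := by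
  have : (coordProj D d)ᵀ * coordProj D d = diagonal fun i => if i.val < d then (1 : ℝ) else 0 := by
    ext i j
    simp only [Matrix.mul_apply, transpose_apply, coordProj, of_apply, diagonal_apply]
    by_cases hi : i.val < d
    · rw [Finset.sum_eq_single ⟨i.val, hi⟩]
      · simp [hi, Fin.ext_iff]
      · intro k _ hk
        have : k.val ≠ i.val := fun h => hk (Fin.ext h)
        simp [this]
      · simp
    · rw [Finset.sum_eq_zero]
      · simp [hi]
      · intro k _
        have : k.val ≠ i.val := by omega
        simp [this]
  rw [pcaProj, Matrix.mul_assoc O, this]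

/-- The covariance matrix `O diag(c₁, …, c_k, 0, …, 0) Oᵀ` of the law at noise level `a`, with
`c_i = a + (1 - a) r_i²`, after projection on the first `k` principal components. -/
noncomputable def truncatedCov {D : ℕ} (O : Matrix (Fin D) (Fin D) ℝ) (a : ℝ) (r : Fin D → ℝ)
    (k : ℕ) : Matrix (Fin D) (Fin D) ℝ :=
  O * diagonal (fun i : Fin D => if i.val < k then a + (1 - a) * r i ^ 2 else 0) * Oᵀ

/-- The fidelity `tr (√A M √A)^{1/2}` of two covariance matrices. -/
noncomputable def fidelity {D : ℕ} (A M : Matrix (Fin D) (Fin D) ℝ) : ℝ :=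
  (CFC.sqrt (CFC.sqrt A * M * CFC.sqrt A)).trace

/-- The Fréchet distance to a centred Gaussian law as a function of the latent dimension. -/
theorem frechetDist_eq_sqrt_latentCost {D : ℕ} {Sig O : Matrix (Fin D) (Fin D) ℝ}
    (hSig : Sig.PosSemidef) (hO : O ∈ orthogonalGroup (Fin D) ℝ) {a : ℝ} {r : Fin D → ℝ}
    {k : ℕ} {ν : Measure (EuclideanSpace ℝ (Fin D))} (hmean : ∫ x, x ∂ν = 0)
    (hcov : covMatrix ν = truncatedCov O a r k) :
    frechetDist ν (multivariateGaussian 0 Sig) =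
      √(Sig.trace + latentCost a r (fun k => fidelity Sig (truncatedCov O a r k)) k) := by
  have hcovG : covMatrix (multivariateGaussian 0 Sig) = Sig := by
    ext i j
    exact covariance_eval_multivariateGaussian hSig i j
  have htr : (truncatedCov O a r k).trace =
      ∑ i : Fin D, if i.val < k then a + (1 - a) * r i ^ 2 else 0 := trace_conj_diagonal hO _
  rw [frechetDist, hmean, integral_id_multivariateGaussian, hcovG, hcov, trace_sub, trace_add,
    trace_smul, htr, latentCost, fidelity]
  simp only [sub_zero, norm_zero, smul_eq_mul]
  congr 1
  ring

/-- Two-sided comparison of the fidelity with its ideal value, when `Σ` and `Σ̂` are comparable up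
to the factor `(1 + η)²`. -/
theorem fidelity_bounds {D : ℕ} {Sig Shat O : Matrix (Fin D) (Fin D) ℝ} {r : Fin D → ℝ}
    {a η : ℝ} (ha0 : 0 ≤ a) (ha1 : a ≤ 1) (hη : 0 ≤ η) (hSig : Sig.PosSemidef)
    (hspec : IsSpectralDecomp Shat O r)
    (h1 : ((1 + η) ^ 2 • Sig - Shat).PosSemidef) (h2 : ((1 + η) ^ 2 • Shat - Sig).PosSemidef)
    (k : ℕ) :
    fidelity Sig (truncatedCov O a r k) ≤ (1 + η) * idealFidelity a r k ∧
      idealFidelity a r k ≤ (1 + η) * fidelity Sig (truncatedCov O a r k) := by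
  have hc : ∀ i : Fin D, 0 ≤ if i.val < k then a + (1 - a) * r i ^ 2 else 0 := by
    intro i
    split_ifs
    · exact add_nonneg ha0 (mul_nonneg (by linarith) (sq_nonneg _))
    · exact le_rfl
  have hM : (truncatedCov O a r k).PosSemidef := posSemidef_conj_diagonal O hc
  have hShat : Shat.PosSemidef := by
    rw [hspec.eq]; exact posSemidef_conj_diagonal O fun i => sq_nonneg _
  have hideal : fidelity Shat (truncatedCov O a r k) = idealFidelity a r k := by
    rw [fidelity, truncatedCov, hspec.eq,
      trace_sqrt_fidelity_conj_diagonal hspec.orthogonal hc hspec.nonneg, idealFidelity]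
    refine Finset.sum_congr rfl fun i _ => ?_
    split_ifs <;> simp
  rw [← hideal]
  exact ⟨trace_sqrt_fidelity_le hSig hShat hM (by linarith) h2,
    trace_sqrt_fidelity_le hShat hSig hM (by linarith) h1⟩

/-- Bounds for the empirical singular values by `S(Σ)`. The first compares the traces of `Σ̂` and
`Σ`, the second the traces of their square roots. -/
theorem sum_le_of_isSpectralDecomp {D : ℕ} {Sig O Shat Ohat : Matrix (Fin D) (Fin D) ℝ}
    {σ r : Fin D → ℝ} {η : ℝ} (hη : 0 ≤ η) (hdec : IsSpectralDecomp Sig O σ)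
    (hspec : IsSpectralDecomp Shat Ohat r) (h1 : ((1 + η) • Sig - Shat).PosSemidef) :
    (∑ i, r i ^ 2 ≤ (1 + η) * spectralSum σ) ∧ ∑ i, r i ≤ (1 + η) * spectralSum σ := by
  have hSig : Sig.PosSemidef := by
    rw [hdec.eq]; exact posSemidef_conj_diagonal O fun i => sq_nonneg _
  have hShat : Shat.PosSemidef := by
    rw [hspec.eq]; exact posSemidef_conj_diagonal Ohat fun i => sq_nonneg _
  constructor
  · have h := h1.trace_nonneg
    rw [trace_sub, trace_smul, hdec.eq, hspec.eq, trace_conj_diagonal hdec.orthogonal,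
      trace_conj_diagonal hspec.orthogonal, smul_eq_mul] at h
    have h2 : ∑ i, σ i ^ 2 ≤ spectralSum σ := Finset.sum_le_sum fun i _ => le_max_right _ _
    nlinarith
  · have h2 : ((1 + η) ^ 2 • Sig - Shat).PosSemidef := by
      have : (1 + η) ^ 2 • Sig - Shat = (η * (1 + η)) • Sig + ((1 + η) • Sig - Shat) := by
        rw [← add_sub_assoc, ← add_smul]; ring_nf
      rw [this]
      exact (hSig.smul (by positivity)).add h1
    have h := trace_sqrt_le_trace_sqrt hShat h2
    rw [sqrt_smul_of_posSemidef hSig (by linarith), trace_smul, hdec.eq, hspec.eq,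
      sqrt_conj_diagonal hdec.orthogonal fun i => sq_nonneg _,
      sqrt_conj_diagonal hspec.orthogonal fun i => sq_nonneg _,
      trace_conj_diagonal hdec.orthogonal, trace_conj_diagonal hspec.orthogonal, smul_eq_mul] at h
    simp only [Real.sqrt_sq (hdec.nonneg _), Real.sqrt_sq (hspec.nonneg _)] at h
    have h2 : ∑ i, σ i ≤ spectralSum σ := Finset.sum_le_sum fun i _ => le_max_left _ _
    nlinarith

/-- A lower bound for the eigenvalues of `Σ̂` by the quadratic form of `Σ`, evaluated at an
eigenvector. -/
theorem le_sq_of_isSpectralDecomp {D : ℕ} {Sig O Shat Ohat : Matrix (Fin D) (Fin D) ℝ}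
    {σ r : Fin D → ℝ} {m c : ℝ} (hc : 0 ≤ c) (hdec : IsSpectralDecomp Sig O σ)
    (hspec : IsSpectralDecomp Shat Ohat r) (hm : ∀ i, m ≤ σ i ^ 2)
    (h1 : (Shat - c • Sig).PosSemidef) (i : Fin D) : c * m ≤ r i ^ 2 := by
  have hOO := (mem_orthogonalGroup_iff' _ _).1 hspec.orthogonal
  have hOO' := (mem_orthogonalGroup_iff _ _).1 hdec.orthogonal
  have h2 : (Sig - m • (1 : Matrix (Fin D) (Fin D) ℝ)).PosSemidef := by
    have : Sig - m • (1 : Matrix (Fin D) (Fin D) ℝ) =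
        O * diagonal (fun i => σ i ^ 2 - m) * Oᵀ := by
      have hd : diagonal (fun i => σ i ^ 2 - m) =
          diagonal (fun i => σ i ^ 2) - m • (1 : Matrix (Fin D) (Fin D) ℝ) := by
        rw [smul_one_eq_diagonal, diagonal_sub]
      rw [hd, mul_sub, sub_mul, ← hdec.eq, mul_smul_comm, mul_one, smul_mul_assoc, hOO']
    rw [this]
    exact posSemidef_conj_diagonal O fun i => sub_nonneg.2 (hm i)
  have h3 : (Shat - (c * m) • (1 : Matrix (Fin D) (Fin D) ℝ)).PosSemidef := by
    have : Shat - (c * m) • (1 : Matrix (Fin D) (Fin D) ℝ) = (Shat - c • Sig) +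
        c • (Sig - m • (1 : Matrix (Fin D) (Fin D) ℝ)) := by
      rw [smul_sub, smul_smul]; abel
    rw [this]
    exact h1.add (h2.smul hc)
  have h4 := h3.conjTranspose_mul_mul_same Ohat
  have h5 : Ohatᵀ * (Shat - (c * m) • (1 : Matrix (Fin D) (Fin D) ℝ)) * Ohat =
      diagonal (fun i => r i ^ 2) - (c * m) • (1 : Matrix (Fin D) (Fin D) ℝ) := by
    rw [mul_sub, sub_mul, mul_smul_comm, mul_one, smul_mul_assoc, hOO]
    congr 1
    rw [hspec.eq]
    calc Ohatᵀ * (Ohat * diagonal (fun i => r i ^ 2) * Ohatᵀ) * Ohat =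
        (Ohatᵀ * Ohat) * diagonal (fun i => r i ^ 2) * (Ohatᵀ * Ohat) := by noncomm_ring
      _ = _ := by rw [hOO, one_mul, mul_one]
  rw [conjTranspose_eq_transpose_of_trivial, h5] at h4
  have := h4.diag_nonneg (i := i)
  simpa using this

end LatentDiffusion

/-! ### Indefinite integrals and time integrals of processes -/

/-- Integration by parts for two indefinite integrals. -/
theorem intervalIntegral_primitive_mul_add {f g : ℝ → ℝ} {t : ℝ}
    (hf : IntervalIntegrable f volume 0 t) (hg : IntervalIntegrable g volume 0 t) (c d : ℝ) :
    ∫ x in (0 : ℝ)..t, (f x * (d + ∫ s in (0 : ℝ)..x, g s) + (c + ∫ s in (0 : ℝ)..x, f s) * g x) =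
      (c + ∫ s in (0 : ℝ)..t, f s) * (d + ∫ s in (0 : ℝ)..t, g s) - c * d := by
  have hac : ∀ {k : ℝ → ℝ} (_ : IntervalIntegrable k volume 0 t) (b : ℝ),
      AbsolutelyContinuousOnInterval (fun x => b + ∫ s in (0 : ℝ)..x, k s) 0 t := by
    intro k hk b
    have h1 : AbsolutelyContinuousOnInterval (fun _ : ℝ => b) 0 t :=
      (LipschitzWith.const b).lipschitzOnWith.absolutelyContinuousOnInterval
    exact h1.add (hk.absolutelyContinuousOnInterval_intervalIntegral Set.left_mem_uIcc)
  have h := (hac hf c).integral_deriv_mul_eq_sub (hac hg d)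
  simp only [intervalIntegral.integral_same, add_zero] at h
  rw [← h]
  refine intervalIntegral.integral_congr_ae ?_
  filter_upwards [hf.ae_hasDerivAt_integral, hg.ae_hasDerivAt_integral] with x h1 h2 hx
  have hx' := Set.uIoc_subset_uIcc hx
  rw [((h1 hx' 0 Set.left_mem_uIcc).const_add c).deriv,
    ((h2 hx' 0 Set.left_mem_uIcc).const_add d).deriv]

theorem LipschitzOnWith.comp_absolutelyContinuousOnInterval {f φ : ℝ → ℝ} {a b : ℝ} {K : ℝ≥0}
    {s : Set ℝ} (hφ : LipschitzOnWith K φ s) (hf : AbsolutelyContinuousOnInterval f a b)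
    (hs : Set.MapsTo f (Set.uIcc a b) s) :
    AbsolutelyContinuousOnInterval (fun x => φ (f x)) a b := by
  rw [absolutelyContinuousOnInterval_iff] at hf ⊢
  intro ε hε
  obtain ⟨δ, hδ, h⟩ := hf (ε / (K + 1)) (by positivity)
  refine ⟨δ, hδ, fun E hE hlen => ?_⟩
  have h1 := h E hE hlen
  have hmem : ∀ i ∈ Finset.range E.1, (E.2 i).1 ∈ Set.uIcc a b ∧ (E.2 i).2 ∈ Set.uIcc a b :=
    hE.1
  calc ∑ i ∈ Finset.range E.1, dist (φ (f (E.2 i).1)) (φ (f (E.2 i).2))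
      ≤ ∑ i ∈ Finset.range E.1, (K + 1) * dist (f (E.2 i).1) (f (E.2 i).2) := by
        refine Finset.sum_le_sum fun i hi => ?_
        refine (hφ.dist_le_mul _ (hs (hmem i hi).1) _ (hs (hmem i hi).2)).trans ?_
        gcongr
        linarith
    _ = (K + 1) * ∑ i ∈ Finset.range E.1, dist (f (E.2 i).1) (f (E.2 i).2) :=
        (Finset.mul_sum _ _ _).symm
    _ < (K + 1) * (ε / (K + 1)) := by gcongr
    _ = ε := by field_simp

/-- Chain rule for a continuously differentiable function of an indefinite integral. -/
theorem intervalIntegral_deriv_comp_primitive {h φ φ' : ℝ → ℝ} {t m M : ℝ}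
    (hh : IntervalIntegrable h volume 0 t) (hφ : ∀ y ∈ Set.Icc m M, HasDerivAt φ (φ' y) y)
    (hφ' : ContinuousOn φ' (Set.Icc m M))
    (hm : ∀ x ∈ Set.uIcc 0 t, ∫ s in (0 : ℝ)..x, h s ∈ Set.Icc m M) :
    ∫ x in (0 : ℝ)..t, φ' (∫ s in (0 : ℝ)..x, h s) * h x =
      φ (∫ s in (0 : ℝ)..t, h s) - φ 0 := by
  have hH := hh.absolutelyContinuousOnInterval_intervalIntegral Set.left_mem_uIcc
  obtain ⟨K, hK⟩ := isCompact_Icc.exists_bound_of_continuousOn hφ'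
  have hlip : LipschitzOnWith K.toNNReal φ (Set.Icc m M) :=
    (convex_Icc m M).lipschitzOnWith_of_nnnorm_hasDerivWithin_le
      (fun y hy => (hφ y hy).hasDerivWithinAt)
      fun y hy => by
        rw [← NNReal.coe_le_coe, coe_nnnorm]
        exact (hK y hy).trans (Real.le_coe_toNNReal K)
  have hac := hlip.comp_absolutelyContinuousOnInterval hH hm
  have hsub := hac.integral_deriv_eq_sub
  simp only [intervalIntegral.integral_same] at hsub
  rw [← hsub]
  refine intervalIntegral.integral_congr_ae ?_
  filter_upwards [hh.ae_hasDerivAt_integral] with x h1 hx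
  have hx' := Set.uIoc_subset_uIcc hx
  exact ((hφ _ (hm x hx')).comp x (h1 hx' 0 Set.left_mem_uIcc)).deriv.symm

section JointMeasurability

variable {Ω : Type*} [MeasurableSpace Ω] {P : Measure Ω}

/-- A process with almost surely continuous paths whose marginals are almost everywhere measurable
is jointly measurable up to a null set: it is the limit of its discretizations in time. -/
theorem aestronglyMeasurable_uncurry_of_continuousOn {Z : ℝ → Ω → ℝ} {t : ℝ}
    (hmeas : ∀ s ∈ Set.Icc 0 t, AEMeasurable (Z s) P)
    (hcont : ∀ᵐ ω ∂P, ContinuousOn (fun s => Z s ω) (Set.Icc 0 t)) :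
    AEStronglyMeasurable (fun p : ℝ × Ω => Z p.1 p.2)
      ((volume.restrict (Set.Ioc 0 t)).prod P) := by
  classical
  let grid : ℕ → ℕ → ℝ := fun n k => k / (n + 1)
  let V : ℕ → ℕ → Ω → ℝ := fun n k ω =>
    if h : grid n k ∈ Set.Icc 0 t then (hmeas _ h).mk (Z (grid n k)) ω else 0
  have hV : ∀ n k, Measurable (V n k) := by
    intro n k
    by_cases h : grid n k ∈ Set.Icc 0 t
    · simp only [V, dif_pos h]; exact (hmeas _ h).measurable_mk
    · simp only [V, dif_neg h]; exact measurable_const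
  have hVeq : ∀ᵐ ω ∂P, ∀ n k, grid n k ∈ Set.Icc 0 t → V n k ω = Z (grid n k) ω := by
    rw [ae_all_iff]; intro n
    rw [ae_all_iff]; intro k
    by_cases h : grid n k ∈ Set.Icc 0 t
    · filter_upwards [(hmeas _ h).ae_eq_mk] with ω hω _
      simp only [V, dif_pos h, hω]
    · exact Eventually.of_forall fun ω h' => absurd h' h
  refine aestronglyMeasurable_of_tendsto_ae atTop
    (f := fun n (p : ℝ × Ω) => V n ⌊p.1 * (n + 1)⌋₊ p.2) (fun n => ?_) ?_
  · have h1 : Measurable (fun q : ℕ × Ω => V n q.1 q.2) :=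
      measurable_from_prod_countable_right (hV n)
    have h2 : Measurable (fun p : ℝ × Ω => (⌊p.1 * ((n : ℝ) + 1)⌋₊, p.2)) :=
      (Nat.measurable_floor.comp (measurable_fst.mul_const _)).prodMk measurable_snd
    exact (h1.comp h2).aestronglyMeasurable
  · have hs : ∀ᵐ p ∂((volume.restrict (Set.Ioc 0 t)).prod P), p.1 ∈ Set.Ioc 0 t :=
      Measure.quasiMeasurePreserving_fst.ae (ae_restrict_mem measurableSet_Ioc)
    have hω := Measure.quasiMeasurePreserving_snd (μ := volume.restrict (Set.Ioc 0 t)).ae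
      (hcont.and hVeq)
    filter_upwards [hs, hω] with ⟨s, ω⟩ hs ⟨hc, he⟩
    simp only at hs hc he ⊢
    have hle : ∀ n : ℕ, grid n ⌊s * (n + 1)⌋₊ ≤ s := by
      intro n
      simp only [grid]
      rw [div_le_iff₀ (by positivity)]
      exact Nat.floor_le (mul_nonneg hs.1.le (by positivity))
    have hmem : ∀ n : ℕ, grid n ⌊s * (n + 1)⌋₊ ∈ Set.Icc 0 t := fun n =>
      ⟨by simp only [grid]; positivity, (hle n).trans hs.2⟩
    have hlim : Tendsto (fun n : ℕ => grid n ⌊s * (n + 1)⌋₊) atTop (𝓝 s) := by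
      have hlow : ∀ n : ℕ, s - 1 / ((n : ℝ) + 1) ≤ grid n ⌊s * (n + 1)⌋₊ := by
        intro n
        have := (Nat.lt_floor_add_one (s * ((n : ℝ) + 1))).le
        have hn : (0 : ℝ) < n + 1 := by positivity
        simp only [grid]
        rw [le_div_iff₀ hn, sub_mul, one_div, inv_mul_cancel₀ hn.ne']
        linarith
      have h0 : Tendsto (fun n : ℕ => s - 1 / ((n : ℝ) + 1)) atTop (𝓝 s) := by
        simpa using tendsto_const_nhds.sub (tendsto_one_div_add_atTop_nhds_zero_nat (𝕜 := ℝ))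
      exact tendsto_of_tendsto_of_tendsto_of_le_of_le h0 tendsto_const_nhds hlow hle
    have h1 : Tendsto (fun n : ℕ => Z (grid n ⌊s * (n + 1)⌋₊) ω) atTop (𝓝 (Z s ω)) :=
      (hc s ⟨hs.1.le, hs.2⟩).tendsto.comp
        (tendsto_nhdsWithin_iff.2 ⟨hlim, Eventually.of_forall hmem⟩)
    exact h1.congr fun n => (he n _ (hmem n)).symm

/-- Let `N = ∫₀ᵗ k(s) Z_s ds` with `k` integrable and `Z` bounded in `L²`. Then `N` is square
integrable, and the `L²` scalar product with `N` can be computed under the time integral. -/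
theorem memLp_intervalIntegral_mul_and_integral_eq [SFinite P] {Z : ℝ → Ω → ℝ} {k : ℝ → ℝ} {t B : ℝ}
    (ht : 0 ≤ t) (hk : IntervalIntegrable k volume 0 t)
    (hZ : AEStronglyMeasurable (fun p : ℝ × Ω => Z p.1 p.2)
      ((volume.restrict (Set.Ioc 0 t)).prod P))
    (hZ2 : ∀ s ∈ Set.Icc 0 t, MemLp (Z s) 2 P) (hB : ∀ s ∈ Set.Icc 0 t, ∫ ω, Z s ω ^ 2 ∂P ≤ B) :
    MemLp (fun ω => ∫ s in (0 : ℝ)..t, k s * Z s ω) 2 P ∧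
      ∀ U : Ω → ℝ, MemLp U 2 P →
        ∫ ω, (∫ s in (0 : ℝ)..t, k s * Z s ω) * U ω ∂P =
          ∫ s in (0 : ℝ)..t, k s * ∫ ω, Z s ω * U ω ∂P := by
  set ν := volume.restrict (Set.Ioc 0 t) with hν
  have hkν : Integrable k ν := by
    rwa [intervalIntegrable_iff_integrableOn_Ioc_of_le ht] at hk
  have hkm : AEStronglyMeasurable (fun p : ℝ × Ω => k p.1) (ν.prod P) :=
    hkν.aestronglyMeasurable.comp_fst
  have hmem : ∀ᵐ s ∂ν, s ∈ Set.Icc 0 t :=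
    (ae_restrict_mem measurableSet_Ioc).mono fun s hs => Set.Ioc_subset_Icc_self hs
  have hsq : Integrable (fun p : ℝ × Ω => |k p.1| * Z p.1 p.2 ^ 2) (ν.prod P) := by
    have hm : AEStronglyMeasurable (fun p : ℝ × Ω => |k p.1| * Z p.1 p.2 ^ 2) (ν.prod P) :=
      hkm.norm.mul (hZ.pow 2)
    rw [integrable_prod_iff hm]
    refine ⟨hmem.mono fun s hs => (hZ2 s hs).integrable_sq.const_mul |k s|, ?_⟩
    refine (hkν.abs.mul_const B).mono' hm.norm.integral_prod_right' ?_
    filter_upwards [hmem] with s hs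
    have : ∀ ω, ‖|k s| * Z s ω ^ 2‖ = |k s| * Z s ω ^ 2 := fun ω =>
      Real.norm_of_nonneg (by positivity)
    simp only [this, integral_const_mul]
    rw [Real.norm_of_nonneg (mul_nonneg (abs_nonneg _) (integral_nonneg fun ω => sq_nonneg _))]
    gcongr
    exact hB s hs
  have hprod : ∀ U : Ω → ℝ, MemLp U 2 P →
      Integrable (fun p : ℝ × Ω => k p.1 * Z p.1 p.2 * U p.2) (ν.prod P) := by
    intro U hU
    have hm : AEStronglyMeasurable (fun p : ℝ × Ω => k p.1 * Z p.1 p.2 * U p.2) (ν.prod P) :=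
      (hkm.mul hZ).mul hU.aestronglyMeasurable.comp_snd
    have hUU : Integrable (fun p : ℝ × Ω => |k p.1| * U p.2 ^ 2) (ν.prod P) :=
      hkν.abs.mul_prod hU.integrable_sq
    refine (hsq.add hUU).mono' hm (Eventually.of_forall fun p => ?_)
    simp only [Pi.add_apply, norm_mul, Real.norm_eq_abs, mul_assoc]
    rw [← mul_add]
    gcongr
    rw [← sq_abs (Z p.1 p.2), ← sq_abs (U p.2)]
    nlinarith [sq_nonneg (|Z p.1 p.2| - |U p.2|), sq_nonneg (|Z p.1 p.2| + |U p.2|)]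
  constructor
  · have hm : AEStronglyMeasurable (fun ω => ∫ s in (0 : ℝ)..t, k s * Z s ω) P := by
      simp only [intervalIntegral.integral_of_le ht]
      exact (hkm.mul hZ).prod_swap.integral_prod_right'
    rw [memLp_two_iff_integrable_sq hm]
    refine ((hsq.integral_prod_right).const_mul (∫ s, |k s| ∂ν)).mono' (hm.pow 2) ?_
    filter_upwards [hsq.prod_left_ae] with ω hω
    simp only [intervalIntegral.integral_of_le ht, ← hν]
    rw [Real.norm_of_nonneg (sq_nonneg _)]
    -- Cauchy–Schwarz with weight `|k|`, from the nonnegativity of a quadratic polynomial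
    by_cases hint : Integrable (fun s => k s * Z s ω) ν
    · have hquad : ∀ m : ℝ, 0 ≤ (∫ s, |k s| ∂ν) * (m * m) + (-2 * ∫ s, k s * Z s ω ∂ν) * m +
          ∫ s, |k s| * Z s ω ^ 2 ∂ν := by
        intro m
        have e : (∫ s, |k s| ∂ν) * (m * m) + (-2 * ∫ s, k s * Z s ω ∂ν) * m +
            ∫ s, |k s| * Z s ω ^ 2 ∂ν =
            ∫ s, (|k s| * (m * m) + k s * Z s ω * (-2 * m) + |k s| * Z s ω ^ 2) ∂ν := by
          have i1 : Integrable (fun s => |k s| * (m * m)) ν := hkν.abs.mul_const _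
          have i2 : Integrable (fun s => k s * Z s ω * (-2 * m)) ν := hint.mul_const _
          have i3 : Integrable (fun s => |k s| * (m * m) + k s * Z s ω * (-2 * m)) ν := i1.add i2
          rw [integral_add i3 hω, integral_add i1 i2, integral_mul_const, integral_mul_const]
          ring
        rw [e]
        refine integral_nonneg fun s => ?_
        simp only [Pi.zero_apply]
        rcases abs_cases (k s) with ⟨h, h0⟩ | ⟨h, h0⟩ <;> rw [h]
        · nlinarith [mul_nonneg h0 (sq_nonneg (m - Z s ω))]
        · nlinarith [mul_nonneg (neg_nonneg.2 h0.le) (sq_nonneg (m + Z s ω))]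
      have := discrim_le_zero hquad
      rw [discrim] at this
      nlinarith
    · rw [integral_undef hint]
      have h1 : 0 ≤ ∫ s, |k s| ∂ν := integral_nonneg fun s => abs_nonneg _
      have h2 : 0 ≤ ∫ s, |k s| * Z s ω ^ 2 ∂ν := integral_nonneg fun s => by positivity
      simpa using mul_nonneg h1 h2
  · intro U hU
    simp only [intervalIntegral.integral_of_le ht, ← hν]
    have := integral_integral_swap (f := fun s ω => k s * Z s ω * U ω) (hprod U hU)
    simp only [← integral_const_mul, ← integral_mul_const, ← mul_assoc]
    exact this.symm

end JointMeasurability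

/-! ### Moments of Wiener integrals -/

/-- Convergence in `L²` of both factors implies convergence of the scalar products. -/
theorem tendsto_integral_mul_of_tendsto_eLpNorm {α : Type*} [MeasurableSpace α] {ν : Measure α}
    {f g : ℕ → α → ℝ} {F G : α → ℝ} (hf : ∀ k, MemLp (f k) 2 ν) (hg : ∀ k, MemLp (g k) 2 ν)
    (hF : MemLp F 2 ν) (hG : MemLp G 2 ν)
    (hfF : Tendsto (fun k => eLpNorm (fun x => f k x - F x) 2 ν) atTop (𝓝 0))
    (hgG : Tendsto (fun k => eLpNorm (fun x => g k x - G x) 2 ν) atTop (𝓝 0)) :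
    Tendsto (fun k => ∫ x, f k x * g k x ∂ν) atTop (𝓝 (∫ x, F x * G x ∂ν)) := by
  have h1 := (Lp.tendsto_Lp_iff_tendsto_eLpNorm'' f hf F hF).2 hfF
  have h2 := (Lp.tendsto_Lp_iff_tendsto_eLpNorm'' g hg G hG).2 hgG
  have e : ∀ {a b : α → ℝ} (ha : MemLp a 2 ν) (hb : MemLp b 2 ν),
      inner ℝ (ha.toLp a) (hb.toLp b) = ∫ x, a x * b x ∂ν := by
    intro a b ha hb
    rw [L2.inner_def]
    refine integral_congr_ae ?_
    filter_upwards [ha.coeFn_toLp, hb.coeFn_toLp] with x hx hy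
    rw [hx, hy]
    simp [mul_comm]
  have h3 := Filter.Tendsto.inner (𝕜 := ℝ) h1 h2
  simpa only [e] using h3

theorem memLp_of_tendsto_eLpNorm {α : Type*} [MeasurableSpace α] {ν : Measure α}
    {f : ℕ → α → ℝ} {F : α → ℝ} (hf : ∀ k, MemLp (f k) 2 ν) (hF : AEStronglyMeasurable F ν)
    (hfF : Tendsto (fun k => eLpNorm (fun x => f k x - F x) 2 ν) atTop (𝓝 0)) : MemLp F 2 ν := by
  obtain ⟨k, hk⟩ := (hfF.eventually (gt_mem_nhds zero_lt_one)).exists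
  have h1 : MemLp (fun x => f k x - F x) 2 ν :=
    ⟨(hf k).aestronglyMeasurable.sub hF, hk.trans ENNReal.one_lt_top⟩
  have h2 := (hf k).sub h1
  refine h2.ae_eq (Eventually.of_forall fun x => ?_)
  simp

namespace LatentDiffusion

section BrownianVec

variable {D : ℕ} {Ω : Type*} [MeasurableSpace Ω] {P : Measure Ω}
  {W : ℝ≥0 → Ω → EuclideanSpace ℝ (Fin D)}

theorem IsBrownianVec.memLp (hW : IsBrownianVec W P) (t : ℝ≥0) (i : Fin D) :
    MemLp (fun ω => W t ω i) 2 P := by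
  have hlaw := (hW.brownian_coord i).hasLaw_eval t
  have h : MemLp id 2 (gaussianReal 0 t) := memLp_id_gaussianReal 2
  rw [← hlaw.map_eq] at h
  exact h.comp_of_map hlaw.aemeasurable

theorem IsBrownianVec.integral_eq_zero (hW : IsBrownianVec W P) (t : ℝ≥0) (i : Fin D) :
    ∫ ω, W t ω i ∂P = 0 :=
  (hW.brownian_coord i).integral_eval t

theorem IsBrownianVec.integral_mul [IsProbabilityMeasure P] (hW : IsBrownianVec W P) (s t : ℝ≥0)
    (i j : Fin D) :
    ∫ ω, W s ω i * W t ω j ∂P = if i = j then ((min s t : ℝ≥0) : ℝ) else 0 := by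
  split_ifs with h
  · subst h
    have h1 := (hW.brownian_coord i).covariance_fun_eval s t
    rw [covariance_eq_sub (hW.memLp s i) (hW.memLp t i)] at h1
    rw [hW.integral_eq_zero s i, zero_mul, sub_zero] at h1
    exact h1
  · have hind : IndepFun (fun ω => W s ω i) (fun ω => W t ω j) P :=
      (hW.indep_coord.indepFun h).comp (measurable_pi_apply s) (measurable_pi_apply t)
    have := hind.integral_mul_eq_mul_integral (hW.memLp s i).aestronglyMeasurable
      (hW.memLp t j).aestronglyMeasurable
    simp only [hW.integral_eq_zero s i, zero_mul] at this
    exact this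

theorem StepFn.integral_apply {D : ℕ} {Ω : Type*} {W : ℝ≥0 → Ω → EuclideanSpace ℝ (Fin D)}
    (φ : StepFn) (t : ℝ≥0) (ω : Ω) (i : Fin D) :
    φ.integral W t ω i = ∑ a ∈ Finset.range φ.size,
      φ.coef a * (W (min (φ.node (a + 1)) t) ω i - W (min (φ.node a) t) ω i) := by
  simp [StepFn.integral]

theorem StepFn.memLp_integral (φ : StepFn) (hW : IsBrownianVec W P) (t : ℝ≥0) (i : Fin D) :
    MemLp (fun ω => φ.integral W t ω i) 2 P := by
  simp only [StepFn.integral_apply]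
  exact memLp_finsetSum _ fun a _ => ((hW.memLp _ i).sub (hW.memLp _ i)).const_mul _

theorem StepFn.integral_integral_eq_zero [IsProbabilityMeasure P] (φ : StepFn)
    (hW : IsBrownianVec W P) (t : ℝ≥0) (i : Fin D) : ∫ ω, φ.integral W t ω i ∂P = 0 := by
  have hi : ∀ s, Integrable (fun ω => W s ω i) P := fun s =>
    (hW.memLp s i).integrable one_le_two
  have hd : ∀ a, Integrable (fun ω => φ.coef a *
      (W (min (φ.node (a + 1)) t) ω i - W (min (φ.node a) t) ω i)) P := fun a =>
    ((hi _).sub (hi _)).const_mul _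
  simp only [StepFn.integral_apply]
  rw [integral_finsetSum _ fun a _ => hd a]
  refine Finset.sum_eq_zero fun a _ => ?_
  rw [integral_const_mul, integral_sub (hi _) (hi _), hW.integral_eq_zero, hW.integral_eq_zero]
  simp

theorem StepFn.integral_mul_integral_of_indepFun (φ : StepFn) (hW : IsBrownianVec W P) (t : ℝ≥0)
    (i : Fin D) {U : Ω → ℝ} (hU : MemLp U 2 P)
    (hind : IndepFun U (fun (ω : Ω) (t : ℝ≥0) => W t ω) P) :
    ∫ ω, φ.integral W t ω i * U ω ∂P = 0 := by
  have h0 : ∀ s, ∫ ω, W s ω i * U ω ∂P = 0 := by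
    intro s
    have h1 : IndepFun (fun ω => W s ω i) U P := by
      have : Measurable (fun f : ℝ≥0 → EuclideanSpace ℝ (Fin D) => f s i) := by fun_prop
      exact (hind.comp measurable_id this).symm
    have := h1.integral_mul_eq_mul_integral (hW.memLp s i).aestronglyMeasurable
      hU.aestronglyMeasurable
    simp only [hW.integral_eq_zero s i, zero_mul] at this
    exact this
  have hint : ∀ s, Integrable (fun ω => W s ω i * U ω) P := fun s =>
    (hW.memLp s i).integrable_mul hU
  have hd : ∀ a, Integrable (fun ω => φ.coef a *
      (W (min (φ.node (a + 1)) t) ω i * U ω - W (min (φ.node a) t) ω i * U ω)) P := fun a =>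
    ((hint _).sub (hint _)).const_mul _
  simp only [StepFn.integral_apply, Finset.sum_mul, mul_assoc, sub_mul]
  rw [integral_finsetSum _ fun a _ => hd a]
  refine Finset.sum_eq_zero fun a _ => ?_
  rw [integral_const_mul, integral_sub (hint _) (hint _), h0, h0]
  simp

/-- The scalar products of increments of Brownian motion are those of indicators of intervals. -/
theorem IsBrownianVec.integral_increment_mul [IsProbabilityMeasure P] (hW : IsBrownianVec W P)
    {p q p' q' : ℝ≥0} (hpq : p ≤ q) (hpq' : p' ≤ q') (i j : Fin D) :
    ∫ ω, (W q ω i - W p ω i) * (W q' ω j - W p' ω j) ∂P =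
      if i = j then ∫ s, (Set.Ioc (p : ℝ) q).indicator (fun _ => (1 : ℝ)) s *
        (Set.Ioc (p' : ℝ) q').indicator (fun _ => (1 : ℝ)) s else 0 := by
  have hint : ∀ s t, Integrable (fun ω => W s ω i * W t ω j) P := fun s t =>
    (hW.memLp s i).integrable_mul (hW.memLp t j)
  have h1 : ∫ ω, (W q ω i - W p ω i) * (W q' ω j - W p' ω j) ∂P =
      (∫ ω, W q ω i * W q' ω j ∂P - ∫ ω, W q ω i * W p' ω j ∂P) -
        (∫ ω, W p ω i * W q' ω j ∂P - ∫ ω, W p ω i * W p' ω j ∂P) := by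
    have hd : ∀ s, Integrable (fun ω => W s ω i * W q' ω j - W s ω i * W p' ω j) P := fun s =>
      (hint _ _).sub (hint _ _)
    rw [← integral_sub (hint _ _) (hint _ _), ← integral_sub (hint _ _) (hint _ _),
      ← integral_sub (hd _) (hd _)]
    congr 1; ext ω; ring
  rw [h1]
  simp only [hW.integral_mul]
  split_ifs with hij
  · have h2 : ∀ s, (Set.Ioc (p : ℝ) q).indicator (fun _ => (1 : ℝ)) s *
        (Set.Ioc (p' : ℝ) q').indicator (fun _ => (1 : ℝ)) s =
        (Set.Ioc (max p p' : ℝ) (min q q')).indicator (fun _ => (1 : ℝ)) s := by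
      intro s
      rw [← Set.Ioc_inter_Ioc]
      simp only [Set.indicator_apply, Set.mem_inter_iff]
      split_ifs <;> simp_all
    simp only [h2]
    rw [integral_indicator_const _ measurableSet_Ioc, measureReal_def, Real.volume_Ioc,
      ENNReal.toReal_ofReal']
    have a1 : (p : ℝ) ≤ q := by exact_mod_cast hpq
    have a2 : (p' : ℝ) ≤ q' := by exact_mod_cast hpq'
    simp only [NNReal.coe_min, smul_eq_mul, mul_one]
    grind
  · simp

/-- On `(0, t]` a step function can be written with nodes cut off at `t`, as in its integral up to
`t`. -/
theorem StepFn.eval_eq_sum_mul (φ : StepFn) {t : ℝ≥0} {s : ℝ} (hs : s ∈ Set.Ioc 0 (t : ℝ)) :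
    φ.eval s = ∑ a ∈ Finset.range φ.size, φ.coef a *
      (Set.Ioc ((min (φ.node a) t : ℝ≥0) : ℝ) (min (φ.node (a + 1)) t : ℝ≥0)).indicator
        (fun _ => (1 : ℝ)) s := by
  refine Finset.sum_congr rfl fun a _ => ?_
  have : s ∈ Set.Ioc ((min (φ.node a) t : ℝ≥0) : ℝ) (min (φ.node (a + 1)) t : ℝ≥0) ↔
      s ∈ Set.Ioc (φ.node a : ℝ) (φ.node (a + 1)) := by
    simp only [Set.mem_Ioc, NNReal.coe_min, min_lt_iff, le_min_iff, hs.2, and_true,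
      not_lt.2 hs.2, or_false]
  simp only [Set.indicator_apply, this]
  split_ifs <;> simp

/-- The Itô isometry for step functions, in polarized form. -/
theorem StepFn.integral_mul_integral [IsProbabilityMeasure P] (φ χ : StepFn)
    (hW : IsBrownianVec W P) (s t : ℝ≥0) (i j : Fin D) :
    ∫ ω, φ.integral W s ω i * χ.integral W t ω j ∂P =
      if i = j then ∫ x in Set.Ioc 0 (min s t : ℝ), φ.eval x * χ.eval x else 0 := by
  set I : StepFn → ℝ≥0 → ℕ → ℝ → ℝ := fun φ t a =>
    (Set.Ioc ((min (φ.node a) t : ℝ≥0) : ℝ) (min (φ.node (a + 1)) t : ℝ≥0)).indicator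
        (fun _ => (1 : ℝ)) with hI
  have hmono : ∀ (φ : StepFn) (t : ℝ≥0) a, min (φ.node a) t ≤ min (φ.node (a + 1)) t :=
    fun φ t a => min_le_min_right _ (φ.node_mono (Nat.le_succ a))
  have hLp : ∀ (φ : StepFn) (t : ℝ≥0) (i : Fin D) a, MemLp (fun ω => φ.coef a *
      (W (min (φ.node (a + 1)) t) ω i - W (min (φ.node a) t) ω i)) 2 P := fun φ t i a =>
    ((hW.memLp _ i).sub (hW.memLp _ i)).const_mul _
  have hILp : ∀ (φ : StepFn) (t : ℝ≥0) a, MemLp (fun x => φ.coef a * I φ t a x) 2 volume :=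
    fun φ t a => ((memLp_indicator_const 2 measurableSet_Ioc 1 (Or.inr (by simp))).const_mul _)
  have hp : ∀ a b, Integrable (fun ω =>
      (φ.coef a * (W (min (φ.node (a + 1)) s) ω i - W (min (φ.node a) s) ω i)) *
        (χ.coef b * (W (min (χ.node (b + 1)) t) ω j - W (min (χ.node b) t) ω j))) P :=
    fun a b => (hLp φ s i a).integrable_mul (hLp χ t j b)
  have hIp : ∀ a b, Integrable (fun x => (φ.coef a * I φ s a x) * (χ.coef b * I χ t b x)) volume :=
    fun a b => (hILp φ s a).integrable_mul (hILp χ t b)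
  have hleft : ∫ ω, φ.integral W s ω i * χ.integral W t ω j ∂P =
      ∑ a ∈ Finset.range φ.size, ∑ b ∈ Finset.range χ.size,
        φ.coef a * χ.coef b * if i = j then ∫ x, I φ s a x * I χ t b x else 0 := by
    simp only [StepFn.integral_apply, Finset.sum_mul_sum]
    rw [integral_finsetSum _ fun a _ => integrable_finsetSum _ fun b _ => hp a b]
    refine Finset.sum_congr rfl fun a _ => ?_
    rw [integral_finsetSum _ fun b _ => hp a b]
    refine Finset.sum_congr rfl fun b _ => ?_
    rw [← hW.integral_increment_mul (hmono φ s a) (hmono χ t b), ← integral_const_mul]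
    congr 1; ext ω; ring
  rw [hleft]
  split_ifs with hij
  · have hsupp : ∀ (φ : StepFn) (t : ℝ≥0) (x : ℝ), x ∉ Set.Ioc 0 (t : ℝ) →
        ∑ a ∈ Finset.range φ.size, φ.coef a * I φ t a x = 0 := by
      intro φ t x hx
      refine Finset.sum_eq_zero fun a _ => ?_
      have : x ∉ Set.Ioc ((min (φ.node a) t : ℝ≥0) : ℝ) (min (φ.node (a + 1)) t : ℝ≥0) := by
        rintro ⟨h1, h2⟩
        refine hx ⟨lt_of_le_of_lt (NNReal.coe_nonneg _) h1, h2.trans ?_⟩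
        exact_mod_cast min_le_right _ _
      rw [hI]
      simp only
      rw [Set.indicator_of_notMem this, mul_zero]
    have hright : ∫ x in Set.Ioc 0 (min s t : ℝ), φ.eval x * χ.eval x =
        ∫ x, (∑ a ∈ Finset.range φ.size, φ.coef a * I φ s a x) *
          ∑ b ∈ Finset.range χ.size, χ.coef b * I χ t b x := by
      rw [← integral_indicator measurableSet_Ioc]
      congr 1; ext x
      by_cases hx : x ∈ Set.Ioc 0 (min s t : ℝ)
      · have hs : x ∈ Set.Ioc 0 (s : ℝ) := ⟨hx.1, hx.2.trans (min_le_left _ _)⟩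
        have ht : x ∈ Set.Ioc 0 (t : ℝ) := ⟨hx.1, hx.2.trans (min_le_right _ _)⟩
        rw [Set.indicator_of_mem hx, φ.eval_eq_sum_mul hs, χ.eval_eq_sum_mul ht]
      · rw [Set.indicator_of_notMem hx]
        by_cases hs : x ∈ Set.Ioc 0 (s : ℝ)
        · have ht : x ∉ Set.Ioc 0 (t : ℝ) := fun ht => hx ⟨hs.1, le_min hs.2 ht.2⟩
          rw [hsupp χ t x ht, mul_zero]
        · rw [hsupp φ s x hs, zero_mul]
    rw [hright]
    simp only [Finset.sum_mul_sum]
    rw [integral_finsetSum _ fun a _ => integrable_finsetSum _ fun b _ => hIp a b]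
    refine Finset.sum_congr rfl fun a _ => ?_
    rw [integral_finsetSum _ fun b _ => hIp a b]
    refine Finset.sum_congr rfl fun b _ => ?_
    rw [← integral_const_mul]
    congr 1; ext x; ring
  · simp

theorem StepFn.memLp_eval (φ : StepFn) (s : Set ℝ) : MemLp φ.eval 2 (volume.restrict s) := by
  have : MemLp φ.eval 2 volume := by
    unfold StepFn.eval
    exact memLp_finsetSum _ fun a _ =>
      memLp_indicator_const 2 measurableSet_Ioc _ (Or.inr (by simp))
  exact this.restrict s

theorem tendsto_eLpNorm_coord {I : Ω → EuclideanSpace ℝ (Fin D)}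
    {f : ℕ → Ω → EuclideanSpace ℝ (Fin D)}
    (h : Tendsto (fun k => eLpNorm (fun ω => f k ω - I ω) 2 P) atTop (𝓝 0)) (i : Fin D) :
    Tendsto (fun k => eLpNorm (fun ω => f k ω i - I ω i) 2 P) atTop (𝓝 0) := by
  refine tendsto_of_tendsto_of_tendsto_of_le_of_le tendsto_const_nhds h
    (fun _ => zero_le) fun k => eLpNorm_mono fun ω => ?_
  exact PiLp.norm_apply_le (f k ω - I ω) i

variable {g : ℝ → ℝ} {s t : ℝ≥0} {I J : Ω → EuclideanSpace ℝ (Fin D)}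

theorem IsWienerIntegral.memLp (hW : IsBrownianVec W P) (hI : IsWienerIntegral P W g t I)
    {i : Fin D} (hm : AEStronglyMeasurable (fun ω => I ω i) P) : MemLp (fun ω => I ω i) 2 P := by
  obtain ⟨φ, -, h⟩ := hI
  exact memLp_of_tendsto_eLpNorm (fun k => (φ k).memLp_integral hW t i) hm
    (tendsto_eLpNorm_coord h i)

theorem IsWienerIntegral.integral_eq_zero [IsProbabilityMeasure P] (hW : IsBrownianVec W P)
    (hI : IsWienerIntegral P W g t I) {i : Fin D} (hm : MemLp (fun ω => I ω i) 2 P) :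
    ∫ ω, I ω i ∂P = 0 := by
  obtain ⟨φ, -, h⟩ := hI
  have h1 := tendsto_integral_mul_of_tendsto_eLpNorm (fun k => (φ k).memLp_integral hW t i)
    (fun _ => memLp_const (1 : ℝ)) hm (memLp_const (1 : ℝ)) (tendsto_eLpNorm_coord h i)
    (by simp)
  simp only [mul_one, StepFn.integral_integral_eq_zero _ hW] at h1
  exact tendsto_nhds_unique h1 tendsto_const_nhds |>.trans rfl

/-- A Wiener integral is uncorrelated with every variable that is independent of the Brownian
motion. -/
theorem IsWienerIntegral.integral_mul_of_indepFun (hW : IsBrownianVec W P)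
    (hI : IsWienerIntegral P W g t I) {i : Fin D} (hm : MemLp (fun ω => I ω i) 2 P)
    {U : Ω → ℝ} (hU : MemLp U 2 P) (hind : IndepFun U (fun (ω : Ω) (t : ℝ≥0) => W t ω) P) :
    ∫ ω, I ω i * U ω ∂P = 0 := by
  obtain ⟨φ, -, h⟩ := hI
  have h1 := tendsto_integral_mul_of_tendsto_eLpNorm (fun k => (φ k).memLp_integral hW t i)
    (fun _ => hU) hm hU (tendsto_eLpNorm_coord h i) (by simp)
  simp only [StepFn.integral_mul_integral_of_indepFun _ hW t i hU hind] at h1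
  exact tendsto_nhds_unique h1 tendsto_const_nhds

/-- The Itô isometry for Wiener integrals, in polarized form and for different upper limits. -/
theorem IsWienerIntegral.integral_mul [IsProbabilityMeasure P] (hW : IsBrownianVec W P)
    (hI : IsWienerIntegral P W g s I) (hJ : IsWienerIntegral P W g t J)
    (hg : AEStronglyMeasurable g (volume.restrict (Set.Ioc 0 (max s t : ℝ)))) {i j : Fin D}
    (hIm : MemLp (fun ω => I ω i) 2 P) (hJm : MemLp (fun ω => J ω j) 2 P) :
    ∫ ω, I ω i * J ω j ∂P =
      if i = j then ∫ x in Set.Ioc 0 (min s t : ℝ), g x ^ 2 else 0 := by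
  obtain ⟨φ, hφ, hφI⟩ := hI
  obtain ⟨χ, hχ, hχJ⟩ := hJ
  have h1 := tendsto_integral_mul_of_tendsto_eLpNorm (fun k => (φ k).memLp_integral hW s i)
    (fun k => (χ k).memLp_integral hW t j) hIm hJm (tendsto_eLpNorm_coord hφI i)
    (tendsto_eLpNorm_coord hχJ j)
  refine tendsto_nhds_unique h1 ?_
  simp only [StepFn.integral_mul_integral _ _ hW]
  split_ifs with hij
  · have hres : ∀ {r : ℝ≥0} {φ : ℕ → StepFn}, (min s t : ℝ) ≤ r →
        Tendsto (fun k => eLpNorm (fun x => (φ k).eval x - g x) 2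
          (volume.restrict (Set.Ioc 0 (r : ℝ)))) atTop (𝓝 0) →
        Tendsto (fun k => eLpNorm (fun x => (φ k).eval x - g x) 2
          (volume.restrict (Set.Ioc 0 (min s t : ℝ)))) atTop (𝓝 0) := by
      intro r φ hr h
      exact tendsto_of_tendsto_of_tendsto_of_le_of_le tendsto_const_nhds h
        (fun _ => zero_le) fun k => eLpNorm_mono_measure _
          (Measure.restrict_mono (Set.Ioc_subset_Ioc_right hr) le_rfl)
    have hgm : AEStronglyMeasurable g (volume.restrict (Set.Ioc 0 (min s t : ℝ))) :=
      hg.mono_measure (Measure.restrict_mono (Set.Ioc_subset_Ioc_right min_le_max) le_rfl)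
    have hφ' := hres (min_le_left _ _) hφ
    have hχ' := hres (min_le_right _ _) hχ
    have hg2 : MemLp g 2 (volume.restrict (Set.Ioc 0 (min s t : ℝ))) :=
      memLp_of_tendsto_eLpNorm (fun k => (φ k).memLp_eval _) hgm hφ'
    have := tendsto_integral_mul_of_tendsto_eLpNorm (fun k => (φ k).memLp_eval _)
      (fun k => (χ k).memLp_eval _) hg2 hg2 hφ' hχ'
    simpa only [sq] using this
  · exact tendsto_const_nhds

end BrownianVec

end LatentDiffusion

/-! ### Linear equations driven by noise with uncorrelated increments -/

section LinearEquation

variable {ι Ω : Type*} [MeasurableSpace Ω] {P : Measure Ω} {T : ℝ}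

/-- The pathwise solution of `y = y₀ + ξ + ∫ α y` by the integrating factor `ψ = ψ(0) - ∫ α ψ`. -/
theorem mul_eq_of_integral_equation {y ξ α ψ : ℝ → ℝ} {t : ℝ} (ht : 0 ≤ t)
    (hy : IntervalIntegrable (fun s => α s * y s) volume 0 t)
    (hψi : IntervalIntegrable (fun s => α s * ψ s) volume 0 t)
    (hψ : ∀ s ∈ Set.Icc 0 t, ψ s = ψ 0 - ∫ x in (0 : ℝ)..s, α x * ψ x)
    (hξ : ∀ s ∈ Set.Icc 0 t, ξ s = y s - y 0 - ∫ x in (0 : ℝ)..s, α x * y x) :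
    y t * ψ t = ψ 0 * y 0 + (ψ t * ξ t + ∫ s in (0 : ℝ)..t, α s * ψ s * ξ s) := by
  have h := intervalIntegral_primitive_mul_add hy hψi.neg (y 0) (ψ 0)
  have e : ∫ x in (0 : ℝ)..t, (α x * y x * (ψ 0 + ∫ s in (0 : ℝ)..x, (-fun s => α s * ψ s) s) +
      (y 0 + ∫ s in (0 : ℝ)..x, α s * y s) * (-fun s => α s * ψ s) x) =
      ∫ s in (0 : ℝ)..t, α s * ψ s * ξ s := by
    refine intervalIntegral.integral_congr fun s hs => ?_
    rw [Set.uIcc_of_le ht] at hs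
    simp only [Pi.neg_apply, intervalIntegral.integral_neg]
    rw [← sub_eq_add_neg, ← hψ s hs, hξ s hs]
    ring
  rw [e] at h
  simp only [Pi.neg_apply, intervalIntegral.integral_neg, ← sub_eq_add_neg] at h
  rw [h, ← hψ t ⟨ht, le_rfl⟩, hξ t ⟨ht, le_rfl⟩]
  ring

/-- First and second moments of the noise part `R_t = ψ(t) ξ_t + ∫₀ᵗ κ ξ ds` of the solution of a
linear equation, where `κ = -ψ'`; this is `∫₀ᵗ ψ dξ` after integration by parts. The driving
processes `ξ k` are only assumed to have the covariances of independent time-changed Brownian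
motions, so that the Itô isometry for `R_t` follows by Fubini's theorem. -/
theorem moments_of_linear_equation [SFinite P] [DecidableEq ι] {ξ : ι → ℝ → Ω → ℝ}
    {κ ψ : ι → ℝ → ℝ} {g : ℝ → ℝ}
    (hκ : ∀ k, IntervalIntegrable (κ k) volume 0 T)
    (hψ : ∀ k, ∀ s ∈ Set.Icc 0 T, ψ k s = ψ k 0 - ∫ x in (0 : ℝ)..s, κ k x)
    (hg : IntervalIntegrable g volume 0 T) (hg0 : ∀ s, 0 ≤ g s)
    (hξm : ∀ k, ∀ t ∈ Set.Icc 0 T, AEStronglyMeasurable (fun p : ℝ × Ω => ξ k p.1 p.2)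
      ((volume.restrict (Set.Ioc 0 t)).prod P))
    (hξ2 : ∀ k, ∀ s ∈ Set.Icc 0 T, MemLp (ξ k s) 2 P)
    (hcov : ∀ k l, ∀ s ∈ Set.Icc 0 T, ∀ r ∈ Set.Icc 0 T,
      ∫ ω, ξ k s ω * ξ l r ω ∂P = if k = l then ∫ x in (0 : ℝ)..min s r, g x else 0)
    {t : ℝ} (ht : t ∈ Set.Icc 0 T) :
    (∀ k, MemLp (fun ω => ψ k t * ξ k t ω + ∫ s in (0 : ℝ)..t, κ k s * ξ k s ω) 2 P) ∧
    (∀ k (U : Ω → ℝ), MemLp U 2 P → (∀ s ∈ Set.Icc 0 T, ∫ ω, ξ k s ω * U ω ∂P = 0) →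
      ∫ ω, (ψ k t * ξ k t ω + ∫ s in (0 : ℝ)..t, κ k s * ξ k s ω) * U ω ∂P = 0) ∧
    ∀ k l, ∫ ω, (ψ k t * ξ k t ω + ∫ s in (0 : ℝ)..t, κ k s * ξ k s ω) *
      (ψ l t * ξ l t ω + ∫ s in (0 : ℝ)..t, κ l s * ξ l s ω) ∂P =
        if k = l then ∫ s in (0 : ℝ)..t, ψ k s ^ 2 * g s else 0 := by
  have hsub : ∀ {s}, s ∈ Set.Icc 0 t → s ∈ Set.Icc 0 T := fun hs => ⟨hs.1, hs.2.trans ht.2⟩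
  have hmono : ∀ {f : ℝ → ℝ}, IntervalIntegrable f volume 0 T → ∀ {a b : ℝ}, a ∈ Set.Icc 0 T →
      b ∈ Set.Icc 0 T → IntervalIntegrable f volume a b := by
    intro f hf a b ha hb
    refine hf.mono_set (Set.uIcc_subset_uIcc ?_ ?_) <;> rw [Set.uIcc_of_le (ha.1.trans ha.2)] <;>
      assumption
  have h0 : (0 : ℝ) ∈ Set.Icc 0 T := ⟨le_rfl, ht.1.trans ht.2⟩
  have hB : ∀ k, ∀ s ∈ Set.Icc 0 t, ∫ ω, ξ k s ω ^ 2 ∂P ≤ ∫ x in (0 : ℝ)..t, g x := by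
    intro k s hs
    have := hcov k k s (hsub hs) s (hsub hs)
    simp only [if_pos, min_self, ← sq] at this
    rw [this]
    exact intervalIntegral.integral_mono_interval le_rfl hs.1 hs.2
      (Eventually.of_forall hg0) (hmono hg h0 ht)
  have hF := fun k => memLp_intervalIntegral_mul_and_integral_eq ht.1 (hmono (hκ k) h0 ht)
    (hξm k t ht) (fun s hs => hξ2 k s (hsub hs)) (hB k)
  have hR : ∀ k, MemLp (fun ω => ψ k t * ξ k t ω + ∫ s in (0 : ℝ)..t, κ k s * ξ k s ω) 2 P :=
    fun k => ((hξ2 k t ht).const_mul _).add (hF k).1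
  have hU : ∀ k (U : Ω → ℝ), MemLp U 2 P →
      ∫ ω, (ψ k t * ξ k t ω + ∫ s in (0 : ℝ)..t, κ k s * ξ k s ω) * U ω ∂P =
        ψ k t * (∫ ω, ξ k t ω * U ω ∂P) + ∫ s in (0 : ℝ)..t, κ k s * ∫ ω, ξ k s ω * U ω ∂P := by
    intro k U hU
    rw [← (hF k).2 U hU, ← integral_const_mul]
    have i1 : Integrable (fun ω => ψ k t * (ξ k t ω * U ω)) P :=
      ((hξ2 k t ht).integrable_mul hU).const_mul _
    have i2 : Integrable (fun ω => (∫ s in (0 : ℝ)..t, κ k s * ξ k s ω) * U ω) P :=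
      (hF k).1.integrable_mul hU
    rw [← integral_add i1 i2]
    congr 1; ext ω; ring
  -- integration by parts against a primitive `F` of `f`
  have hparts : ∀ k (f : ℝ → ℝ), IntervalIntegrable f volume 0 T → ∀ r ∈ Set.Icc 0 t,
      ψ k r * (∫ x in (0 : ℝ)..r, f x) + ∫ s in (0 : ℝ)..r, κ k s * ∫ x in (0 : ℝ)..s, f x =
        ∫ s in (0 : ℝ)..r, ψ k s * f s := by
    intro k f hf r hr
    have hf' := hmono hf h0 (hsub hr)
    have hκ' := hmono (hκ k) h0 (hsub hr)
    have hψc : ContinuousOn (ψ k) (Set.uIcc 0 r) := by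
      have : ContinuousOn (fun s => ψ k 0 - ∫ x in (0 : ℝ)..s, κ k x) (Set.uIcc 0 r) :=
        continuousOn_const.sub
          (intervalIntegral.continuousOn_primitive_interval' hκ' Set.left_mem_uIcc)
      refine this.congr fun s hs => hψ k s ?_
      rw [Set.uIcc_of_le hr.1] at hs
      exact hsub ⟨hs.1, hs.2.trans hr.2⟩
    have i1 : IntervalIntegrable (fun s => ψ k s * f s) volume 0 r := hf'.continuousOn_mul hψc
    have i2 : IntervalIntegrable (fun s => κ k s * ∫ x in (0 : ℝ)..s, f x) volume 0 r :=
      hκ'.mul_continuousOn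
        (intervalIntegral.continuousOn_primitive_interval' hf' Set.left_mem_uIcc)
    have h := intervalIntegral_primitive_mul_add hκ'.neg hf' (ψ k 0) 0
    simp only [Pi.neg_apply, intervalIntegral.integral_neg, ← sub_eq_add_neg, zero_add, mul_zero,
      sub_zero, ← hψ k r (hsub hr)] at h
    have e : ∫ x in (0 : ℝ)..r, (-(κ k x * ∫ s in (0 : ℝ)..x, f s) +
        (ψ k 0 - ∫ s in (0 : ℝ)..x, κ k s) * f x) =
        ∫ x in (0 : ℝ)..r, (ψ k x * f x - κ k x * ∫ s in (0 : ℝ)..x, f s) := by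
      refine intervalIntegral.integral_congr fun s hs => ?_
      rw [Set.uIcc_of_le hr.1] at hs
      rw [← hψ k s (hsub ⟨hs.1, hs.2.trans hr.2⟩)]
      ring
    simp only [neg_mul] at h
    rw [e, intervalIntegral.integral_sub i1 i2] at h
    linarith
  refine ⟨hR, fun k U hU' hz => ?_, fun k l => ?_⟩
  · rw [hU k U hU', hz t ht, mul_zero, zero_add]
    refine (intervalIntegral.integral_congr fun s hs => ?_).trans intervalIntegral.integral_zero
    rw [Set.uIcc_of_le ht.1] at hs
    simp [hz s (hsub hs)]
  · -- the covariance of `R_t` with the noise at an earlier time `r`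
    have h1 : ∀ r ∈ Set.Icc 0 t, ∫ ω, ξ k r ω *
        (ψ l t * ξ l t ω + ∫ s in (0 : ℝ)..t, κ l s * ξ l s ω) ∂P =
        if k = l then ∫ s in (0 : ℝ)..r, ψ k s * g s else 0 := by
      intro r hr
      simp only [mul_comm (ξ k r _)]
      rw [hU l _ (hξ2 k r (hsub hr)), hcov l k t ht r (hsub hr)]
      have e : ∫ s in (0 : ℝ)..t, κ l s * ∫ ω, ξ l s ω * ξ k r ω ∂P =
          ∫ s in (0 : ℝ)..t, κ l s * if l = k then ∫ x in (0 : ℝ)..min s r, g x else 0 := by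
        refine intervalIntegral.integral_congr fun s hs => ?_
        rw [Set.uIcc_of_le ht.1] at hs
        rw [hcov l k s (hsub hs) r (hsub hr)]
      rw [e]
      by_cases hkl : k = l
      · subst hkl
        simp only [if_true, min_eq_right hr.2]
        have hκr := hmono (hκ k) h0 (hsub hr)
        have hκrt := hmono (hκ k) (hsub hr) ht
        have hGc : ContinuousOn (fun s => ∫ x in (0 : ℝ)..min s r, g x) (Set.Icc 0 t) := by
          have := intervalIntegral.continuousOn_primitive_interval' (hmono hg h0 (hsub hr))
            Set.left_mem_uIcc
          refine this.comp (by fun_prop) fun s hs => ?_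
          rw [Set.uIcc_of_le hr.1]
          exact ⟨le_min hs.1 hr.1, min_le_right _ _⟩
        have j1 : IntervalIntegrable (fun s => κ k s * ∫ x in (0 : ℝ)..min s r, g x)
            volume 0 r := by
          refine hκr.mul_continuousOn (hGc.mono ?_)
          rw [Set.uIcc_of_le hr.1]; exact Set.Icc_subset_Icc_right hr.2
        have j2 : IntervalIntegrable (fun s => κ k s * ∫ x in (0 : ℝ)..min s r, g x)
            volume r t := by
          refine hκrt.mul_continuousOn (hGc.mono ?_)
          rw [Set.uIcc_of_le hr.2]; exact Set.Icc_subset_Icc_left hr.1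
        rw [← intervalIntegral.integral_add_adjacent_intervals j1 j2, ← hparts k g hg r hr]
        have e1 : ∫ s in (0 : ℝ)..r, κ k s * ∫ x in (0 : ℝ)..min s r, g x =
            ∫ s in (0 : ℝ)..r, κ k s * ∫ x in (0 : ℝ)..s, g x := by
          refine intervalIntegral.integral_congr fun s hs => ?_
          rw [Set.uIcc_of_le hr.1] at hs
          simp only [min_eq_left hs.2]
        have e2 : ∫ s in r..t, κ k s * ∫ x in (0 : ℝ)..min s r, g x =
            (ψ k r - ψ k t) * ∫ x in (0 : ℝ)..r, g x := by
          have : ∫ s in r..t, κ k s = ψ k r - ψ k t := by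
            rw [hψ k r (hsub hr), hψ k t ht,
              ← intervalIntegral.integral_add_adjacent_intervals hκr hκrt]
            ring
          rw [← this, ← intervalIntegral.integral_mul_const]
          refine intervalIntegral.integral_congr fun s hs => ?_
          rw [Set.uIcc_of_le hr.2] at hs
          simp only [min_eq_right hs.1]
        rw [e1, e2]
        ring
      · simp [hkl, Ne.symm hkl]
    rw [hU k _ (hR l), h1 t ⟨ht.1, le_rfl⟩]
    have e : ∫ s in (0 : ℝ)..t, κ k s * ∫ ω, ξ k s ω *
        (ψ l t * ξ l t ω + ∫ s in (0 : ℝ)..t, κ l s * ξ l s ω) ∂P =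
        ∫ s in (0 : ℝ)..t, κ k s * if k = l then ∫ x in (0 : ℝ)..s, ψ k x * g x else 0 := by
      refine intervalIntegral.integral_congr fun s hs => ?_
      rw [Set.uIcc_of_le ht.1] at hs
      rw [h1 s hs]
    rw [e]
    by_cases hkl : k = l
    · subst hkl
      simp only [if_true]
      have hψc : ContinuousOn (ψ k) (Set.uIcc 0 T) := by
        have : ContinuousOn (fun s => ψ k 0 - ∫ x in (0 : ℝ)..s, κ k x) (Set.uIcc 0 T) :=
          continuousOn_const.sub
            (intervalIntegral.continuousOn_primitive_interval' (hκ k) Set.left_mem_uIcc)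
        refine this.congr fun s hs => hψ k s ?_
        rwa [Set.uIcc_of_le h0.2] at hs
      rw [hparts k _ (hg.continuousOn_mul hψc) t ⟨ht.1, le_rfl⟩]
      refine intervalIntegral.integral_congr fun s _ => ?_
      ring
    · simp [hkl]

end LinearEquation

/-! ### The backward drift in the eigenbasis -/

namespace LatentDiffusion

/-- With `β = exp (x - A)`, the eigenvalue `(1 - β²) + β² r²` of the covariance matrix of the
diffusion that corresponds to the eigenvalue `r²` of the initial one. -/
noncomputable def eigenScale (A r x : ℝ) : ℝ := 1 + Real.exp (x - A) ^ 2 * (r ^ 2 - 1)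

/-- The factor `β / ((1 - β²) + β² r²)` with `β = exp (x - A)`, whose product with a coordinate of
the backward diffusion has no drift. -/
noncomputable def integFactor (A r x : ℝ) : ℝ := Real.exp (x - A) / eigenScale A r x

section Factor

variable {A r x : ℝ}

theorem eigenScale_pos (hr : 0 < r) (hx : x ≤ A) : 0 < eigenScale A r x := by
  have h0 := Real.exp_pos (x - A)
  have h1 : Real.exp (x - A) ≤ 1 := Real.exp_le_one_iff.2 (sub_nonpos.2 hx)
  have h2 : 0 < Real.exp (x - A) ^ 2 * r ^ 2 := by positivity
  rw [eigenScale]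
  nlinarith

theorem integFactor_pos (hr : 0 < r) (hx : x ≤ A) : 0 < integFactor A r x :=
  div_pos (Real.exp_pos _) (eigenScale_pos hr hx)

theorem hasDerivAt_eigenScale : HasDerivAt (eigenScale A r) (2 * (eigenScale A r x - 1)) x := by
  have h1 : HasDerivAt (fun x => Real.exp (x - A)) (Real.exp (x - A)) x := by
    simpa using ((hasDerivAt_id x).sub_const A).exp
  have h2 := ((h1.pow 2).mul_const (r ^ 2 - 1)).const_add 1
  refine h2.congr_deriv ?_
  simp [eigenScale]
  ring

theorem hasDerivAt_integFactor (hr : 0 < r) (hx : x ≤ A) :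
    HasDerivAt (integFactor A r) (-((1 - 2 / eigenScale A r x) * integFactor A r x)) x := by
  have h1 : HasDerivAt (fun x => Real.exp (x - A)) (Real.exp (x - A)) x := by
    simpa using ((hasDerivAt_id x).sub_const A).exp
  have hc := (eigenScale_pos hr hx).ne'
  refine (h1.div hasDerivAt_eigenScale hc).congr_deriv ?_
  rw [integFactor]
  field_simp
  ring

theorem hasDerivAt_integFactor_sq_mul (hr : 0 < r) (hx : x ≤ A) :
    HasDerivAt (fun x => integFactor A r x ^ 2 * eigenScale A r x)
      (2 * integFactor A r x ^ 2) x := by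
  have hc := (eigenScale_pos hr hx).ne'
  refine (((hasDerivAt_integFactor hr hx).pow 2).mul hasDerivAt_eigenScale).congr_deriv ?_
  simp
  field_simp
  ring

variable {h : ℝ → ℝ} {T : ℝ}

/-- Along `H = ∫ h` with `h_s = w_{T-s}²`, the integrating factor `ψ` solves
`ψ' = -h (1 - 2 / c) ψ`, where `h (1 - 2 / c)` is the rate of the backward drift in an
eigendirection. -/
theorem integFactor_primitive (hr : 0 < r) (hh : IntervalIntegrable h volume 0 T)
    (hH : ∀ x ∈ Set.Icc 0 T, ∫ s in (0 : ℝ)..x, h s ∈ Set.Icc 0 A) {t : ℝ}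
    (ht : t ∈ Set.Icc 0 T) :
    integFactor A r (∫ s in (0 : ℝ)..t, h s) = integFactor A r 0 -
      ∫ x in (0 : ℝ)..t, h x * (1 - 2 / eigenScale A r (∫ s in (0 : ℝ)..x, h s)) *
        integFactor A r (∫ s in (0 : ℝ)..x, h s) := by
  have hh' : IntervalIntegrable h volume 0 t := hh.mono_set (by
    rw [Set.uIcc_of_le ht.1, Set.uIcc_of_le (ht.1.trans ht.2)]
    exact Set.Icc_subset_Icc_right ht.2)
  have hc : ContinuousOn (fun y => -((1 - 2 / eigenScale A r y) * integFactor A r y))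
      (Set.Icc 0 A) := by
    have h1 : ContinuousOn (eigenScale A r) (Set.Icc 0 A) := fun y _ =>
      hasDerivAt_eigenScale.continuousAt.continuousWithinAt
    have h2 : ContinuousOn (integFactor A r) (Set.Icc 0 A) := fun y hy =>
      (hasDerivAt_integFactor hr hy.2).continuousAt.continuousWithinAt
    exact ((continuousOn_const.sub (continuousOn_const.div h1
      fun y hy => (eigenScale_pos hr hy.2).ne')).mul h2).neg
  have := intervalIntegral_deriv_comp_primitive hh'
    (fun y hy => hasDerivAt_integFactor hr hy.2) hc fun x hx => by
      rw [Set.uIcc_of_le ht.1] at hx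
      exact hH x ⟨hx.1, hx.2.trans ht.2⟩
  rw [eq_sub_iff_add_eq, ← eq_sub_iff_add_eq', ← neg_sub, ← this, ← intervalIntegral.integral_neg]
  refine intervalIntegral.integral_congr fun s _ => ?_
  ring

/-- The variance `∫ ψ² 2h` of the noise, after multiplication by the integrating factor, is the
increment of `ψ² c`; therefore `c` is the variance of the solution at all times. -/
theorem integral_integFactor_sq (hr : 0 < r) (hh : IntervalIntegrable h volume 0 T)
    (hH : ∀ x ∈ Set.Icc 0 T, ∫ s in (0 : ℝ)..x, h s ∈ Set.Icc 0 A) {t : ℝ}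
    (ht : t ∈ Set.Icc 0 T) :
    ∫ x in (0 : ℝ)..t, integFactor A r (∫ s in (0 : ℝ)..x, h s) ^ 2 * (2 * h x) =
      integFactor A r (∫ s in (0 : ℝ)..t, h s) ^ 2 * eigenScale A r (∫ s in (0 : ℝ)..t, h s) -
        integFactor A r 0 ^ 2 * eigenScale A r 0 := by
  have hh' : IntervalIntegrable h volume 0 t := hh.mono_set (by
    rw [Set.uIcc_of_le ht.1, Set.uIcc_of_le (ht.1.trans ht.2)]
    exact Set.Icc_subset_Icc_right ht.2)
  have hc : ContinuousOn (fun y => 2 * integFactor A r y ^ 2) (Set.Icc 0 A) := by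
    have h2 : ContinuousOn (integFactor A r) (Set.Icc 0 A) := fun y hy =>
      (hasDerivAt_integFactor hr hy.2).continuousAt.continuousWithinAt
    exact continuousOn_const.mul (h2.pow 2)
  have := intervalIntegral_deriv_comp_primitive hh'
    (fun y hy => hasDerivAt_integFactor_sq_mul hr hy.2) hc fun x hx => by
      rw [Set.uIcc_of_le ht.1] at hx
      exact hH x ⟨hx.1, hx.2.trans ht.2⟩
  rw [← this]
  refine intervalIntegral.integral_congr fun s _ => ?_
  ring

end Factor

section Schedule

variable {w : ℝ → ℝ} {T : ℝ}

theorem intervalIntegrable_comp_sub (hw : IntervalIntegrable (fun s => w s ^ 2) volume 0 T) :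
    IntervalIntegrable (fun s => w (T - s) ^ 2) volume 0 T := by
  simpa using (hw.comp_sub_left T).symm

theorem integral_comp_sub_add (hw : IntervalIntegrable (fun s => w s ^ 2) volume 0 T) {t : ℝ}
    (ht : t ∈ Set.Icc 0 T) :
    (∫ s in (0 : ℝ)..t, w (T - s) ^ 2) + ∫ s in (0 : ℝ)..(T - t), w s ^ 2 =
      ∫ s in (0 : ℝ)..T, w s ^ 2 := by
  have h := intervalIntegral.integral_comp_sub_left (a := 0) (b := t) (fun s => w s ^ 2) T
  rw [sub_zero] at h
  have hT := ht.1.trans ht.2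
  rw [h, add_comm, intervalIntegral.integral_add_adjacent_intervals]
  · refine hw.mono_set (Set.uIcc_subset_uIcc Set.left_mem_uIcc ?_)
    rw [Set.uIcc_of_le hT]; exact ⟨by linarith [ht.2], by linarith [ht.1]⟩
  · refine hw.mono_set (Set.uIcc_subset_uIcc ?_ Set.right_mem_uIcc)
    rw [Set.uIcc_of_le hT]; exact ⟨by linarith [ht.2], by linarith [ht.1]⟩

theorem integral_comp_sub_mem_Icc (hw : IntervalIntegrable (fun s => w s ^ 2) volume 0 T) {t : ℝ}
    (ht : t ∈ Set.Icc 0 T) :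
    ∫ s in (0 : ℝ)..t, w (T - s) ^ 2 ∈ Set.Icc 0 (∫ s in (0 : ℝ)..T, w s ^ 2) := by
  refine ⟨intervalIntegral.integral_nonneg ht.1 fun s _ => sq_nonneg _, ?_⟩
  have h1 := integral_comp_sub_add hw ht
  have h2 : 0 ≤ ∫ s in (0 : ℝ)..(T - t), w s ^ 2 :=
    intervalIntegral.integral_nonneg (sub_nonneg.2 ht.2) fun s _ => sq_nonneg _
  linarith

/-- In the time of the backward diffusion, `eigenScale` is `a² + b² r²` at noise level `T - t`. -/
theorem eigenScale_integral (hw : IntervalIntegrable (fun s => w s ^ 2) volume 0 T) {t : ℝ}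
    (ht : t ∈ Set.Icc 0 T) (r : ℝ) :
    eigenScale (∫ s in (0 : ℝ)..T, w s ^ 2) r (∫ s in (0 : ℝ)..t, w (T - s) ^ 2) =
      noiseScale w (T - t) ^ 2 + (1 - noiseScale w (T - t) ^ 2) * r ^ 2 := by
  rw [noiseScale_sq w (sub_nonneg.2 ht.2), eigenScale, signalScale, ← integral_comp_sub_add hw ht,
    sub_add_cancel_left]
  ring

open Matrix

theorem forwardCov_eq {D : ℕ} {S O : Matrix (Fin D) (Fin D) ℝ} {r : Fin D → ℝ}
    (hO : O ∈ orthogonalGroup (Fin D) ℝ) (hS : S = O * diagonal (fun i => r i ^ 2) * Oᵀ)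
    (hw : IntervalIntegrable (fun s => w s ^ 2) volume 0 T) {t : ℝ} (ht : t ∈ Set.Icc 0 T) :
    forwardCov w S (T - t) = O * diagonal (fun i =>
      eigenScale (∫ s in (0 : ℝ)..T, w s ^ 2) (r i) (∫ s in (0 : ℝ)..t, w (T - s) ^ 2)) * Oᵀ := by
  have hOO : O * Oᵀ = 1 := (mem_orthogonalGroup_iff _ _).1 hO
  have hs := noiseScale_sq w (sub_nonneg.2 ht.2)
  have e : (diagonal fun i => eigenScale (∫ s in (0 : ℝ)..T, w s ^ 2) (r i)
      (∫ s in (0 : ℝ)..t, w (T - s) ^ 2)) = noiseScale w (T - t) ^ 2 • (1 : Matrix _ _ ℝ) +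
      signalScale w (T - t) ^ 2 • diagonal (fun i => r i ^ 2) := by
    ext i j
    by_cases hij : i = j
    · subst hij
      simp [eigenScale_integral hw ht, hs]
    · simp [hij]
  rw [e, forwardCov, mul_add, add_mul, hS]
  simp [hOO]

theorem inv_forwardCov_eq {D : ℕ} {S O : Matrix (Fin D) (Fin D) ℝ} {r : Fin D → ℝ}
    (hO : O ∈ orthogonalGroup (Fin D) ℝ) (hr : ∀ i, 0 < r i)
    (hS : S = O * diagonal (fun i => r i ^ 2) * Oᵀ)
    (hw : IntervalIntegrable (fun s => w s ^ 2) volume 0 T) {t : ℝ} (ht : t ∈ Set.Icc 0 T) :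
    (forwardCov w S (T - t))⁻¹ = O * diagonal (fun i =>
      (eigenScale (∫ s in (0 : ℝ)..T, w s ^ 2) (r i)
        (∫ s in (0 : ℝ)..t, w (T - s) ^ 2))⁻¹) * Oᵀ := by
  refine inv_eq_right_inv ?_
  have hOO : O * Oᵀ = 1 := (mem_orthogonalGroup_iff _ _).1 hO
  rw [forwardCov_eq hO hS hw ht, orthogonal_conj_mul hO, diagonal_mul_diagonal]
  have : ∀ i, eigenScale (∫ s in (0 : ℝ)..T, w s ^ 2) (r i) (∫ s in (0 : ℝ)..t, w (T - s) ^ 2) *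
      (eigenScale (∫ s in (0 : ℝ)..T, w s ^ 2) (r i) (∫ s in (0 : ℝ)..t, w (T - s) ^ 2))⁻¹ = 1 :=
    fun i => mul_inv_cancel₀ (eigenScale_pos (hr i) (integral_comp_sub_mem_Icc hw ht).2).ne'
  simp [this, hOO]

/-- The coordinate of a vector along a column of `O`. -/
noncomputable def columnCoord {D : ℕ} (O : Matrix (Fin D) (Fin D) ℝ) (k : Fin D) :
    EuclideanSpace ℝ (Fin D) →L[ℝ] ℝ :=
  ∑ i, O i k • EuclideanSpace.proj i

theorem columnCoord_apply {D : ℕ} (O : Matrix (Fin D) (Fin D) ℝ) (k : Fin D)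
    (x : EuclideanSpace ℝ (Fin D)) : columnCoord O k x = (Oᵀ *ᵥ x.ofLp) k := by
  simp [columnCoord, mulVec, dotProduct]

theorem sum_mul_columnCoord {D : ℕ} {O : Matrix (Fin D) (Fin D) ℝ}
    (hO : O ∈ orthogonalGroup (Fin D) ℝ) (x : EuclideanSpace ℝ (Fin D)) (i : Fin D) :
    ∑ k, O i k * columnCoord O k x = x i := by
  have hOO : O * Oᵀ = 1 := (mem_orthogonalGroup_iff _ _).1 hO
  have h : (O *ᵥ (Oᵀ *ᵥ x.ofLp)) i = x i := by rw [mulVec_mulVec, hOO, one_mulVec]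
  rw [← h]
  simp only [columnCoord_apply]
  rfl

theorem columnCoord_toEuclideanCLM {D : ℕ} {O : Matrix (Fin D) (Fin D) ℝ}
    (hO : O ∈ orthogonalGroup (Fin D) ℝ) (d : Fin D → ℝ) (k : Fin D)
    (x : EuclideanSpace ℝ (Fin D)) :
    columnCoord O k (toEuclideanCLM (𝕜 := ℝ) (O * diagonal d * Oᵀ) x) =
      d k * columnCoord O k x := by
  have hOO : Oᵀ * O = 1 := (mem_orthogonalGroup_iff' _ _).1 hO
  simp only [columnCoord_apply, ofLp_toEuclideanCLM]
  rw [mulVec_mulVec, ← mul_assoc, ← mul_assoc, hOO, one_mul, ← mulVec_mulVec, mulVec_diagonal]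

/-- In the eigenbasis of the plug-in covariance matrix the backward drift is diagonal. -/
theorem columnCoord_backwardDrift {D : ℕ} {S O : Matrix (Fin D) (Fin D) ℝ} {r : Fin D → ℝ}
    (hO : O ∈ orthogonalGroup (Fin D) ℝ) (hr : ∀ i, 0 < r i)
    (hS : S = O * diagonal (fun i => r i ^ 2) * Oᵀ)
    (hw : IntervalIntegrable (fun s => w s ^ 2) volume 0 T) {t : ℝ} (ht : t ∈ Set.Icc 0 T)
    (k : Fin D) (x : EuclideanSpace ℝ (Fin D)) :
    columnCoord O k (backwardDrift w T S t x) = w (T - t) ^ 2 *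
      (1 - 2 / eigenScale (∫ s in (0 : ℝ)..T, w s ^ 2) (r k) (∫ s in (0 : ℝ)..t, w (T - s) ^ 2)) *
        columnCoord O k x := by
  rw [backwardDrift, gaussianScore, inv_forwardCov_eq hO hr hS hw ht]
  simp only [map_add, map_smul, map_neg, columnCoord_toEuclideanCLM hO, smul_eq_mul]
  ring

end Schedule

end LatentDiffusion

/-! ### Moments of the backward diffusion -/

namespace LatentDiffusion

open Matrix

section Coordinates

variable {D : ℕ} {Ω : Type*} [MeasurableSpace Ω] {P : Measure Ω} {O : Matrix (Fin D) (Fin D) ℝ}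

theorem columnCoord_eq_sum (O : Matrix (Fin D) (Fin D) ℝ) (k : Fin D)
    (x : EuclideanSpace ℝ (Fin D)) : columnCoord O k x = ∑ i, O i k * x i := by
  simp [columnCoord]

theorem memLp_columnCoord {U : Ω → EuclideanSpace ℝ (Fin D)}
    (hU : ∀ i, MemLp (fun ω => U ω i) 2 P) (k : Fin D) :
    MemLp (fun ω => columnCoord O k (U ω)) 2 P := by
  simp only [columnCoord_eq_sum]
  exact memLp_finsetSum _ fun i _ => (hU i).const_mul _

/-- Second moments transform as a bilinear form under the change of coordinates. -/
theorem integral_columnCoord_mul {U V : Ω → EuclideanSpace ℝ (Fin D)}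
    (hU : ∀ i, MemLp (fun ω => U ω i) 2 P) (hV : ∀ i, MemLp (fun ω => V ω i) 2 P)
    (k l : Fin D) :
    ∫ ω, columnCoord O k (U ω) * columnCoord O l (V ω) ∂P =
      (Oᵀ * (Matrix.of fun i j => ∫ ω, U ω i * V ω j ∂P) * O) k l := by
  have hi : ∀ i j, Integrable (fun ω => (O i k * U ω i) * (O j l * V ω j)) P := fun i j =>
    ((hU i).const_mul _).integrable_mul ((hV j).const_mul _)
  simp only [columnCoord_eq_sum, Finset.sum_mul_sum]
  rw [integral_finsetSum _ fun i _ => integrable_finsetSum _ fun j _ => hi i j]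
  simp only [Matrix.mul_apply, transpose_apply, of_apply, Finset.sum_mul]
  rw [Finset.sum_comm]
  refine Finset.sum_congr rfl fun i _ => ?_
  rw [integral_finsetSum _ fun j _ => hi i j]
  refine Finset.sum_congr rfl fun j _ => ?_
  rw [← integral_const_mul, ← integral_mul_const]
  congr 1; ext ω; ring

theorem moments_of_hasLaw_multivariateGaussian (hO : O ∈ orthogonalGroup (Fin D) ℝ)
    {c : Fin D → ℝ} (hc : ∀ i, 0 ≤ c i) {Z : Ω → EuclideanSpace ℝ (Fin D)}
    (hZ : HasLaw Z (multivariateGaussian 0 (O * diagonal c * Oᵀ)) P) :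
    (∀ k, MemLp (fun ω => columnCoord O k (Z ω)) 2 P) ∧
    (∀ k, ∫ ω, columnCoord O k (Z ω) ∂P = 0) ∧
    ∀ k l, ∫ ω, columnCoord O k (Z ω) * columnCoord O l (Z ω) ∂P = if k = l then c k else 0 := by
  have hOO : Oᵀ * O = 1 := (mem_orthogonalGroup_iff' _ _).1 hO
  set γ := multivariateGaussian 0 (O * diagonal c * Oᵀ) with hγ
  have hLp : ∀ i, MemLp (fun x : EuclideanSpace ℝ (Fin D) => x i) 2 γ := fun i =>
    IsGaussian.memLp_dual γ (EuclideanSpace.proj i) 2 (by simp)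
  have hmean : ∀ L : EuclideanSpace ℝ (Fin D) →L[ℝ] ℝ, ∫ x, L x ∂γ = 0 := by
    intro L
    have := L.integral_comp_id_comm (μ := γ) IsGaussian.integrable_id
    rw [this, hγ]
    simp
  have hcov : ∀ i j, ∫ x : EuclideanSpace ℝ (Fin D), x i * x j ∂γ = (O * diagonal c * Oᵀ) i j := by
    intro i j
    have h1 := covariance_eval_multivariateGaussian (μ := 0) (posSemidef_conj_diagonal O hc) i j
    rw [← hγ, covariance_eq_sub (hLp i) (hLp j)] at h1
    have h2 : ∫ x : EuclideanSpace ℝ (Fin D), x i ∂γ = 0 := hmean (EuclideanSpace.proj i)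
    rw [h2, zero_mul, sub_zero] at h1
    exact h1
  have hLp' : ∀ i, MemLp (fun ω => Z ω i) 2 P := fun i => by
    have := hLp i
    rw [← hZ.map_eq] at this
    exact this.comp_of_map hZ.aemeasurable
  refine ⟨memLp_columnCoord hLp', fun k => ?_, fun k l => ?_⟩
  · rw [← hmean (columnCoord O k)]
    exact hZ.integral_comp (f := columnCoord O k)
      (columnCoord O k).continuous.aestronglyMeasurable
  · have e : (Matrix.of fun i j => ∫ ω, Z ω i * Z ω j ∂P) = O * diagonal c * Oᵀ := by
      ext i j
      rw [of_apply, ← hcov i j]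
      exact hZ.integral_comp (f := fun x : EuclideanSpace ℝ (Fin D) => x i * x j)
        (by fun_prop)
    rw [integral_columnCoord_mul hLp' hLp', e, ← mul_assoc, ← mul_assoc, hOO, one_mul, mul_assoc,
      hOO, mul_one, diagonal_apply]

end Coordinates

/-- The coordinates of the backward diffusion in the eigenbasis of the plug-in covariance matrix
are square integrable, centred and uncorrelated, with the variances of the forward diffusion. Each
coordinate solves a linear equation driven by a Wiener integral; the equation is solved pathwise
by an integrating factor. -/
theorem IsBackwardDiffusion.moments {D : ℕ} {Ω : Type*} [MeasurableSpace Ω] {P : Measure Ω}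
    [IsProbabilityMeasure P] {w : ℝ → ℝ} {T : ℝ} {S O : Matrix (Fin D) (Fin D) ℝ}
    {W : ℝ≥0 → Ω → EuclideanSpace ℝ (Fin D)} {Y : ℝ → Ω → EuclideanSpace ℝ (Fin D)}
    (hY : IsBackwardDiffusion P w T S W Y) (hw : IntervalIntegrable (fun s => w s ^ 2) volume 0 T)
    {r : Fin D → ℝ} (hO : O ∈ orthogonalGroup (Fin D) ℝ) (hr : ∀ i, 0 < r i)
    (hS : S = O * diagonal (fun i => r i ^ 2) * Oᵀ) {t : ℝ} (ht : t ∈ Set.Icc 0 T) :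
    (∀ k, MemLp (fun ω => columnCoord O k (Y t ω)) 2 P) ∧
    (∀ k, ∫ ω, columnCoord O k (Y t ω) ∂P = 0) ∧
    ∀ k l, ∫ ω, columnCoord O k (Y t ω) * columnCoord O l (Y t ω) ∂P =
      if k = l then noiseScale w (T - t) ^ 2 + (1 - noiseScale w (T - t) ^ 2) * r k ^ 2 else 0 := by
  have hT : 0 ≤ T := ht.1.trans ht.2
  have h0 : (0 : ℝ) ∈ Set.Icc 0 T := ⟨le_rfl, hT⟩
  have hOO : Oᵀ * O = 1 := (mem_orthogonalGroup_iff' _ _).1 hO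
  set A := ∫ s in (0 : ℝ)..T, w s ^ 2 with hA
  set h : ℝ → ℝ := fun s => w (T - s) ^ 2 with hh
  have hhi : IntervalIntegrable h volume 0 T := intervalIntegrable_comp_sub hw
  set H : ℝ → ℝ := fun x => ∫ s in (0 : ℝ)..x, h s with hHdef
  have hH : ∀ x ∈ Set.Icc 0 T, H x ∈ Set.Icc 0 A := fun x hx => integral_comp_sub_mem_Icc hw hx
  have hHc : ContinuousOn H (Set.uIcc 0 T) :=
    intervalIntegral.continuousOn_primitive_interval' hhi Set.left_mem_uIcc
  have hH0 : H 0 = 0 := intervalIntegral.integral_same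
  set c : Fin D → ℝ → ℝ := fun k s => eigenScale A (r k) (H s) with hc
  set ψ : Fin D → ℝ → ℝ := fun k s => integFactor A (r k) (H s) with hψ
  set α : Fin D → ℝ → ℝ := fun k s => h s * (1 - 2 / c k s) with hα
  set y : Fin D → ℝ → Ω → ℝ := fun k s ω => columnCoord O k (Y s ω) with hy
  have hcpos : ∀ k, ∀ s ∈ Set.Icc 0 T, 0 < c k s := fun k s hs => eigenScale_pos (hr k) (hH s hs).2
  have hcc : ∀ k, ContinuousOn (c k) (Set.uIcc 0 T) := fun k =>
    (continuous_iff_continuousAt.2 fun _ => hasDerivAt_eigenScale.continuousAt).comp_continuousOn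
      hHc
  have hψc : ∀ k, ContinuousOn (ψ k) (Set.uIcc 0 T) := by
    intro k s hs
    refine ContinuousAt.comp_continuousWithinAt
      (hasDerivAt_integFactor (hr k) (hH s ?_).2).continuousAt (hHc s hs)
    rwa [Set.uIcc_of_le hT] at hs
  have hαi : ∀ k, IntervalIntegrable (α k) volume 0 T := fun k =>
    hhi.mul_continuousOn (continuousOn_const.sub (continuousOn_const.div (hcc k) fun s hs =>
      (hcpos k s (by rwa [Set.uIcc_of_le hT] at hs)).ne'))
  have hκi : ∀ k, IntervalIntegrable (fun s => α k s * ψ k s) volume 0 T := fun k =>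
    (hαi k).mul_continuousOn (hψc k)
  have hsub : ∀ {f : ℝ → ℝ}, IntervalIntegrable f volume 0 T → ∀ {s : ℝ}, s ∈ Set.Icc 0 T →
      IntervalIntegrable f volume 0 s := by
    intro f hf s hs
    refine hf.mono_set (Set.uIcc_subset_uIcc Set.left_mem_uIcc ?_)
    rwa [Set.uIcc_of_le hT]
  have hψeq : ∀ k, ∀ s ∈ Set.Icc 0 T, ψ k s = ψ k 0 - ∫ x in (0 : ℝ)..s, α k x * ψ k x := by
    intro k s hs
    have := integFactor_primitive (hr k) hhi hH hs
    simp only [hψ, hH0]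
    exact this
  -- the driving noise in the eigenbasis
  set ξ : Fin D → ℝ → Ω → ℝ := fun k s ω =>
    y k s ω - y k 0 ω - ∫ x in (0 : ℝ)..s, α k x * y k x ω with hξ
  set I : ℝ → Ω → EuclideanSpace ℝ (Fin D) := fun s ω =>
    Y s ω - Y 0 ω - ∫ x in (0 : ℝ)..s, backwardDrift w T S x (Y x ω) with hI
  have hymeas : ∀ k, ∀ s ∈ Set.Icc 0 T, AEMeasurable (y k s) P := fun k s hs =>
    (columnCoord O k).continuous.measurable.comp_aemeasurable (hY.aemeasurable s hs)
  have hycont : ∀ k, ∀ᵐ ω ∂P, ContinuousOn (fun s => y k s ω) (Set.Icc 0 T) := by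
    intro k
    filter_upwards [hY.continuous_paths] with ω hω
    exact (columnCoord O k).continuous.comp_continuousOn hω
  have hyint : ∀ k, ∀ᵐ ω ∂P, IntervalIntegrable (fun s => α k s * y k s ω) volume 0 T := by
    intro k
    filter_upwards [hycont k] with ω hω
    refine (hαi k).mul_continuousOn ?_
    rwa [Set.uIcc_of_le hT]
  have hyjoint : ∀ k, ∀ s ∈ Set.Icc 0 T, AEStronglyMeasurable (fun p : ℝ × Ω => y k p.1 p.2)
      ((volume.restrict (Set.Ioc 0 s)).prod P) := fun k s hs =>
    aestronglyMeasurable_uncurry_of_continuousOn (fun x hx => hymeas k x ⟨hx.1, hx.2.trans hs.2⟩)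
      ((hycont k).mono fun ω hω => hω.mono (Set.Icc_subset_Icc_right hs.2))
  have hξmeas : ∀ k, ∀ s ∈ Set.Icc 0 T, AEStronglyMeasurable (ξ k s) P := by
    intro k s hs
    have h1 : AEStronglyMeasurable (fun p : ℝ × Ω => α k p.1 * y k p.1 p.2)
        ((volume.restrict (Set.Ioc 0 s)).prod P) := by
      have h2 : AEStronglyMeasurable (α k) (volume.restrict (Set.Ioc 0 s)) :=
        (hsub (hαi k) hs).1.aestronglyMeasurable
      exact h2.comp_fst.mul (hyjoint k s hs)
    have h3 : AEStronglyMeasurable (fun ω => ∫ x in (0 : ℝ)..s, α k x * y k x ω) P := by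
      simp only [intervalIntegral.integral_of_le hs.1]
      exact h1.prod_swap.integral_prod_right'
    exact ((hymeas k s hs).aestronglyMeasurable.sub (hymeas k 0 h0).aestronglyMeasurable).sub h3
  have hξcont : ∀ k, ∀ᵐ ω ∂P, ContinuousOn (fun s => ξ k s ω) (Set.Icc 0 T) := by
    intro k
    filter_upwards [hycont k, hyint k] with ω h1 h2
    refine (h1.sub continuousOn_const).sub ?_
    have := intervalIntegral.continuousOn_primitive_interval' h2 Set.left_mem_uIcc
    rwa [Set.uIcc_of_le hT] at this
  have hξjoint : ∀ k, ∀ s ∈ Set.Icc 0 T, AEStronglyMeasurable (fun p : ℝ × Ω => ξ k p.1 p.2)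
      ((volume.restrict (Set.Ioc 0 s)).prod P) := fun k s hs =>
    aestronglyMeasurable_uncurry_of_continuousOn
      (fun x hx => (hξmeas k x ⟨hx.1, hx.2.trans hs.2⟩).aemeasurable)
      ((hξcont k).mono fun ω hω => hω.mono (Set.Icc_subset_Icc_right hs.2))
  have hξI : ∀ s ∈ Set.Icc 0 T, ∀ᵐ ω ∂P, ∀ k, columnCoord O k (I s ω) = ξ k s ω := by
    intro s hs
    filter_upwards [hY.integrable_drift] with ω hω k
    have hω' : IntervalIntegrable (fun x => backwardDrift w T S x (Y x ω)) volume 0 s := by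
      refine hω.mono_set (Set.uIcc_subset_uIcc Set.left_mem_uIcc ?_)
      rwa [Set.uIcc_of_le hT]
    simp only [hI, hξ, map_sub, ← ContinuousLinearMap.intervalIntegral_comp_comm _ hω']
    congr 1
    refine intervalIntegral.integral_congr fun x hx => ?_
    rw [Set.uIcc_of_le hs.1] at hx
    exact columnCoord_backwardDrift hO hr hS hw ⟨hx.1, hx.2.trans hs.2⟩ k (Y x ω)
  have hImeas : ∀ s ∈ Set.Icc 0 T, ∀ i, AEStronglyMeasurable (fun ω => I s ω i) P := by
    intro s hs i
    have h1 : AEStronglyMeasurable (fun ω => ∑ k, O i k * ξ k s ω) P :=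
      Finset.aestronglyMeasurable_fun_sum _ fun k _ => (hξmeas k s hs).const_mul _
    refine h1.congr ?_
    filter_upwards [hξI s hs] with ω hω
    simp only [← hω, sum_mul_columnCoord hO]
  have hIW := hY.equation
  have hI2 : ∀ s ∈ Set.Icc 0 T, ∀ i, MemLp (fun ω => I s ω i) 2 P := fun s hs i =>
    (hIW s hs).memLp hY.brownian (hImeas s hs i)
  have hξ2 : ∀ k, ∀ s ∈ Set.Icc 0 T, MemLp (ξ k s) 2 P := fun k s hs =>
    (memLp_columnCoord (hI2 s hs) k).ae_eq ((hξI s hs).mono fun ω hω => hω k)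
  have hξU : ∀ k, ∀ s ∈ Set.Icc 0 T, ∀ U : Ω → ℝ, MemLp U 2 P →
      (∀ i, ∫ ω, I s ω i * U ω ∂P = 0) → ∫ ω, ξ k s ω * U ω ∂P = 0 := by
    intro k s hs U hU hz
    have e : ∫ ω, ξ k s ω * U ω ∂P = ∫ ω, ∑ i, O i k * (I s ω i * U ω) ∂P := by
      refine integral_congr_ae ?_
      filter_upwards [hξI s hs] with ω hω
      rw [← hω, columnCoord_eq_sum, Finset.sum_mul]
      simp only [mul_assoc]
    have hi : ∀ i, Integrable (fun ω => O i k * (I s ω i * U ω)) P := fun i =>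
      ((hI2 s hs i).integrable_mul hU).const_mul _
    rw [e, integral_finsetSum _ fun i _ => hi i]
    refine Finset.sum_eq_zero fun i _ => ?_
    rw [integral_const_mul]
    exact mul_eq_zero_of_right _ (hz i)
  have hgi : IntervalIntegrable (fun s => 2 * h s) volume 0 T := hhi.const_mul 2
  have hξcov : ∀ k l, ∀ s ∈ Set.Icc 0 T, ∀ q ∈ Set.Icc 0 T, ∫ ω, ξ k s ω * ξ l q ω ∂P =
      if k = l then ∫ x in (0 : ℝ)..min s q, 2 * h x else 0 := by
    intro k l s hs q hq
    have e : ∫ ω, ξ k s ω * ξ l q ω ∂P =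
        ∫ ω, columnCoord O k (I s ω) * columnCoord O l (I q ω) ∂P := by
      refine integral_congr_ae ?_
      filter_upwards [hξI s hs, hξI q hq] with ω h1 h2
      rw [h1, h2]
    have hgm : AEStronglyMeasurable (fun s => √(2 * w (T - s) ^ 2))
        (volume.restrict (Set.Ioc 0 (max (s.toNNReal : ℝ) q.toNNReal))) := by
      have h1 := hgi.1.aestronglyMeasurable
      have h2 : AEStronglyMeasurable (fun s => √(2 * w (T - s) ^ 2))
          (volume.restrict (Set.Ioc 0 T)) :=
        Real.continuous_sqrt.comp_aestronglyMeasurable h1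
      refine h2.mono_measure (Measure.restrict_mono (Set.Ioc_subset_Ioc_right ?_) le_rfl)
      rw [Real.coe_toNNReal _ hs.1, Real.coe_toNNReal _ hq.1]
      exact max_le hs.2 hq.2
    have hmat : (Matrix.of fun i j => ∫ ω, I s ω i * I q ω j ∂P) =
        (∫ x in (0 : ℝ)..min s q, 2 * h x) • (1 : Matrix (Fin D) (Fin D) ℝ) := by
      ext i j
      rw [of_apply, (hIW s hs).integral_mul hY.brownian (hIW q hq) hgm (hI2 s hs i) (hI2 q hq j),
        Real.coe_toNNReal _ hs.1, Real.coe_toNNReal _ hq.1, Matrix.smul_apply, one_apply,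
        intervalIntegral.integral_of_le (le_min hs.1 hq.1)]
      have : ∀ x, √(2 * w (T - x) ^ 2) ^ 2 = 2 * h x := fun x => Real.sq_sqrt (by positivity)
      simp only [this]
      split_ifs <;> simp
    rw [e, integral_columnCoord_mul (hI2 s hs) (hI2 q hq), hmat, Matrix.mul_smul, Matrix.smul_mul,
      mul_one, hOO, Matrix.smul_apply, one_apply]
    split_ifs <;> simp
  -- the initial value
  have hinit : HasLaw (Y 0) (multivariateGaussian 0 (O * diagonal (fun k => c k 0) * Oᵀ)) P := by
    have := hY.law_init
    have e := forwardCov_eq hO hS hw h0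
    rw [sub_zero] at e
    rwa [e] at this
  obtain ⟨hy0L, hy0m, hy0c⟩ := moments_of_hasLaw_multivariateGaussian hO
    (fun k => (hcpos k 0 h0).le) hinit
  obtain ⟨hRL, hRU, hRR⟩ := moments_of_linear_equation hκi hψeq hgi
    (fun s => mul_nonneg zero_le_two (sq_nonneg _)) hξjoint hξ2 hξcov ht
  set R : Fin D → Ω → ℝ := fun k ω =>
    ψ k t * ξ k t ω + ∫ s in (0 : ℝ)..t, α k s * ψ k s * ξ k s ω with hR
  have hR1 : ∀ k, ∫ ω, R k ω ∂P = 0 := by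
    intro k
    have := hRU k (fun _ => 1) (memLp_const 1) fun s hs => hξU k s hs _ (memLp_const 1) fun i => by
      simp only [mul_one]
      exact (hIW s hs).integral_eq_zero hY.brownian (hI2 s hs i)
    simpa using this
  have hR0 : ∀ k l, ∫ ω, R k ω * y l 0 ω ∂P = 0 := by
    intro k l
    refine hRU k _ (hy0L l) fun s hs => hξU k s hs _ (hy0L l) fun i => ?_
    exact (hIW s hs).integral_mul_of_indepFun hY.brownian (hI2 s hs i) (hy0L l)
      (hY.indep_init.comp (columnCoord O l).continuous.measurable measurable_id)
  have hsol : ∀ k, ∀ᵐ ω ∂P, y k t ω * ψ k t = ψ k 0 * y k 0 ω + R k ω := by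
    intro k
    filter_upwards [hyint k] with ω hω
    exact mul_eq_of_integral_equation ht.1 (hsub hω ht) (hsub (hκi k) ht)
      (fun s hs => hψeq k s ⟨hs.1, hs.2.trans ht.2⟩) fun s _ => rfl
  have hψpos : ∀ k, ∀ s ∈ Set.Icc 0 T, 0 < ψ k s := fun k s hs => integFactor_pos (hr k) (hH s hs).2
  have hsol' : ∀ k, ∀ᵐ ω ∂P, (ψ k t)⁻¹ * (ψ k 0 * y k 0 ω + R k ω) = y k t ω := by
    intro k
    filter_upwards [hsol k] with ω hω
    rw [← hω, mul_comm (y k t ω), inv_mul_cancel_left₀ (hψpos k t ht).ne']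
  have hZL : ∀ k, MemLp (fun ω => ψ k 0 * y k 0 ω + R k ω) 2 P := fun k =>
    ((hy0L k).const_mul _).add (hRL k)
  refine ⟨fun k => ((hZL k).const_mul _).ae_eq (hsol' k), fun k => ?_, fun k l => ?_⟩
  · rw [← integral_congr_ae (hsol' k), integral_const_mul,
      integral_add (((hy0L k).const_mul _).integrable one_le_two) ((hRL k).integrable one_le_two),
      integral_const_mul, hR1, hy0m]
    simp
  · have e : ∫ ω, y k t ω * y l t ω ∂P = (ψ k t)⁻¹ * (ψ l t)⁻¹ *
        ∫ ω, (ψ k 0 * y k 0 ω + R k ω) * (ψ l 0 * y l 0 ω + R l ω) ∂P := by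
      rw [← integral_const_mul]
      refine integral_congr_ae ?_
      filter_upwards [hsol' k, hsol' l] with ω h1 h2
      rw [← h1, ← h2]
      ring
    have e2 : ∫ ω, (ψ k 0 * y k 0 ω + R k ω) * (ψ l 0 * y l 0 ω + R l ω) ∂P =
        ψ k 0 * ψ l 0 * (∫ ω, y k 0 ω * y l 0 ω ∂P) + ψ l 0 * (∫ ω, R k ω * y l 0 ω ∂P) +
          (ψ k 0 * (∫ ω, R l ω * y k 0 ω ∂P) + ∫ ω, R k ω * R l ω ∂P) := by
      have i1 : Integrable (fun ω => ψ k 0 * ψ l 0 * (y k 0 ω * y l 0 ω)) P :=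
        ((hy0L k).integrable_mul (hy0L l)).const_mul _
      have i2 : Integrable (fun ω => ψ l 0 * (R k ω * y l 0 ω)) P :=
        ((hRL k).integrable_mul (hy0L l)).const_mul _
      have i3 : Integrable (fun ω => ψ k 0 * (R l ω * y k 0 ω)) P :=
        ((hRL l).integrable_mul (hy0L k)).const_mul _
      have i4 : Integrable (fun ω => R k ω * R l ω) P := (hRL k).integrable_mul (hRL l)
      have i12 : Integrable (fun ω => ψ k 0 * ψ l 0 * (y k 0 ω * y l 0 ω) +
        ψ l 0 * (R k ω * y l 0 ω)) P := i1.add i2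
      have i34 : Integrable (fun ω => ψ k 0 * (R l ω * y k 0 ω) + R k ω * R l ω) P := i3.add i4
      rw [← integral_const_mul, ← integral_const_mul, ← integral_const_mul, ← integral_add i1 i2,
        ← integral_add i3 i4, ← integral_add i12 i34]
      congr 1; ext ω; ring
    rw [e, e2, hR0, hR0, hRR, hy0c]
    split_ifs with hkl
    · subst hkl
      have := integral_integFactor_sq (hr k) hhi hH ht
      have hct : c k t = noiseScale w (T - t) ^ 2 + (1 - noiseScale w (T - t) ^ 2) * r k ^ 2 :=
        eigenScale_integral hw ht (r k)
      rw [← hct]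
      have hp := (hψpos k t ht).ne'
      have h3 : ∫ s in (0 : ℝ)..t, ψ k s ^ 2 * (2 * h s) =
          ψ k t ^ 2 * c k t - ψ k 0 ^ 2 * c k 0 := by
        simp only [hψ, hc, hH0]
        exact this
      rw [h3]
      field_simp
      ring
    · simp

/-- The first two moments of the projected diffusion. -/
theorem IsBackwardDiffusion.mean_cov_pcaProj {D : ℕ} {Ω : Type*} [MeasurableSpace Ω]
    {P : Measure Ω} [IsProbabilityMeasure P] {w : ℝ → ℝ} {T : ℝ}
    {S O : Matrix (Fin D) (Fin D) ℝ} {W : ℝ≥0 → Ω → EuclideanSpace ℝ (Fin D)}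
    {Y : ℝ → Ω → EuclideanSpace ℝ (Fin D)}
    (hY : IsBackwardDiffusion P w T S W Y) (hw : IntervalIntegrable (fun s => w s ^ 2) volume 0 T)
    {r : Fin D → ℝ} (hO : O ∈ orthogonalGroup (Fin D) ℝ) (hr : ∀ i, 0 < r i)
    (hS : S = O * diagonal (fun i => r i ^ 2) * Oᵀ) {t : ℝ} (ht : t ∈ Set.Icc 0 T) (d : ℕ) :
    (∫ x, x ∂(P.map fun ω => toEuclideanCLM (𝕜 := ℝ) (pcaProj O d) (Y t ω))) = 0 ∧
    covMatrix (P.map fun ω => toEuclideanCLM (𝕜 := ℝ) (pcaProj O d) (Y t ω)) =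
      truncatedCov O (noiseScale w (T - t) ^ 2) r d := by
  obtain ⟨hL, hm, hc⟩ := hY.moments hw hO hr hS ht
  set V : Ω → EuclideanSpace ℝ (Fin D) := fun ω => toEuclideanCLM (𝕜 := ℝ) (pcaProj O d) (Y t ω)
    with hV
  have hVm : AEMeasurable V P :=
    (toEuclideanCLM (𝕜 := ℝ) (pcaProj O d)).continuous.measurable.comp_aemeasurable
      (hY.aemeasurable t ht)
  set p : Fin D → ℝ := fun k => if k.val < d then 1 else 0 with hp
  have hVi : ∀ i ω, V ω i = ∑ k, O i k * (p k * columnCoord O k (Y t ω)) := by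
    intro i ω
    rw [← sum_mul_columnCoord hO (V ω) i]
    refine Finset.sum_congr rfl fun k _ => ?_
    rw [hV]
    simp only
    rw [pcaProj_eq, columnCoord_toEuclideanCLM hO]
  have hVL : ∀ i, MemLp (fun ω => V ω i) 2 P := by
    intro i
    simp only [hVi]
    exact memLp_finsetSum _ fun k _ => ((hL k).const_mul _).const_mul _
  have hV0 : ∀ i, ∫ ω, V ω i ∂P = 0 := by
    intro i
    simp only [hVi]
    rw [integral_finsetSum _ fun k _ => (((hL k).integrable one_le_two).const_mul _).const_mul _]
    refine Finset.sum_eq_zero fun k _ => ?_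
    rw [integral_const_mul, integral_const_mul, hm, mul_zero, mul_zero]
  constructor
  · rw [integral_map hVm (by fun_prop)]
    ext i
    have hVint : Integrable V P := by
      rw [← memLp_one_iff_integrable]
      exact (MemLp.of_eval_piLp fun i => hVL i).mono_exponent one_le_two
    have h1 : ∫ ω, V ω i ∂P = (∫ ω, V ω ∂P) i :=
      (EuclideanSpace.proj (𝕜 := ℝ) i).integral_comp_comm hVint
    rw [← h1, hV0]
    rfl
  · ext i j
    rw [covMatrix, of_apply, covariance_map_fun (by fun_prop) (by fun_prop) hVm,
      covariance_eq_sub (hVL i) (hVL j), hV0, zero_mul, sub_zero]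
    have hi : ∀ k l, Integrable (fun ω => O i k * (p k * columnCoord O k (Y t ω)) *
        (O j l * (p l * columnCoord O l (Y t ω)))) P := fun k l =>
      (((hL k).const_mul _).const_mul _).integrable_mul (((hL l).const_mul _).const_mul _)
    have hkl : ∀ k l, ∫ ω, O i k * (p k * columnCoord O k (Y t ω)) *
        (O j l * (p l * columnCoord O l (Y t ω))) ∂P =
        O i k * p k * (O j l * p l) * if k = l then
          noiseScale w (T - t) ^ 2 + (1 - noiseScale w (T - t) ^ 2) * r k ^ 2 else 0 := by
      intro k l
      rw [← hc k l, ← integral_const_mul]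
      congr 1; ext ω; ring
    simp only [Pi.mul_apply, hVi, Finset.sum_mul_sum]
    rw [integral_finsetSum _ fun k _ => integrable_finsetSum _ fun l _ => hi k l, truncatedCov,
      Matrix.mul_apply]
    refine Finset.sum_congr rfl fun k _ => ?_
    rw [integral_finsetSum _ fun l _ => hi k l]
    simp only [hkl]
    simp only [mul_diagonal, transpose_apply, mul_ite, mul_zero, Finset.sum_ite_eq,
      Finset.mem_univ, if_true, hp]
    by_cases hk : k.val < d
    · simp only [hk, if_true]
      ring
    · simp [hk]

end LatentDiffusion

/-! ### The thresholded dimension is optimal -/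

namespace LatentDiffusion

open Matrix

theorem spectralSum_nonneg {D : ℕ} (σ : Fin D → ℝ) : 0 ≤ spectralSum σ :=
  Finset.sum_nonneg fun i _ => (sq_nonneg (σ i)).trans (le_max_right _ _)

theorem spectralSum_pos {D : ℕ} {σ : Fin D → ℝ} (hσ : ∀ i, 0 < σ i) (hD : 0 < D) :
    0 < spectralSum σ :=
  Finset.sum_pos (fun i _ => (hσ i).trans_le (le_max_left _ _)) ⟨⟨0, hD⟩, Finset.mem_univ _⟩

theorem exists_pos_le_sq {D : ℕ} {σ : Fin D → ℝ} (hσ : ∀ i, 0 < σ i) :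
    ∃ m : ℝ, 0 < m ∧ ∀ i, m ≤ σ i ^ 2 := by
  rcases isEmpty_or_nonempty (Fin D) with h | h
  · exact ⟨1, one_pos, fun i => h.elim i⟩
  · obtain ⟨i, hi⟩ := Finite.exists_min fun i => σ i ^ 2
    exact ⟨σ i ^ 2, pow_pos (hσ i) 2, hi⟩

/-- Optimality of the thresholded dimension, on the event that the empirical covariance matrix is
close to the true one in the order of quadratic forms. -/
theorem frechetDist_le_of_mem_thresholds {D : ℕ} {Sig O Shat Ohat : Matrix (Fin D) (Fin D) ℝ}
    {σ r : Fin D → ℝ} {T e q : ℝ} {w : ℝ → ℝ} (hσ : ∀ i, 0 < σ i) (hdec : IsSpectralDecomp Sig O σ)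
    (hspec : IsSpectralDecomp Shat Ohat r) (hT : 0 ≤ T)
    (hw : IntervalIntegrable (fun s => w s ^ 2) volume 0 T)
    (hmono : StrictMonoOn (noiseScale w) (Set.Icc 0 T)) (hq : 0 ≤ q)
    (he : e = spectralSum σ * (800 * q))
    (h1 : ((1 + 144 * q) • Sig - Shat).PosSemidef) (h2 : (Shat - (1 - 144 * q) • Sig).PosSemidef)
    (hwell : ∀ i : Fin D, 1 ≤ i.val → 4 * e < r i ^ 2)
    {Ω : Type*} [MeasurableSpace Ω] {P : Measure Ω} [IsProbabilityMeasure P]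
    {W : ℝ≥0 → Ω → EuclideanSpace ℝ (Fin D)} {Y : ℝ → Ω → EuclideanSpace ℝ (Fin D)}
    (hY : IsBackwardDiffusion P w T Shat W Y) {d : ℕ} (hd : d ∈ Set.Icc 1 D)
    (hpos : 0 < lowerThreshold w T r e (d + 1)) {t : ℝ}
    (ht : t ∈ Set.Icc (upperThreshold w T r e d) (lowerThreshold w T r e (d + 1))) {d' : ℕ}
    (hd' : d' ∈ Set.Icc 1 D) :
    frechetDist (P.map fun ω => toEuclideanCLM (𝕜 := ℝ) (pcaProj Ohat d) (Y t ω))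
        (multivariateGaussian 0 Sig) ≤
      frechetDist (P.map fun ω => toEuclideanCLM (𝕜 := ℝ) (pcaProj Ohat d') (Y t ω))
        (multivariateGaussian 0 Sig) := by
  rcases Nat.lt_or_ge D 2 with hD | hD
  · have : d = d' := by
      have := hd.1; have := hd.2; have := hd'.1; have := hd'.2
      omega
    rw [this]
  have htT : t ∈ Set.Icc 0 T := ⟨(upperThreshold_nonneg hT hw r e d).trans ht.1,
    ht.2.trans (lowerThreshold_le hT hw r e _)⟩
  have hS := spectralSum_pos hσ (by omega : 0 < D)
  set s := spectralSum σ with hs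
  have he0 : 0 ≤ e := by rw [he]; positivity
  obtain ⟨hsum2, hsum1⟩ := sum_le_of_isSpectralDecomp (by positivity) hdec hspec h1
  -- Well-defined thresholds force the relative error to be small: `4 S ε < r_D² ≤ (1 + η) S`, where
  -- `η = 144 q` is a fixed fraction of `ε = 800 q`.
  have hlast := hwell ⟨D - 1, by omega⟩ (by simp; omega)
  have hq1 : 144 * q ≤ 1 / 2 := by
    have h3 : r ⟨D - 1, by omega⟩ ^ 2 ≤ ∑ i, r i ^ 2 :=
      Finset.single_le_sum (f := fun i => r i ^ 2) (fun i _ => sq_nonneg _) (Finset.mem_univ _)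
    have h4 : s * (4 * (800 * q)) < s * (1 + 144 * q) := by
      rw [he] at hlast
      linarith
    have h5 := lt_of_mul_lt_mul_left h4 hS.le
    linarith
  have hr : ∀ i, 0 < r i := by
    have h3 : 0 < r ⟨D - 1, by omega⟩ := by
      refine lt_of_le_of_ne (hspec.nonneg _) fun h0 => ?_
      rw [← h0] at hlast
      nlinarith
    exact fun i => h3.trans_le (hspec.antitone (Fin.le_def.2 (by simp; omega)))
  have hSig : Sig.PosSemidef := by
    rw [hdec.eq]; exact posSemidef_conj_diagonal O fun i => sq_nonneg _
  have hup : ((1 + 144 * q) ^ 2 • Sig - Shat).PosSemidef := by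
    have e1 : (1 + 144 * q) ^ 2 • Sig - Shat =
        ((1 + 144 * q) • Sig - Shat) + ((1 + 144 * q) * (144 * q)) • Sig := by
      module
    rw [e1]
    exact h1.add (hSig.smul (by positivity))
  have hlow : ((1 + 144 * q) ^ 2 • Shat - Sig).PosSemidef := by
    have e1 : (1 + 144 * q) ^ 2 • Shat - Sig = (1 + 144 * q) ^ 2 • (Shat - (1 - 144 * q) • Sig) +
        ((1 + 144 * q) ^ 2 * (1 - 144 * q) - 1) • Sig := by
      module
    rw [e1]
    refine (h2.smul (by positivity)).add (hSig.smul ?_)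
    have h0 : 0 ≤ 144 * q := by positivity
    nlinarith [mul_nonneg h0 h0, mul_nonneg h0 (mul_nonneg h0 (sub_nonneg.2 hq1))]
  have ha1 := (noiseScale_sq_lt_one w (sub_nonneg.2 htT.2)).le
  have hΦ := fidelity_bounds (sq_nonneg (noiseScale w (T - t))) ha1 (by positivity) hSig hspec
    hup hlow
  have herr : 144 * q * ∑ i, (r i + r i ^ 2) ≤ e := by
    rw [Finset.sum_add_distrib, he]
    have h3 : ∑ i, r i + ∑ i, r i ^ 2 ≤ 3 * s := by nlinarith
    have h4 : 144 * q * (∑ i, r i + ∑ i, r i ^ 2) ≤ 144 * q * (3 * s) := by gcongr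
    nlinarith [mul_nonneg hq hS.le]
  have key := latentCost_le_of_mem_thresholds hT hw hmono hspec.nonneg hspec.antitone
    (by positivity) (by linarith) he0 hΦ herr hwell hd hpos ht hd'
  have hm := fun k => hY.mean_cov_pcaProj hw hspec.orthogonal hr hspec.eq htT k
  rw [frechetDist_eq_sqrt_latentCost hSig hspec.orthogonal (hm d).1 (hm d).2,
    frechetDist_eq_sqrt_latentCost hSig hspec.orthogonal (hm d').1 (hm d').2]
  exact Real.sqrt_le_sqrt (by linarith)

end LatentDiffusion

theorem proposition7 :
    ∃ C : ℝ, 0 < C ∧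
    ∀ (D : ℕ) (Sig O : Matrix (Fin D) (Fin D) ℝ) (σ : Fin D → ℝ),
      O ∈ Matrix.orthogonalGroup (Fin D) ℝ → StrictAnti σ → (∀ i, 0 < σ i) →
      Sig = O * Matrix.diagonal (fun i => σ i ^ 2) * O.transpose →
    ∃ ε₀ : ℝ, 0 < ε₀ ∧
    ∀ (T : ℝ) (w : ℝ → ℝ), 0 < T →
      IntervalIntegrable (fun s => w s ^ 2) volume 0 T →
      StrictMonoOn (noiseScale w) (Set.Icc 0 T) →
    ∀ (n : ℕ), 0 < n →
    ∀ {Ω : Type*} [MeasurableSpace Ω] (μ : Measure Ω) [IsProbabilityMeasure μ]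
      (X : Fin n → Ω → EuclideanSpace ℝ (Fin D)),
      iIndepFun X μ → (∀ i, HasLaw (X i) (multivariateGaussian 0 Sig) μ) →
    ∀ u : ℝ, 0 ≤ u →
    ∃ E : Set Ω, MeasurableSet E ∧ 1 - 2 * Real.exp (-u) ≤ μ.real E ∧
      ∀ ω ∈ E, ∀ (Ohat : Matrix (Fin D) (Fin D) ℝ) (σhat : Fin D → ℝ),
        IsSpectralDecomp (empCov (fun i => X i ω)) Ohat σhat →
        -- the thresholds are well defined as soon as the estimation error is small enough
        (estError C D n u ≤ ε₀ →
          ∀ i : Fin D, 1 ≤ i.val → 4 * (spectralSum σ * estError C D n u) < σhat i ^ 2) ∧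
        -- whenever they are well defined, the projection is optimal on the stated interval
        ((∀ i : Fin D, 1 ≤ i.val → 4 * (spectralSum σ * estError C D n u) < σhat i ^ 2) →
          ∀ {Ω' : Type*} [MeasurableSpace Ω'] (P : Measure Ω') [IsProbabilityMeasure P]
            (W : ℝ≥0 → Ω' → EuclideanSpace ℝ (Fin D))
            (Y : ℝ → Ω' → EuclideanSpace ℝ (Fin D)),
            IsBackwardDiffusion P w T (empCov (fun i => X i ω)) W Y →
          ∀ d ∈ Set.Icc 1 D,
            0 < lowerThreshold w T σhat (spectralSum σ * estError C D n u) (d + 1) →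
          ∀ t ∈ Set.Icc
              (upperThreshold w T σhat (spectralSum σ * estError C D n u) d)
              (lowerThreshold w T σhat (spectralSum σ * estError C D n u) (d + 1)),
            IsLeast
              ((fun d' : ℕ => frechetDist
                (P.map (fun ω' => Matrix.toEuclideanCLM (𝕜 := ℝ) (pcaProj Ohat d') (Y t ω')))
                (multivariateGaussian 0 Sig)) '' Set.Icc 1 D)
              (frechetDist
                (P.map (fun ω' => Matrix.toEuclideanCLM (𝕜 := ℝ) (pcaProj Ohat d) (Y t ω')))
                (multivariateGaussian 0 Sig))) := by
  -- with `C = 300`, `ε_u = 800 q`, while the relative error of the covariance matrix is `144 q`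
  refine ⟨300, by norm_num, fun D Sig O σ hO hσanti hσ hSig => ?_⟩
  obtain ⟨m, hm, hmσ⟩ := exists_pos_le_sq hσ
  have hS := spectralSum_nonneg σ
  have hdec : IsSpectralDecomp Sig O σ := ⟨hO, fun i => (hσ i).le, hσanti.antitone, hSig⟩
  refine ⟨min 1 (m / (16 * (spectralSum σ + 1))), by positivity, ?_⟩
  intro T w hT hw hmono n hn Ω _ μ _ X hX hlaw u hu
  obtain ⟨E, hE, hμE, hclose⟩ := exists_event_empCov_close hn hO hσ hSig hX hlaw hu
  refine ⟨E, hE, hμE, fun ω hω Ohat r hspec => ?_⟩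
  obtain ⟨h1, h2⟩ := hclose ω hω
  set q := √((D + u) / n) + (D + u) / n with hq
  have hq0 : 0 ≤ q := by positivity
  have hest : estError 300 D n u = 800 * q := by rw [estError, hq]; ring
  constructor
  · intro hε i _
    rw [hest] at hε ⊢
    have h3 : 800 * q ≤ 1 := hε.trans (min_le_left _ _)
    have h4 : 800 * q * (16 * (spectralSum σ + 1)) ≤ m :=
      (le_div_iff₀ (by positivity)).1 (hε.trans (min_le_right _ _))
    have h5 := le_sq_of_isSpectralDecomp (by linarith) hdec hspec hmσ h2 i
    nlinarith
  · intro hwell Ω' _ P _ W Y hY d hd hpos t ht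
    refine ⟨⟨d, hd, rfl⟩, ?_⟩
    rintro _ ⟨d', hd', rfl⟩
    exact frechetDist_le_of_mem_thresholds hσ hdec hspec hT.le hw hmono hq0 (by rw [hest]) h1 h2
      hwell hY hd hpos ht hd'
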